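/- Conventions. For a finite set $S$, let $S^{\pm}=S\sqcup S^{-1}$ be the set of formal letters and their formal inverses. An automaton $\Sigma=(V,E)$ over $S^{\pm}$ is a finite directed graph (loops and multiple edges allowed) with edges labelled by $S^{\pm}$ and a distinguished start vertex $\mathfrak s$; its accepted language $\mathcal L_\Sigma$ is the set of labels of directed paths beginning at $\mathfrak s$ (the trivial path is allowed, so the empty word belongs to $\mathcal L_\Sigma$). It is deterministic if distinct edges going out of the same vertex have distinct labels. A CAT(0) cube complex is a simply connected cube complex in which the link of every vertex is a flag simplicial complex. A group has property $FW_n$ if each of its actions (by combinatorial automorphisms) on an $n$-dimensional CAT(0) cube complex $X$ fixes a point of $X$ (not necessarily a vertex). For a set $R$ of words over $S^{\pm}$, let $R^*$ be the set of all cyclic permutations of elements of $R$ and of their inverses; a piece is a common initial segment of two distinct elements of $R^*$. The set $R$ satisfies $C'(\lambda)$ if its elements are nonempty and cyclically reduced, and $|b|<\lambda|u|$ whenever a piece $b$ is an initial segment of an element $u\in R^*$. Theorem. For every integer $n>0$ there are constants $0<c_1,c_2<1$ and $K\in\mathbb N$, depending only on $n$, such that for every finite set $S$ there is a finite set $\mathbf\Sigma$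 of automata over $S^{\pm}$ with the following properties. 1. For every set $R$ of words over $S^{\pm}$ that contains, for each $\Sigma\in\mathbf\Sigma$, at least one nonempty word of $\mathcal L_\Sigma$, the group $\langle S\mid R\rangle$ has $FW_n$. 2. Every $\Sigma=(V,E)\in\mathbf\Sigma$ is deterministic and has one of the following two forms: - $V=\{\mathfrak s,v\}$ has two elements, and the edges of $\Sigma$ are two edges from $\mathfrak s$ to $v$ labelled $s$ and $s^{-1}$ for some $s\in S$, and exactly $\lceil c_1|S^{\pm}|\rceil$ loops at $v$ with labels in $S^{\pm}-\{s,s^{-1}\}$; - $\mathfrak s$ has exactly $\lceil (1-c_1)|S^{\pm}|\rceil$ outgoing edges, none of which is a loop, and every vertex $v\in V-\{\mathfrak s\}$ has exactly $\lceil c_2|S^{\pm}|\rceil$ outgoing edges, all of which have their terminal vertex in $V-\{\mathfrak s\}$. 3. If $|S^{\pm}|\ge K$, then for every real $p\ge 1$ one can choose a word in $\mathcal L_\Sigma$ for each $\Sigma\in\mathbf\Sigma$ so that the set of chosen words satisfies $C'(1/p)$. -/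

import Mathlib

universe u v w

/-! ## Cube complexes -/

/-- A combinatorial isomorphism of the cube `[0,1]^m` onto a face of the cube `[0,1]^n`, recorded by
its effect on the corners `{0,1}^m → {0,1}^n`. These are precisely the maps of corners that preserve
the Hamming (that is, the edge-path) distance. -/
@[ext]
structure CubeMap (m n : ℕ) where
  toFun : (Fin m → Bool) → (Fin n → Bool)
  isometry : ∀ a b, hammingDist (toFun a) (toFun b) = hammingDist a b

namespace CubeMap

/-- The identity of the `n`-cube. -/
def id (n : ℕ) : CubeMap n n := ⟨fun a => a, fun _ _ => rfl⟩

/-- Composition of face maps. -/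
def comp {l m n : ℕ} (f : CubeMap m n) (g : CubeMap l m) : CubeMap l n :=
  ⟨fun a => f.toFun (g.toFun a), fun a b => by rw [f.isometry, g.isometry]⟩

/-- The corner `v` of the `n`-cube, as a `0`-dimensional face. -/
def vertex {n : ℕ} (v : Fin n → Bool) : CubeMap 0 n :=
  ⟨fun _ => v, fun a b => by rw [Subsingleton.elim a b]; simp⟩

/-- The oriented edge of the `n`-cube that starts at the corner `v` and runs in the `i`-th
coordinate direction. -/
def edge {n : ℕ} (v : Fin n → Bool) (i : Fin n) : CubeMap 1 n :=
  ⟨fun b => if b 0 then Function.update v i (!(v i)) else v, fun a b => by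
    have key : hammingDist (Function.update v i (!(v i))) v = 1 := by
      unfold hammingDist
      rw [Finset.card_eq_one]
      refine ⟨i, ?_⟩
      ext j
      by_cases h : j = i
      · subst h; simp
      · simp [h]
    have h1 : hammingDist a b = if a 0 = b 0 then 0 else 1 := by
      unfold hammingDist
      rw [Finset.card_filter]
      simp
    rw [h1]
    cases ha : a 0 <;> cases hb : b 0 <;> simp [key, hammingDist_comm v]⟩

/-- The extension of a face map to a map `[0,1]^m → [0,1]^n` of solid cubes that is affine in each
coordinate. The `j`-th coordinate is the average of the `j`-th coordinates of the images of the
corners, the corner `v` being weighted by `∏ i, (if v i then t i else 1 - t i)`. -/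
noncomputable def extend {m n : ℕ} (f : CubeMap m n) (t : Fin m → ℝ) : Fin n → ℝ := fun j =>
  ∑ v : Fin m → Bool, (∏ i, (if v i then t i else 1 - t i)) * (if f.toFun v j then 1 else 0)

end CubeMap

/-- A cube complex: a collection of cubes glued along faces by combinatorial isomorphisms.
`Cube n` is the set of *parametrised* `n`-cubes (each geometric `n`-cube occurs once for each of its
`2^n n!` parametrisations), `face f c` is the face of `c` parametrised through `f`. The last field
says that a cube is not glued to itself by a nontrivial symmetry, so that the `2^n n!`
parametrisations of a geometric cube are distinct. Faces of the same cube may be identified with one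
another, and distinct cubes may have the same faces. -/
structure CubeComplex where
  Cube : ℕ → Type u
  face : {m n : ℕ} → CubeMap m n → Cube n → Cube m
  face_id : ∀ {n : ℕ} (c : Cube n), face (CubeMap.id n) c = c
  face_comp : ∀ {l m n : ℕ} (f : CubeMap m n) (g : CubeMap l m) (c : Cube n),
    face (f.comp g) c = face g (face f c)
  eq_id_of_face_eq : ∀ {n : ℕ} (f : CubeMap n n) (c : Cube n), face f c = c → f = CubeMap.id n

namespace CubeComplex

/-- The `0`-cubes. -/
abbrev Vertex (X : CubeComplex.{u}) : Type u := X.Cube 0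

/-- The oriented `1`-cubes (each `1`-cube occurs with both of its orientations). They are also the
ends of `1`-cubes, that is, the vertices of the links. -/
abbrev Dart (X : CubeComplex.{u}) : Type u := X.Cube 1

/-- The vertex of the cube `c` at the corner `v`. -/
def corner (X : CubeComplex.{u}) {n : ℕ} (v : Fin n → Bool) (c : X.Cube n) : X.Vertex :=
  X.face (CubeMap.vertex v) c

/-- The oriented edge of the cube `c` that starts at the corner `v` in direction `i`. -/
def edgeAt (X : CubeComplex.{u}) {n : ℕ} (v : Fin n → Bool) (i : Fin n) (c : X.Cube n) : X.Dart :=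
  X.face (CubeMap.edge v i) c

/-- The initial vertex of an oriented edge. -/
def src (X : CubeComplex.{u}) (e : X.Dart) : X.Vertex := X.corner (fun _ => false) e

/-- The terminal vertex of an oriented edge. -/
def tgt (X : CubeComplex.{u}) (e : X.Dart) : X.Vertex := X.corner (fun _ => true) e

/-- The same edge with the opposite orientation. -/
def rev (X : CubeComplex.{u}) (e : X.Dart) : X.Dart := X.edgeAt (fun _ => true) 0 e

/-- `X.IsPath x p y`: the oriented edges in the list `p` form a path in the `1`-skeleton
from `x` to `y`. -/
def IsPath (X : CubeComplex.{u}) : X.Vertex → List X.Dart → X.Vertex → Prop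
  | x, [], y => x = y
  | x, e :: p, y => X.src e = x ∧ X.IsPath (X.tgt e) p y

/-- Elementary homotopies of edge paths starting at `x`: deleting a backtrack, and pushing a path
across a square. -/
inductive HomotopyStep (X : CubeComplex.{u}) (x : X.Vertex) : List X.Dart → List X.Dart → Prop
  | backtrack (p q : List X.Dart) (e : X.Dart) (h : X.IsPath x p (X.src e)) :
      HomotopyStep X x (p ++ e :: X.rev e :: q) (p ++ q)
  | square (p q : List X.Dart) (s : X.Cube 2) (h : X.IsPath x p (X.corner ![false, false] s)) :
      HomotopyStep X x
        (p ++ X.edgeAt ![false, false] 0 s :: X.edgeAt ![true, false] 1 s :: q)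
        (p ++ X.edgeAt ![false, false] 1 s :: X.edgeAt ![false, true] 0 s :: q)

/-- Simple connectivity: the complex is nonempty and connected, and its fundamental group, computed
as the group of closed edge paths up to homotopy across the squares, is trivial. -/
structure IsSimplyConnected (X : CubeComplex.{u}) : Prop where
  nonempty : Nonempty X.Vertex
  connected : ∀ x y : X.Vertex, ∃ p, X.IsPath x p y
  nullhomotopic : ∀ (x : X.Vertex) (p : List X.Dart), X.IsPath x p x →
    Relation.EqvGen (X.HomotopyStep x) p []

/-- The corner of a parametrised cube at the origin. Every corner of a cube is of this form for a
suitable parametrisation. -/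
abbrev origin (X : CubeComplex.{u}) {n : ℕ} (c : X.Cube n) : X.Vertex :=
  X.corner (fun _ => false) c

/-- The `n` edges of a parametrised cube at the origin, which are the vertices of the
`(n-1)`-simplex that the corner contributes to the link of the origin. -/
abbrev originEdge (X : CubeComplex.{u}) {n : ℕ} (c : X.Cube n) (i : Fin n) : X.Dart :=
  X.edgeAt (fun _ => false) i c

/-- Adjacency in the link: two ends of edges are the sides of a corner of a square. -/
def LinkAdj (X : CubeComplex.{u}) (e e' : X.Dart) : Prop :=
  ∃ s : X.Cube 2, X.originEdge s 0 = e ∧ X.originEdge s 1 = e'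

/-- Non-positive curvature: the link of every vertex is a flag simplicial complex. The first two
fields say that the link is simplicial (the vertices of a simplex are distinct, and a simplex is
determined by its vertices), the third says that it is flag. -/
structure IsNonPositivelyCurved (X : CubeComplex.{u}) : Prop where
  link_injective : ∀ {n : ℕ} (c : X.Cube n), Function.Injective (X.originEdge c)
  link_unique : ∀ {n : ℕ} (c c' : X.Cube n), X.origin c = X.origin c' →
    (∀ i, X.originEdge c i = X.originEdge c' i) → c = c'
  link_flag : ∀ (x : X.Vertex) {n : ℕ} (e : Fin n → X.Dart), (∀ i, X.src (e i) = x) →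
    Function.Injective e → (∀ i j, i ≠ j → X.LinkAdj (e i) (e j)) →
    ∃ c : X.Cube n, X.origin c = x ∧ ∀ i, X.originEdge c i = e i

/-- A CAT(0) cube complex: simply connected and non-positively curved. -/
structure IsCAT0 (X : CubeComplex.{u}) : Prop where
  simplyConnected : X.IsSimplyConnected
  nonPositivelyCurved : X.IsNonPositivelyCurved

/-- The complex has dimension `n`: this is the maximal dimension of a cube. -/
def HasDim (X : CubeComplex.{u}) (n : ℕ) : Prop :=
  Nonempty (X.Cube n) ∧ ∀ m, n < m → IsEmpty (X.Cube m)

/-- A cube together with a point of the solid cube `[0,1]^n`. -/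
def PrePoint (X : CubeComplex.{u}) : Type u :=
  Σ n : ℕ, X.Cube n × (Fin n → Set.Icc (0 : ℝ) 1)

/-- The identification of the points of a face of a cube with points of the cube. -/
inductive Glue (X : CubeComplex.{u}) : X.PrePoint → X.PrePoint → Prop
  | mk {m n : ℕ} (f : CubeMap m n) (c : X.Cube n) (t : Fin m → Set.Icc (0 : ℝ) 1)
      (t' : Fin n → Set.Icc (0 : ℝ) 1) (h : ∀ j, (t' j : ℝ) = f.extend (fun i => (t i : ℝ)) j) :
      Glue X ⟨m, X.face f c, t⟩ ⟨n, c, t'⟩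

/-- The points of the complex: the disjoint union of the solid cubes `[0,1]^n`, glued along
faces. -/
def Point (X : CubeComplex.{u}) : Type u := Quot X.Glue

/-- An action of a group on a cube complex, by combinatorial automorphisms. -/
structure Action (G : Type v) [Group G] (X : CubeComplex.{u}) where
  smul : G → {n : ℕ} → X.Cube n → X.Cube n
  one_smul : ∀ {n : ℕ} (c : X.Cube n), smul 1 c = c
  mul_smul : ∀ (g h : G) {n : ℕ} (c : X.Cube n), smul (g * h) c = smul g (smul h c)
  smul_face : ∀ (g : G) {m n : ℕ} (f : CubeMap m n) (c : X.Cube n),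
    smul g (X.face f c) = X.face f (smul g c)

/-- The induced action on the points of the complex. -/
def Action.smulPoint {G : Type v} [Group G] {X : CubeComplex.{u}} (a : X.Action G) (g : G) :
    X.Point → X.Point :=
  Quot.map (fun p => ⟨p.1, a.smul g p.2.1, p.2.2⟩) (by
    rintro _ _ ⟨f, c, t, t', h⟩
    simp only [a.smul_face]
    exact Glue.mk f (a.smul g c) t t' h)

/-- Some point of the complex (not necessarily a vertex) is fixed by the whole group. -/
def Action.HasFixedPoint {G : Type v} [Group G] {X : CubeComplex.{u}} (a : X.Action G) : Prop :=
  ∃ p : X.Point, ∀ g : G, a.smulPoint g p = p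

end CubeComplex

/-- Property `FW_n`: every action of the group on an `n`-dimensional CAT(0) cube complex has a global
fixed point. -/
def HasFW (n : ℕ) (G : Type v) [Group G] : Prop :=
  ∀ X : CubeComplex.{u}, X.IsCAT0 → X.HasDim n → ∀ a : X.Action G, a.HasFixedPoint

/-! ## Words and automata -/

/-- The alphabet `S^±` of formal letters `s = (s, true)` and formal inverses `s⁻¹ = (s, false)`. -/
abbrev Letter (S : Type u) : Type u := S × Bool

/-- A finite state automaton over `S^±`: a finite directed graph (loops and multiple edges are
allowed) with edges labelled by `S^±` and a start vertex. -/
structure FinAutomaton (S : Type u) where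
  V : Type
  E : Type
  finite_V : Finite V
  finite_E : Finite E
  src : E → V
  tgt : E → V
  label : E → Letter S
  start : V

namespace FinAutomaton

variable {S : Type u}

/-- The edges in the list `p` form a directed path from `v` to `w`. -/
def IsPath (A : FinAutomaton S) : A.V → List A.E → A.V → Prop
  | v, [], w => v = w
  | v, e :: p, w => A.src e = v ∧ A.IsPath (A.tgt e) p w

/-- The accepted language: all labels of directed paths that begin at the start vertex. -/
def language (A : FinAutomaton S) : Set (List (Letter S)) :=
  {w | ∃ (p : List A.E) (v : A.V), A.IsPath A.start p v ∧ p.map A.label = w}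

/-- The outgoing edges at a vertex. -/
def outEdges (A : FinAutomaton S) (v : A.V) : Set A.E := {e | A.src e = v}

/-- The labelling is deterministic: the outgoing edges at each vertex have distinct labels. -/
def IsDeterministic (A : FinAutomaton S) : Prop :=
  ∀ e e' : A.E, A.src e = A.src e' → A.label e = A.label e' → e = e'

/-- The first form: two vertices `start` and `v`, two edges from `start` to `v`, with labels
`s` and `s⁻¹`, and `⌈c₁ |S^±|⌉` loops at `v` with labels in `S^± - {s, s⁻¹}`. -/
def IsFirstForm (c₁ : ℝ) (A : FinAutomaton S) : Prop :=
  ∃ (v : A.V) (s : S) (e e' : A.E),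
    v ≠ A.start ∧ (∀ u : A.V, u = A.start ∨ u = v) ∧
    (A.src e = A.start ∧ A.tgt e = v ∧ A.label e = (s, true)) ∧
    (A.src e' = A.start ∧ A.tgt e' = v ∧ A.label e' = (s, false)) ∧
    (∀ d : A.E, d = e ∨ d = e' ∨ (A.src d = v ∧ A.tgt d = v ∧ (A.label d).1 ≠ s)) ∧
    (A.outEdges v).ncard = ⌈c₁ * (Nat.card (Letter S) : ℝ)⌉₊

/-- The second form: `start` has `⌈(1 - c₁) |S^±|⌉` outgoing edges, none of which is a loop, and
every other vertex has `⌈c₂ |S^±|⌉` outgoing edges, none of which ends at `start`. -/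
def IsSecondForm (c₁ c₂ : ℝ) (A : FinAutomaton S) : Prop :=
  (A.outEdges A.start).ncard = ⌈(1 - c₁) * (Nat.card (Letter S) : ℝ)⌉₊ ∧
  (∀ e ∈ A.outEdges A.start, A.tgt e ≠ A.start) ∧
  ∀ v : A.V, v ≠ A.start →
    (A.outEdges v).ncard = ⌈c₂ * (Nat.card (Letter S) : ℝ)⌉₊ ∧
    ∀ e ∈ A.outEdges v, A.tgt e ≠ A.start

end FinAutomaton

/-! ## Small cancellation -/

/-- The symmetrised closure: all cyclic permutations of the given words and of their inverses. -/
def symmetrized {S : Type u} (R : Set (List (Letter S))) : Set (List (Letter S)) :=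
  {u | ∃ r ∈ R, u ~r r ∨ u ~r FreeGroup.invRev r}

/-- A piece: a common initial segment of two distinct words of the symmetrised closure. -/
def IsPiece {S : Type u} (R : Set (List (Letter S))) (b : List (Letter S)) : Prop :=
  ∃ u ∈ symmetrized R, ∃ v ∈ symmetrized R, u ≠ v ∧ b <+: u ∧ b <+: v

/-- The condition `C'(lam)` for a set of words: they are nonempty and cyclically reduced, and every
piece is shorter than `lam` times the length of any word of the symmetrised closure of which it is an
initial segment. -/
def SmallCancellation {S : Type u} (lam : ℝ) (R : Set (List (Letter S))) : Prop :=
  (∀ r ∈ R, r ≠ [] ∧ FreeGroup.IsCyclicallyReduced r) ∧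
  ∀ u ∈ symmetrized R, ∀ b, b <+: u → IsPiece R b → (b.length : ℝ) < lam * (u.length : ℝ)

/-! Write `m` for the number of letters. Suppose the presented group acts without a fixed point on
an `n`-dimensional CAT(0) cube complex. The languages are designed so that some automaton among
finitely many contradicts this: each of its nonempty words acts nontrivially, yet one of them is a
relator.

If at least `c₁ m` letters fix a point `p`, some generator `s` still moves `p`. An automaton of the
first form accepts only words consisting of `s` or its inverse followed by letters fixing `p`, and
such a relator would force `s` to fix `p`. Hence every point is fixed by fewer than `c₁ m` letters.

Now take a vertex `x` of least total displacement over all letters. The second form comes from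
finitely many half spaces missing `x`, with the property that each is carried into another of them
by at least `c₂ m` letters, and every vertex is carried into one of them by at least `c₂ m` letters.
Starting with a letter that moves `x` and then following such transitions, a word never returns to
`x` (`Action.exists_states`, `exists_isSecondForm`).

The half spaces are found among those of the edges at `x`, the directions. For a direction `K` and a
letter `a`, either the inverse of `a` moves `x` into `K`, or `aK` lies behind a direction containing
`ax`, or `aK` is again a direction (`trichotomy`). Minimality of `x` bounds the first case, except
for directions inverted by many letters. A maximal family inverted by almost all letters spans a
cube; the letters acting on it only by reversal fix its centre, so they are few and can be
discarded. After a second maximal choice (`exists_core`) the directions play a game: a direction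
wins if many letters keep leading it towards images of `x`. If a target lost, moving it repeatedly
would create `n + 1` pairwise crossing directions at `x`, which a complex of dimension `n` does not
allow (`target_wins`). The number of half spaces is bounded in terms of `n` and `m`, so finitely
many automata suffice for all relator sets.

The facts on half spaces follow from combinatorial non-positive curvature: paths modulo squares have
a normal form as in a right-angled Coxeter group, so two geodesics with the same ends differ by
squares (`swapEq_of_geodesic`).

For small cancellation, the languages contain binary trees of cyclically reduced words. A weight
argument (`exists_avoiding`) selects one long word in each, so that no moderately long subword
recurs in any of the words or their inverses. -/

/-! ### Faces of a cube. -/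

namespace CubeMap

/-- The face of the `n`-cube through the corner `v` in the directions `σ 0, σ 1, …`, parametrised
so that the origin goes to `v`. -/
noncomputable def sub {m n : ℕ} (v : Fin n → Bool) (σ : Fin m → Fin n)
    (hσ : Function.Injective σ) : CubeMap m n where
  toFun a j := if h : ∃ i, σ i = j then xor (v j) (a h.choose) else v j
  isometry a b := by
    have key : ∀ c : Fin m → Bool, ∀ i, (if h : ∃ i', σ i' = σ i then xor (v (σ i)) (c h.choose)
        else v (σ i)) = xor (v (σ i)) (c i) := by
      intro c i
      have h : ∃ i', σ i' = σ i := ⟨i, rfl⟩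
      rw [dif_pos h, hσ h.choose_spec]
    unfold hammingDist
    symm
    apply Finset.card_bij (fun i _ => σ i)
    · intro i hi
      simp only [Finset.mem_filter, Finset.mem_univ, true_and, ne_eq] at hi ⊢
      rw [key, key]
      simpa using hi
    · intro i _ j _ h
      exact hσ h
    · intro j hj
      simp only [Finset.mem_filter, Finset.mem_univ, true_and, ne_eq] at hj
      by_cases h : ∃ i, σ i = j
      · obtain ⟨i, rfl⟩ := h
        rw [key, key] at hj
        exact ⟨i, by simpa using hj, rfl⟩
      · simp [h] at hj

theorem sub_apply {m n : ℕ} (v : Fin n → Bool) (σ : Fin m → Fin n)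
    (hσ : Function.Injective σ) (a : Fin m → Bool) (i : Fin m) :
    (sub v σ hσ).toFun a (σ i) = xor (v (σ i)) (a i) := by
  have h : ∃ i', σ i' = σ i := ⟨i, rfl⟩
  simp only [sub]
  rw [dif_pos h, hσ h.choose_spec]

theorem sub_apply_of_notMem {m n : ℕ} (v : Fin n → Bool) (σ : Fin m → Fin n)
    (hσ : Function.Injective σ) (a : Fin m → Bool) (j : Fin n) (hj : ∀ i, σ i ≠ j) :
    (sub v σ hσ).toFun a j = v j := by
  have h : ¬ ∃ i', σ i' = j := by simpa using hj
  simp only [sub]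
  rw [dif_neg h]

theorem comp_vertex {m n : ℕ} (f : CubeMap m n) (w : Fin m → Bool) :
    f.comp (vertex w) = vertex (f.toFun w) := rfl

theorem sub_comp_edge {m n : ℕ} (v : Fin n → Bool) (σ : Fin m → Fin n)
    (hσ : Function.Injective σ) (w : Fin m → Bool) (l : Fin m) :
    (sub v σ hσ).comp (edge w l) = edge ((sub v σ hσ).toFun w) (σ l) := by
  ext b j
  simp only [comp, edge]
  by_cases hb : b 0
  · simp only [hb, if_true]
    by_cases hj : ∃ i, σ i = j
    · obtain ⟨i, rfl⟩ := hj
      by_cases hil : i = l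
      · subst hil
        simp [sub_apply]
      · rw [sub_apply, Function.update_of_ne hil, Function.update_of_ne (fun h => hil (hσ h)),
          sub_apply]
    · have hj' : ∀ i, σ i ≠ j := by simpa using hj
      rw [sub_apply_of_notMem _ _ _ _ _ hj', Function.update_of_ne (hj' l).symm,
        sub_apply_of_notMem _ _ _ _ _ hj']
  · simp [hb]

theorem edge_comp_vertex_false {n : ℕ} (v : Fin n → Bool) (i : Fin n) :
    (edge v i).comp (vertex fun _ => false) = vertex v := rfl

theorem edge_comp_vertex_true {n : ℕ} (v : Fin n → Bool) (i : Fin n) :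
    (edge v i).comp (vertex fun _ => true) = vertex (Function.update v i (!(v i))) := rfl

theorem edge_comp_flip {n : ℕ} (v : Fin n → Bool) (i : Fin n) :
    (edge v i).comp (edge (fun _ => true) 0) = edge (Function.update v i (!(v i))) i := by
  ext b j
  simp only [comp, edge]
  by_cases hb : b 0
  · simp [hb]
  · simp [hb]

end CubeMap

/-! ### Squares and the cube condition. -/

namespace CubeComplex

variable {X : CubeComplex.{u}}

theorem corner_face {m n : ℕ} (f : CubeMap m n) (w : Fin m → Bool) (c : X.Cube n) :
    X.corner w (X.face f c) = X.corner (f.toFun w) c := by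
  unfold corner
  rw [← X.face_comp, CubeMap.comp_vertex]

theorem edgeAt_face_sub {m n : ℕ} (v : Fin n → Bool) (σ : Fin m → Fin n)
    (hσ : Function.Injective σ) (w : Fin m → Bool) (l : Fin m) (c : X.Cube n) :
    X.edgeAt w l (X.face (CubeMap.sub v σ hσ) c) =
      X.edgeAt ((CubeMap.sub v σ hσ).toFun w) (σ l) c := by
  unfold edgeAt
  rw [← X.face_comp, CubeMap.sub_comp_edge]

theorem src_edgeAt {n : ℕ} (v : Fin n → Bool) (i : Fin n) (c : X.Cube n) :
    X.src (X.edgeAt v i c) = X.corner v c := by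
  unfold src edgeAt corner
  rw [← X.face_comp, CubeMap.edge_comp_vertex_false]

theorem tgt_edgeAt {n : ℕ} (v : Fin n → Bool) (i : Fin n) (c : X.Cube n) :
    X.tgt (X.edgeAt v i c) = X.corner (Function.update v i (!(v i))) c := by
  unfold tgt edgeAt corner
  rw [← X.face_comp, CubeMap.edge_comp_vertex_true]

theorem rev_edgeAt {n : ℕ} (v : Fin n → Bool) (i : Fin n) (c : X.Cube n) :
    X.rev (X.edgeAt v i c) = X.edgeAt (Function.update v i (!(v i))) i c := by
  unfold rev edgeAt
  rw [← X.face_comp, CubeMap.edge_comp_flip]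

theorem edgeAt_one (e : X.Dart) : X.edgeAt (fun _ => false) 0 e = e := by
  conv_rhs => rw [← X.face_id e]
  unfold edgeAt
  congr 1
  ext b j
  fin_cases j
  simp only [CubeMap.edge, CubeMap.id]
  cases hb : b 0 <;> simp [hb]

@[simp] theorem rev_rev (e : X.Dart) : X.rev (X.rev e) = e := by
  conv_rhs => rw [← edgeAt_one e]
  rw [show X.rev e = X.edgeAt (fun _ => true) 0 e from rfl, rev_edgeAt]
  congr 1
  ext j
  fin_cases j
  simp

@[simp] theorem src_rev (e : X.Dart) : X.src (X.rev e) = X.tgt e :=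
  src_edgeAt _ _ _

@[simp] theorem tgt_rev (e : X.Dart) : X.tgt (X.rev e) = X.src e := by
  rw [← src_rev, rev_rev]

/-- `X.Sq e f e' f'`: some square has the edges `e` and `f` at its origin, `e'` opposite to `e` and
`f'` opposite to `f`. -/
def Sq (X : CubeComplex.{u}) (e f e' f' : X.Dart) : Prop :=
  ∃ s : X.Cube 2, X.edgeAt ![false, false] 0 s = e ∧ X.edgeAt ![false, false] 1 s = f ∧
    X.edgeAt ![false, true] 0 s = e' ∧ X.edgeAt ![true, false] 1 s = f'

theorem zero_two : (fun _ => false : Fin 2 → Bool) = ![false, false] := by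
  ext i; fin_cases i <;> rfl

theorem LinkAdj.exists_sq {e f : X.Dart} (h : X.LinkAdj e f) : ∃ e' f', X.Sq e f e' f' := by
  obtain ⟨s, h0, h1⟩ := h
  rw [originEdge, zero_two] at h0 h1
  exact ⟨_, _, s, h0, h1, rfl, rfl⟩

theorem Sq.linkAdj {e f e' f' : X.Dart} (h : X.Sq e f e' f') : X.LinkAdj e f := by
  obtain ⟨s, h0, h1, -, -⟩ := h
  exact ⟨s, by rw [originEdge, zero_two, h0], by rw [originEdge, zero_two, h1]⟩

theorem sub_eq {m n : ℕ} (v : Fin n → Bool) (σ : Fin m → Fin n)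
    (hσ : Function.Injective σ) (w : Fin m → Bool) (r : Fin n → Bool)
    (h1 : ∀ i, r (σ i) = xor (v (σ i)) (w i)) (h2 : ∀ j, (∀ i, σ i ≠ j) → r j = v j) :
    (CubeMap.sub v σ hσ).toFun w = r := by
  ext j
  by_cases hj : ∃ i, σ i = j
  · obtain ⟨i, rfl⟩ := hj
    rw [CubeMap.sub_apply, h1]
  · have hj' : ∀ i, σ i ≠ j := by simpa using hj
    rw [CubeMap.sub_apply_of_notMem _ _ _ _ _ hj', h2 j hj']

/-- A coordinate square of a cube. -/
theorem sq_edgeAt {n : ℕ} (c : X.Cube n) (v : Fin n → Bool) {i j : Fin n} (hij : i ≠ j) :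
    X.Sq (X.edgeAt v i c) (X.edgeAt v j c)
      (X.edgeAt (Function.update v j (!(v j))) i c)
      (X.edgeAt (Function.update v i (!(v i))) j c) := by
  have hσ : Function.Injective ![i, j] := by
    intro a b; fin_cases a <;> fin_cases b <;> simp [hij, hij.symm]
  refine ⟨X.face (CubeMap.sub v ![i, j] hσ) c, ?_, ?_, ?_, ?_⟩ <;> rw [edgeAt_face_sub]
  all_goals
    congr 1
    apply sub_eq
    · intro a; fin_cases a <;> simp [hij, hij.symm]
    · intro l hl
      have h0 := hl 0
      have h1 := hl 1
      simp at h0 h1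
      simp [Ne.symm h0, Ne.symm h1]

theorem Sq.symm {e f e' f' : X.Dart} (h : X.Sq e f e' f') : X.Sq f e f' e' := by
  obtain ⟨s, rfl, rfl, rfl, rfl⟩ := h
  have := sq_edgeAt s ![false, false] (i := 1) (j := 0) (by decide)
  convert this using 2
  · ext l; fin_cases l <;> simp
  · ext l; fin_cases l <;> simp

/-- The same square seen from the far end of `e`. Together with `Sq.symm` this gives every
relabelling of a square by its symmetries. -/
theorem Sq.rot {e f e' f' : X.Dart} (h : X.Sq e f e' f') : X.Sq (X.rev e) f' (X.rev e') f := by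
  obtain ⟨s, rfl, rfl, rfl, rfl⟩ := h
  have := sq_edgeAt s ![true, false] (i := 0) (j := 1) (by decide)
  rw [rev_edgeAt, rev_edgeAt]
  convert this using 2 <;> ext l <;> fin_cases l <;> simp

theorem Sq.src_eq {e f e' f' : X.Dart} (h : X.Sq e f e' f') : X.src e = X.src f := by
  obtain ⟨s, rfl, rfl, rfl, rfl⟩ := h
  rw [src_edgeAt, src_edgeAt]

theorem Sq.src_right {e f e' f' : X.Dart} (h : X.Sq e f e' f') : X.src f' = X.tgt e := by
  rw [← h.rot.src_eq, src_rev]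

theorem Sq.src_left {e f e' f' : X.Dart} (h : X.Sq e f e' f') : X.src e' = X.tgt f :=
  h.symm.src_right

theorem Sq.tgt_eq {e f e' f' : X.Dart} (h : X.Sq e f e' f') : X.tgt e' = X.tgt f' := by
  rw [← h.rot.src_left, src_rev]

theorem LinkAdj.symm {e f : X.Dart} (h : X.LinkAdj e f) : X.LinkAdj f e := by
  obtain ⟨e', f', h⟩ := h.exists_sq
  exact h.symm.linkAdj

namespace IsNonPositivelyCurved

variable (hX : X.IsNonPositivelyCurved)
include hX

theorem linkAdj_ne {e f : X.Dart} (h : X.LinkAdj e f) : e ≠ f := by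
  obtain ⟨s, rfl, rfl⟩ := h
  intro h
  exact absurd (hX.link_injective s h) (by decide)

theorem sq_ne {e f e' f' : X.Dart} (h : X.Sq e f e' f') : e ≠ f := hX.linkAdj_ne h.linkAdj

theorem sq_unique {e f a b c d : X.Dart} (h : X.Sq e f a b) (h' : X.Sq e f c d) :
    a = c ∧ b = d := by
  obtain ⟨s, rfl, rfl, rfl, rfl⟩ := h
  obtain ⟨s', h1, h2, rfl, rfl⟩ := h'
  have : s = s' := by
    apply hX.link_unique
    · rw [origin, origin, zero_two, ← src_edgeAt _ 0, ← src_edgeAt _ 0, h1]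
    · intro i
      rw [originEdge, originEdge, zero_two]
      fin_cases i
      · exact h1.symm
      · exact h2.symm
  subst this
  exact ⟨rfl, rfl⟩

/-- Three pairwise adjacent edges at a vertex span a cube. -/
theorem sq_cube {e f g e₁ f₁ e₂ g₁ f₂ g₂ : X.Dart} (hef : X.Sq e f e₁ f₁) (heg : X.Sq e g e₂ g₁)
    (hfg : X.Sq f g f₂ g₂) :
    ∃ e₃ f₃ g₃, X.Sq f₁ g₁ f₃ g₃ ∧ X.Sq e₁ g₂ e₃ g₃ ∧ X.Sq e₂ f₂ e₃ f₃ := by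
  obtain ⟨c, -, hc⟩ := hX.link_flag (X.src e) ![e, f, g]
    (by intro i; fin_cases i <;> simp [hef.src_eq, hfg.src_eq])
    (by
      have h1 := hX.sq_ne hef
      have h2 := hX.sq_ne heg
      have h3 := hX.sq_ne hfg
      intro i j; fin_cases i <;> fin_cases j <;> simp [h1, h2, h3, h1.symm, h2.symm, h3.symm])
    (by
      have h1 := hef.linkAdj
      have h2 := heg.linkAdj
      have h3 := hfg.linkAdj
      intro i j hij; fin_cases i <;> fin_cases j <;>
        simp [h1, h2, h3, h1.symm, h2.symm, h3.symm] at hij ⊢)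
  have c0 := hc 0
  have c1 := hc 1
  have c2 := hc 2
  simp only [originEdge] at c0 c1 c2
  have z : (fun _ => false : Fin 3 → Bool) = ![false, false, false] := by
    ext i; fin_cases i <;> rfl
  rw [z] at c0 c1 c2
  simp at c0 c1 c2
  have s01 := sq_edgeAt c ![false, false, false] (i := 0) (j := 1) (by decide)
  have s02 := sq_edgeAt c ![false, false, false] (i := 0) (j := 2) (by decide)
  have s12 := sq_edgeAt c ![false, false, false] (i := 1) (j := 2) (by decide)
  rw [c0, c1] at s01
  rw [c0, c2] at s02
  rw [c1, c2] at s12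
  obtain ⟨rfl, rfl⟩ := hX.sq_unique hef s01
  obtain ⟨rfl, rfl⟩ := hX.sq_unique heg s02
  obtain ⟨rfl, rfl⟩ := hX.sq_unique hfg s12
  refine ⟨X.edgeAt ![false, true, true] 0 c, X.edgeAt ![true, false, true] 1 c,
    X.edgeAt ![true, true, false] 2 c, ?_, ?_, ?_⟩
  · have := sq_edgeAt c ![true, false, false] (i := 1) (j := 2) (by decide)
    convert this using 2 <;> ext l <;> fin_cases l <;> simp
  · have := sq_edgeAt c ![false, true, false] (i := 0) (j := 2) (by decide)
    convert this using 2 <;> ext l <;> fin_cases l <;> simp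
  · have := sq_edgeAt c ![false, false, true] (i := 0) (j := 1) (by decide)
    convert this using 2 <;> ext l <;> fin_cases l <;> simp

end IsNonPositivelyCurved

end CubeComplex

/-! ### Normal forms for edge paths modulo squares. -/

namespace CubeComplex

variable {X : CubeComplex.{u}}

theorem Sq.rot_rot {e f e' f' : X.Dart} (h : X.Sq e f e' f') :
    X.Sq (X.rev e') (X.rev f') (X.rev e) (X.rev f) :=
  h.rot.symm.rot.symm

/-- Pushing a path across a square. Paths are recorded backwards: the head of the list is the last
edge of the path. -/
inductive SwapStep (X : CubeComplex.{u}) : List X.Dart → List X.Dart → Prop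
  | swap {e f e' f' : X.Dart} (h : X.Sq e f e' f') (q : List X.Dart) :
      SwapStep X (f' :: e :: q) (e' :: f :: q)
  | cons (a : X.Dart) {p q : List X.Dart} (h : SwapStep X p q) : SwapStep X (a :: p) (a :: q)

/-- Equality of paths up to pushing them across squares. -/
def SwapEq (X : CubeComplex.{u}) : List X.Dart → List X.Dart → Prop :=
  Relation.ReflTransGen X.SwapStep

theorem SwapStep.symm {p q : List X.Dart} (h : X.SwapStep p q) : X.SwapStep q p := by
  induction h with
  | swap h q => exact .swap h.symm q
  | cons a _ ih => exact .cons a ih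

theorem SwapStep.length_eq {p q : List X.Dart} (h : X.SwapStep p q) : p.length = q.length := by
  induction h with
  | swap => rfl
  | cons _ _ ih => simp [ih]

namespace SwapEq

@[refl] theorem refl (p : List X.Dart) : X.SwapEq p p := Relation.ReflTransGen.refl

theorem trans {p q r : List X.Dart} (h : X.SwapEq p q) (h' : X.SwapEq q r) : X.SwapEq p r :=
  Relation.ReflTransGen.trans h h'

theorem symm {p q : List X.Dart} (h : X.SwapEq p q) : X.SwapEq q p := by
  induction h with
  | refl => exact .refl _
  | tail _ h ih => exact trans (Relation.ReflTransGen.single h.symm) ih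

theorem cons (a : X.Dart) {p q : List X.Dart} (h : X.SwapEq p q) : X.SwapEq (a :: p) (a :: q) := by
  induction h with
  | refl => exact .refl _
  | tail _ h ih => exact trans ih (Relation.ReflTransGen.single (.cons a h))

theorem swap {e f e' f' : X.Dart} (h : X.Sq e f e' f') (q : List X.Dart) :
    X.SwapEq (f' :: e :: q) (e' :: f :: q) :=
  Relation.ReflTransGen.single (.swap h q)

theorem length_eq {p q : List X.Dart} (h : X.SwapEq p q) : p.length = q.length := by
  induction h with
  | refl => rfl
  | tail _ h ih => exact ih.trans h.length_eq

end SwapEq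

/-- The list contains an edge followed by its reverse. -/
inductive HasBacktrack (X : CubeComplex.{u}) : List X.Dart → Prop
  | here (e : X.Dart) (q : List X.Dart) : HasBacktrack X (X.rev e :: e :: q)
  | cons (a : X.Dart) {q : List X.Dart} (h : HasBacktrack X q) : HasBacktrack X (a :: q)

/-- No way of pushing the path across squares produces a backtrack. -/
def IsReduced (X : CubeComplex.{u}) (p : List X.Dart) : Prop :=
  ∀ q, X.SwapEq p q → ¬ X.HasBacktrack q

theorem IsReduced.of_swapEq {p q : List X.Dart} (hp : X.IsReduced p) (h : X.SwapEq p q) :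
    X.IsReduced q := fun r hr => hp r (h.trans hr)

theorem IsReduced.of_cons {a : X.Dart} {p : List X.Dart} (hp : X.IsReduced (a :: p)) :
    X.IsReduced p := fun r hr hb => hp (a :: r) (hr.cons a) (.cons a hb)

theorem isReduced_nil : X.IsReduced [] := by
  intro q hq hb
  have := hq.length_eq
  cases hb <;> simp at this

namespace IsNonPositivelyCurved

variable (hX : X.IsNonPositivelyCurved)
include hX

/-- Two paths that agree up to pushing across squares either have the same last edge, or their last
edges are the last sides of a square. -/
theorem swapEq_cons_cons {f f' : X.Dart} {p p' : List X.Dart}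
    (h : X.SwapEq (f :: p) (f' :: p')) :
    (f = f' ∧ X.SwapEq p p') ∨
      ∃ s a b, X.SwapEq p (a :: s) ∧ X.SwapEq p' (b :: s) ∧ X.Sq a b f' f := by
  obtain ⟨ℓ, hℓ⟩ : ∃ ℓ, p.length = ℓ := ⟨_, rfl⟩
  -- Outer induction on the length, inner induction on the number of squares crossed. The outer
  -- hypothesis is needed when the last square changes the last edge after that edge has already
  -- changed.
  induction ℓ using Nat.strong_induction_on generalizing f f' p p' with
  | _ ℓ IH =>
  obtain ⟨r, hr⟩ : ∃ r, r = f' :: p' := ⟨_, rfl⟩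
  rw [← hr] at h
  induction h generalizing f' p' with
  | refl =>
    cases hr
    exact .inl ⟨rfl, .refl _⟩
  | @tail r₀ r₁ h₀ hstep ih =>
    subst hr
    cases hstep with
    | @cons a q₀ q₁ hq =>
      rcases ih rfl with ⟨rfl, h⟩ | ⟨s, a, b, h1, h2, h3⟩
      · exact .inl ⟨rfl, h.trans (Relation.ReflTransGen.single hq)⟩
      · exact .inr ⟨s, a, b, h1, (SwapEq.symm (Relation.ReflTransGen.single hq)).trans h2, h3⟩
    | @swap e g e' g' hsq q =>
      rcases ih rfl with ⟨rfl, h⟩ | ⟨s, a, b, h1, h2, h3⟩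
      · exact .inr ⟨q, e, g, h, .refl _, hsq⟩
      · have l1 := h1.length_eq
        have l2 := h2.length_eq
        simp only [List.length_cons] at l1 l2
        rcases IH q.length (by omega) h2 rfl with ⟨rfl, hqs⟩ | ⟨s', c, d, h4, h5, h6⟩
        · obtain ⟨h7, rfl⟩ := hX.sq_unique hsq.rot h3.symm.rot
          have h8 : f' = f := by rw [← X.rev_rev f', h7, X.rev_rev]
          exact .inl ⟨h8.symm, h1.trans (hqs.symm.cons _)⟩
        -- The edges `X.rev e`, `X.rev b` and `g'` at the penultimate vertex pairwise span squares,
        -- hence a cube. Its remaining faces provide the square ending in `f'` and `f` and the swaps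
        -- leading to it.
        · obtain ⟨e₃, f₃, g₃, k1, k2, k3⟩ := hX.sq_cube h6.rot_rot.symm hsq.rot h3.symm.rot
          refine .inr ⟨g₃ :: s', X.rev e₃, X.rev f₃, ?_, ?_, ?_⟩
          · refine h1.trans ((h5.cons a).trans ?_)
            have := k2.rot
            rw [X.rev_rev] at this
            exact SwapEq.swap this s'
          · refine (h4.cons g).trans ?_
            have := k1.rot
            rw [X.rev_rev] at this
            exact SwapEq.swap this s'
          · have := k3.rot_rot
            rwa [X.rev_rev, X.rev_rev] at this

theorem swapEq_of_cons {f : X.Dart} {p p' : List X.Dart}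
    (h : X.SwapEq (f :: p) (f :: p')) : X.SwapEq p p' := by
  rcases hX.swapEq_cons_cons h with ⟨-, h⟩ | ⟨s, a, b, -, -, h⟩
  · exact h
  · exact absurd rfl (hX.sq_ne h.rot_rot)

/-- Adding an edge to a reduced path gives a reduced path, unless the edge undoes the last edge of
the path. -/
theorem exists_swapEq_rev_cons {e : X.Dart} {p r : List X.Dart} (hp : X.IsReduced p)
    (h : X.SwapEq (e :: p) r) (hr : X.HasBacktrack r) : ∃ q, X.SwapEq p (X.rev e :: q) := by
  obtain ⟨ℓ, hℓ⟩ : ∃ ℓ, p.length = ℓ := ⟨_, rfl⟩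
  induction ℓ using Nat.strong_induction_on generalizing e p r with
  | _ ℓ IH =>
  cases hr with
  | here g r₂ =>
    rcases hX.swapEq_cons_cons h with ⟨rfl, h⟩ | ⟨s, a, b, h1, h2, h3⟩
    · exact ⟨r₂, by rwa [X.rev_rev]⟩
    · rcases hX.swapEq_cons_cons h2 with ⟨rfl, h⟩ | ⟨t, c, d, h4, h5, h6⟩
      · exact absurd rfl (hX.sq_ne h3.symm.rot)
      -- Both squares have the sides `X.rev b` and `X.rev g` at one corner, so they agree and `a` is
      -- the reverse of `d`; then `p` itself could be pushed to a backtrack.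
      · obtain ⟨-, h7⟩ := hX.sq_unique h3.symm.rot h6.rot_rot
        exfalso
        refine hp (a :: d :: t) (h1.trans (h5.cons a)) ?_
        rw [h7]
        exact .here _ _
  | @cons g r' hb =>
    rcases hX.swapEq_cons_cons h with ⟨rfl, h'⟩ | ⟨s, a, b, h1, h2, h3⟩
    · exact absurd hb (hp _ h')
    · have l1 := h1.length_eq
      simp only [List.length_cons] at l1
      obtain ⟨q, hq⟩ := IH s.length (by omega) (hp.of_swapEq h1).of_cons h2.symm hb rfl
      exact ⟨_, h1.trans ((hq.cons a).trans (SwapEq.swap h3.symm.rot q))⟩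

end IsNonPositivelyCurved

/-- Paths up to pushing across squares. -/
def SwapClass (X : CubeComplex.{u}) : Type u := Quot X.SwapStep

/-- The class of a path. -/
def SwapClass.mk (p : List X.Dart) : X.SwapClass := Quot.mk _ p

theorem SwapClass.mk_eq {p q : List X.Dart} : SwapClass.mk p = SwapClass.mk q ↔ X.SwapEq p q := by
  constructor
  · intro h
    have := Quot.eqvGen_exact h
    induction this with
    | rel _ _ h' => exact Relation.ReflTransGen.single h'
    | refl => exact .refl _
    | symm _ _ _ ih => exact (ih (Quot.eqvGen_sound ‹_›)).symm
    | trans _ _ _ _ _ ih1 ih2 =>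
      exact (ih1 (Quot.eqvGen_sound ‹_›)).trans (ih2 (Quot.eqvGen_sound ‹_›))
  · intro h
    induction h with
    | refl => rfl
    | tail _ h ih => exact ih.trans (Quot.sound h)

/-- A class all of whose paths are free of backtracks. -/
def SwapClass.IsReduced (C : X.SwapClass) : Prop :=
  ∀ p, C = SwapClass.mk p → X.IsReduced p

theorem SwapClass.isReduced_mk {p : List X.Dart} :
    (SwapClass.mk p).IsReduced ↔ X.IsReduced p :=
  ⟨fun h => h p rfl, fun h _ hq => h.of_swapEq (SwapClass.mk_eq.1 hq)⟩

/-- Extend a path by an edge. -/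
def SwapClass.cons (e : X.Dart) (C : X.SwapClass) : X.SwapClass :=
  Quot.map (List.cons e) (fun _ _ h => .cons e h) C

open Classical in
/-- Extend a path by an edge, cancelling the last edge if possible. -/
noncomputable def SwapClass.act (C : X.SwapClass) (e : X.Dart) : X.SwapClass :=
  if h : ∃ q, C = SwapClass.mk (X.rev e :: q) then SwapClass.mk h.choose
  else C.cons e

namespace IsNonPositivelyCurved

variable (hX : X.IsNonPositivelyCurved)
include hX

theorem act_cancel {p q : List X.Dart} {e : X.Dart} (h : X.SwapEq p (X.rev e :: q)) :
    (SwapClass.mk p).act e = SwapClass.mk q := by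
  have h' : ∃ q, SwapClass.mk p = SwapClass.mk (X.rev e :: q) := ⟨q, SwapClass.mk_eq.2 h⟩
  unfold SwapClass.act
  rw [dif_pos h', SwapClass.mk_eq]
  have h2 := SwapClass.mk_eq.1 h'.choose_spec
  exact hX.swapEq_of_cons (h2.symm.trans h)

omit hX in
theorem act_cons {p : List X.Dart} {e : X.Dart} (h : ∀ q, ¬ X.SwapEq p (X.rev e :: q)) :
    (SwapClass.mk p).act e = SwapClass.mk (e :: p) := by
  have h' : ¬ ∃ q, SwapClass.mk p = SwapClass.mk (X.rev e :: q) := by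
    rintro ⟨q, hq⟩
    exact h q (SwapClass.mk_eq.1 hq)
  unfold SwapClass.act
  rw [dif_neg h']
  rfl

theorem act_isReduced {C : X.SwapClass} (hC : C.IsReduced) (e : X.Dart) :
    (C.act e).IsReduced := by
  obtain ⟨p, rfl⟩ : ∃ p, C = SwapClass.mk p := by
    induction C using Quot.ind with | _ p => exact ⟨p, rfl⟩
  rw [SwapClass.isReduced_mk] at hC
  by_cases h : ∃ q, X.SwapEq p (X.rev e :: q)
  · obtain ⟨q, hq⟩ := h
    rw [hX.act_cancel hq, SwapClass.isReduced_mk]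
    exact (hC.of_swapEq hq).of_cons
  · push Not at h
    rw [act_cons h, SwapClass.isReduced_mk]
    intro r hr hb
    obtain ⟨q, hq⟩ := hX.exists_swapEq_rev_cons hC hr hb
    exact h q hq

theorem act_act_rev {C : X.SwapClass} (hC : C.IsReduced) (e : X.Dart) :
    (C.act e).act (X.rev e) = C := by
  obtain ⟨p, rfl⟩ : ∃ p, C = SwapClass.mk p := by
    induction C using Quot.ind with | _ p => exact ⟨p, rfl⟩
  rw [SwapClass.isReduced_mk] at hC
  by_cases h : ∃ q, X.SwapEq p (X.rev e :: q)
  · obtain ⟨q, hq⟩ := h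
    rw [hX.act_cancel hq, act_cons, SwapClass.mk_eq]
    · exact hq.symm
    · intro q' hq'
      rw [X.rev_rev] at hq'
      exact hC _ (hq.trans (hq'.cons _)) (.here _ _)
  · push Not at h
    rw [act_cons h, hX.act_cancel]
    rw [X.rev_rev]

/-- With `act_act_rev` this makes the action of edges on reduced classes compatible with both
elementary homotopies. The cases are whether `e` and `f` cancel against the end of the path: if both
do, the path ends in two sides of the same square; if neither does, a cancellation by `f'` after `e`
would come from one by `f`. -/
theorem act_sq {C : X.SwapClass} (hC : C.IsReduced) {e f e' f' : X.Dart}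
    (h : X.Sq e f e' f') : (C.act e).act f' = (C.act f).act e' := by
  obtain ⟨p, rfl⟩ : ∃ p, C = SwapClass.mk p := by
    induction C using Quot.ind with | _ p => exact ⟨p, rfl⟩
  rw [SwapClass.isReduced_mk] at hC
  have noDesc : ∀ {e f e' f' : X.Dart}, X.Sq e f e' f' →
      (∀ q, ¬ X.SwapEq p (X.rev f :: q)) → ∀ q, ¬ X.SwapEq (e :: p) (X.rev f' :: q) := by
    intro e f e' f' h hf q hq
    rcases hX.swapEq_cons_cons hq with ⟨h1, -⟩ | ⟨s, a, b, h1, -, h3⟩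
    · exact hX.sq_ne h.rot (by rw [h1, X.rev_rev])
    · have h4 := h3.rot_rot
      rw [X.rev_rev] at h4
      have h6 := (hX.sq_unique h4 h.rot.symm).1
      have h5 : a = X.rev f := by rw [← h6, X.rev_rev]
      exact hf s (h5 ▸ h1)
  have mixed : ∀ {e f e' f' : X.Dart}, X.Sq e f e' f' →
      (∃ q, X.SwapEq p (X.rev e :: q)) → (∀ q, ¬ X.SwapEq p (X.rev f :: q)) →
      ((SwapClass.mk p).act e).act f' = ((SwapClass.mk p).act f).act e' := by
    rintro e f e' f' h ⟨q, hq⟩ hf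
    have hs : X.SwapEq (f :: X.rev e :: q) (X.rev e' :: f' :: q) := SwapEq.swap h.rot q
    rw [hX.act_cancel hq, act_cons hf, hX.act_cancel (((hq.cons f).trans hs)), act_cons]
    intro q' hq'
    have h2 : X.Sq (X.rev f') (X.rev e') (X.rev f) (X.rev e) := h.rot_rot.symm
    exact hf _ (hq.trans ((hq'.cons _).trans (SwapEq.swap h2 q')))
  by_cases he : ∃ q, X.SwapEq p (X.rev e :: q)
  · by_cases hf : ∃ q, X.SwapEq p (X.rev f :: q)
    · obtain ⟨q, hq⟩ := he
      obtain ⟨q', hq'⟩ := hf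
      rw [hX.act_cancel hq, hX.act_cancel hq']
      rcases hX.swapEq_cons_cons (hq.symm.trans hq') with ⟨h1, -⟩ | ⟨s, a, b, h1, h2, h3⟩
      · exact absurd (by rw [← X.rev_rev e, h1, X.rev_rev]) (hX.sq_ne h)
      · have h4 := h3.rot_rot.symm
        rw [X.rev_rev, X.rev_rev] at h4
        obtain ⟨h5, h6⟩ := hX.sq_unique h4 h
        rw [hX.act_cancel (q := s), hX.act_cancel (q := s)]
        · rwa [← h5, X.rev_rev]
        · rwa [← h6, X.rev_rev]
    · push Not at hf
      exact mixed h he hf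
  · by_cases hf : ∃ q, X.SwapEq p (X.rev f :: q)
    · push Not at he
      exact (mixed h.symm hf he).symm
    · push Not at he hf
      rw [act_cons he, act_cons hf, act_cons (noDesc h hf), act_cons (noDesc h.symm he),
        SwapClass.mk_eq]
      exact SwapEq.swap h p

theorem foldl_act_isReduced {C : X.SwapClass} (hC : C.IsReduced) (p : List X.Dart) :
    (p.foldl SwapClass.act C).IsReduced := by
  induction p generalizing C with
  | nil => exact hC
  | cons e p ih => exact ih (hX.act_isReduced hC e)

-- No letter of a reduced path ever cancels, so acting by the path recovers its class. Combined with
-- `foldl_act_homotopy`, homotopic reduced paths agree modulo squares.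
omit hX in
theorem foldl_act_of_isReduced {p q : List X.Dart} (h : X.IsReduced (p.reverse ++ q)) :
    p.foldl SwapClass.act (SwapClass.mk q) = SwapClass.mk (p.reverse ++ q) := by
  induction p generalizing q with
  | nil => rfl
  | cons e p ih =>
    rw [List.reverse_cons, List.append_assoc] at h
    have h' : X.IsReduced (e :: q) := by
      generalize p.reverse = r at h
      clear ih
      induction r with
      | nil => exact h
      | cons a r ih => exact ih h.of_cons
    rw [List.foldl_cons, act_cons, List.reverse_cons, List.append_assoc]
    · exact ih h
    · intro q' hq'
      refine h' _ (hq'.cons e) ?_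
      have := HasBacktrack.here (X.rev e) q'
      rwa [X.rev_rev] at this

theorem foldl_act_homotopy {x : X.Vertex} {p q : List X.Dart}
    (h : Relation.EqvGen (X.HomotopyStep x) p q) {C : X.SwapClass} (hC : C.IsReduced) :
    p.foldl SwapClass.act C = q.foldl SwapClass.act C := by
  induction h with
  | rel _ _ h =>
    cases h with
    | backtrack p q e _ =>
      simp only [List.foldl_append, List.foldl_cons]
      rw [hX.act_act_rev (hX.foldl_act_isReduced hC p)]
    | square p q s _ =>
      simp only [List.foldl_append, List.foldl_cons]
      rw [hX.act_sq (hX.foldl_act_isReduced hC p) ⟨s, rfl, rfl, rfl, rfl⟩]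
  | refl => rfl
  | symm _ _ _ ih => exact ih.symm
  | trans _ _ _ _ _ ih1 ih2 => exact ih1.trans ih2

end IsNonPositivelyCurved

end CubeComplex

/-! ### The edge-path metric and half spaces. -/

namespace CubeComplex

variable {X : CubeComplex.{u}}

theorem isPath_append {x z : X.Vertex} {p q : List X.Dart} :
    X.IsPath x (p ++ q) z ↔ ∃ y, X.IsPath x p y ∧ X.IsPath y q z := by
  induction p generalizing x with
  | nil => simp [IsPath]
  | cons e p ih => simp [IsPath, ih, and_assoc]

theorem isPath_snoc {x z : X.Vertex} {p : List X.Dart} {e : X.Dart} :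
    X.IsPath x (p ++ [e]) z ↔ X.IsPath x p (X.src e) ∧ X.tgt e = z := by
  rw [isPath_append]
  constructor
  · rintro ⟨y, h, rfl, h'⟩
    exact ⟨h, h'⟩
  · rintro ⟨h, h'⟩
    exact ⟨_, h, rfl, h'⟩

theorem IsPath.rev {x y : X.Vertex} {p : List X.Dart} (h : X.IsPath x p y) :
    X.IsPath y (p.reverse.map X.rev) x := by
  induction p generalizing x with
  | nil => exact h.symm
  | cons e p ih =>
    obtain ⟨rfl, h⟩ := h
    rw [List.reverse_cons, List.map_append, List.map_singleton, isPath_snoc, src_rev, tgt_rev]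
    exact ⟨ih h, rfl⟩

theorem SwapStep.isPath {x y : X.Vertex} {p q : List X.Dart} (h : X.SwapStep p q)
    (hp : X.IsPath x p.reverse y) : X.IsPath x q.reverse y := by
  induction h generalizing y with
  | swap h q =>
    simp only [List.reverse_cons, isPath_snoc] at hp ⊢
    obtain ⟨⟨h1, h2⟩, rfl⟩ := hp
    exact ⟨⟨h.src_eq ▸ h1, h.src_left.symm⟩, h.tgt_eq⟩
  | cons a _ ih =>
    simp only [List.reverse_cons, isPath_snoc] at hp ⊢
    exact ⟨ih hp.1, hp.2⟩

theorem SwapEq.isPath {x y : X.Vertex} {p q : List X.Dart} (h : X.SwapEq p q)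
    (hp : X.IsPath x p.reverse y) : X.IsPath x q.reverse y := by
  induction h with
  | refl => exact hp
  | tail _ h ih => exact h.isPath ih

theorem HasBacktrack.exists_shorter {x y : X.Vertex} {p : List X.Dart} (h : X.HasBacktrack p)
    (hp : X.IsPath x p.reverse y) :
    ∃ q : List X.Dart, X.IsPath x q.reverse y ∧ q.length < p.length := by
  induction h generalizing y with
  | here e q =>
    simp only [List.reverse_cons, isPath_snoc, tgt_rev] at hp
    obtain ⟨⟨h1, -⟩, rfl⟩ := hp
    exact ⟨q, h1, by simp⟩
  | cons a _ ih =>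
    simp only [List.reverse_cons, isPath_snoc] at hp
    obtain ⟨q, hq, hl⟩ := ih hp.1
    refine ⟨a :: q, ?_, by simpa using hl⟩
    simp only [List.reverse_cons, isPath_snoc]
    exact ⟨hq, hp.2⟩

/-- The length of a shortest edge path. -/
noncomputable def dist (X : CubeComplex.{u}) (x y : X.Vertex) : ℕ :=
  sInf {k | ∃ p, X.IsPath x p y ∧ p.length = k}

theorem IsPath.dist_le {x y : X.Vertex} {p : List X.Dart} (h : X.IsPath x p y) :
    X.dist x y ≤ p.length := Nat.sInf_le ⟨p, h, rfl⟩

theorem dist_self (x : X.Vertex) : X.dist x x = 0 :=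
  Nat.le_zero.1 (IsPath.dist_le (p := []) rfl)

/-- A backtrack changes the length by two and a square preserves it. Under simple connectivity the
1-skeleton is therefore bipartite, which is how `dist_dart` excludes equal distances. -/
theorem homotopy_parity {x : X.Vertex} {p q : List X.Dart}
    (h : Relation.EqvGen (X.HomotopyStep x) p q) : p.length % 2 = q.length % 2 := by
  induction h with
  | rel _ _ h => cases h <;> simp only [List.length_append, List.length_cons] <;> omega
  | refl => rfl
  | symm _ _ _ ih => exact ih.symm
  | trans _ _ _ _ _ ih1 ih2 => exact ih1.trans ih2

/-- The half space of the vertices that are closer to the end of the edge `e` than to its start. -/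
def halfspace (X : CubeComplex.{u}) (e : X.Dart) : Set X.Vertex :=
  {z | X.dist z (X.tgt e) < X.dist z (X.src e)}

namespace IsCAT0

variable (hX : X.IsCAT0)
include hX

theorem exists_geodesic (x y : X.Vertex) : ∃ p, X.IsPath x p y ∧ p.length = X.dist x y :=
  Nat.sInf_mem (s := {k | ∃ p, X.IsPath x p y ∧ p.length = k})
    (let ⟨p, hp⟩ := hX.simplyConnected.connected x y; ⟨_, p, hp, rfl⟩)

theorem dist_comm (x y : X.Vertex) : X.dist x y = X.dist y x := by
  have key : ∀ x y, X.dist y x ≤ X.dist x y := by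
    intro x y
    obtain ⟨p, hp, hl⟩ := hX.exists_geodesic x y
    have := hp.rev.dist_le
    simp only [List.length_map, List.length_reverse] at this
    omega
  exact le_antisymm (key _ _) (key _ _)

theorem dist_dart (z : X.Vertex) (e : X.Dart) :
    X.dist z (X.tgt e) = X.dist z (X.src e) + 1 ∨ X.dist z (X.src e) = X.dist z (X.tgt e) + 1 := by
  obtain ⟨p, hp, hl⟩ := hX.exists_geodesic z (X.src e)
  obtain ⟨q, hq, hl'⟩ := hX.exists_geodesic z (X.tgt e)
  have h1 := (isPath_snoc.2 ⟨hp, rfl⟩).dist_le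
  have h2 := (isPath_snoc.2 ⟨(X.src_rev e).symm ▸ hq, rfl⟩).dist_le
  rw [tgt_rev] at h2
  have h3 := isPath_append.2 ⟨_, isPath_snoc.2 ⟨hp, rfl⟩, hq.rev⟩
  have h4 := homotopy_parity (hX.simplyConnected.nullhomotopic z _ h3)
  simp only [List.length_append, List.length_cons, List.length_nil, List.length_map,
    List.length_reverse] at h1 h2 h4
  omega

omit hX in
theorem isReduced_of_geodesic {x y : X.Vertex} {p : List X.Dart} (hp : X.IsPath x p y)
    (hl : p.length = X.dist x y) : X.IsReduced p.reverse := by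
  intro q hq hb
  have h1 := hq.isPath (x := x) (y := y) (by rwa [List.reverse_reverse])
  obtain ⟨r, hr, hlt⟩ := hb.exists_shorter h1
  have h2 := hr.dist_le
  have h3 := hq.length_eq
  rw [List.length_reverse] at h2 h3
  omega

/-- Two geodesics with the same ends differ by pushing across squares. -/
theorem swapEq_of_geodesic {x y : X.Vertex} {p q : List X.Dart} (hp : X.IsPath x p y)
    (hlp : p.length = X.dist x y) (hq : X.IsPath x q y) (hlq : q.length = X.dist x y) :
    X.SwapEq p.reverse q.reverse := by
  have hN := hX.nonPositivelyCurved
  have h1 := hX.simplyConnected.nullhomotopic x _ (isPath_append.2 ⟨y, hp, hq.rev⟩)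
  have h0 : (SwapClass.mk ([] : List X.Dart)).IsReduced := SwapClass.isReduced_mk.2 isReduced_nil
  have h2 := hN.foldl_act_homotopy h1 h0
  have h3 : ∀ (l : List X.Dart) {C : X.SwapClass}, C.IsReduced →
      l.foldl SwapClass.act ((l.reverse.map X.rev).foldl SwapClass.act C) = C := by
    intro l
    induction l with
    | nil => intro C _; rfl
    | cons e l ih =>
      intro C hC
      rw [List.reverse_cons, List.map_append, List.map_singleton, List.foldl_append,
        List.foldl_cons, List.foldl_cons, List.foldl_nil]
      have := hN.act_act_rev (hN.foldl_act_isReduced hC (l.reverse.map X.rev)) (X.rev e)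
      rw [rev_rev] at this
      rw [this]
      exact ih hC
  rw [← SwapClass.mk_eq]
  have h4 := IsNonPositivelyCurved.foldl_act_of_isReduced (p := p) (q := []) (by
    rw [List.append_nil]; exact isReduced_of_geodesic hp hlp)
  have h5 := IsNonPositivelyCurved.foldl_act_of_isReduced (p := q) (q := []) (by
    rw [List.append_nil]; exact isReduced_of_geodesic hq hlq)
  rw [List.append_nil] at h4 h5
  rw [List.foldl_append] at h2
  -- After `p`, insert `q` backwards and then forwards. The loop formed by `p` and the backwards
  -- copy acts trivially on the empty path, which leaves `q`.
  rw [← h4, ← h5, ← h3 q (hN.foldl_act_isReduced h0 p), h2]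
  rfl

/-- The quadrangle condition. -/
theorem quadrangle {z : X.Vertex} {e f : X.Dart} (hef : X.src e = X.src f) (hne : e ≠ f)
    (he : X.dist z (X.src e) = X.dist z (X.tgt e) + 1)
    (hf : X.dist z (X.src f) = X.dist z (X.tgt f) + 1) :
    ∃ e' f', X.Sq e f e' f' ∧ X.dist z (X.src e) = X.dist z (X.tgt e') + 2 := by
  obtain ⟨p, hp, hlp⟩ := hX.exists_geodesic z (X.tgt e)
  obtain ⟨q, hq, hlq⟩ := hX.exists_geodesic z (X.tgt f)
  have h1 := hX.swapEq_of_geodesic (x := z) (y := X.src e) (p := p ++ [X.rev e])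
    (q := q ++ [X.rev f]) (isPath_snoc.2 ⟨by rwa [src_rev], tgt_rev e⟩)
    (by rw [List.length_append, List.length_singleton, hlp, he])
    (isPath_snoc.2 ⟨by rwa [src_rev], by rw [tgt_rev, hef]⟩)
    (by rw [List.length_append, List.length_singleton, hlq, hef, hf])
  simp only [List.reverse_append, List.reverse_singleton, List.singleton_append] at h1
  rcases hX.nonPositivelyCurved.swapEq_cons_cons h1 with ⟨h2, -⟩ | ⟨s, a, b, h2, h3, h4⟩
  · exact absurd (by rw [← rev_rev e, h2, rev_rev]) hne
  · have h5 := h4.rot_rot.symm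
    rw [rev_rev, rev_rev] at h5
    refine ⟨_, _, h5, ?_⟩
    have h6 := h3.isPath (x := z) (y := X.tgt f) (by rwa [List.reverse_reverse])
    rw [List.reverse_cons, isPath_snoc] at h6
    have h7 := h6.1.dist_le
    have h8 := h3.length_eq
    have h9 := hX.dist_dart z (X.rev b)
    rw [src_rev, h6.2] at h9
    rw [tgt_rev] at h9 ⊢
    simp only [List.length_reverse, List.length_cons] at h7 h8
    rw [hef]
    omega

theorem mem_halfspace {z : X.Vertex} {e : X.Dart} :
    z ∈ X.halfspace e ↔ X.dist z (X.src e) = X.dist z (X.tgt e) + 1 := by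
  have := hX.dist_dart z e
  simp only [halfspace, Set.mem_ofPred_eq]
  omega

theorem notMem_halfspace {z : X.Vertex} {e : X.Dart} :
    z ∉ X.halfspace e ↔ X.dist z (X.tgt e) = X.dist z (X.src e) + 1 := by
  have := hX.dist_dart z e
  simp only [halfspace, Set.mem_ofPred_eq]
  omega

omit hX in
theorem src_notMem_halfspace (e : X.Dart) : X.src e ∉ X.halfspace e := by
  simp [halfspace, dist_self]

theorem tgt_mem_halfspace (e : X.Dart) : X.tgt e ∈ X.halfspace e := by
  rw [hX.mem_halfspace, dist_self, hX.dist_comm]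
  have := hX.dist_dart (X.src e) e
  rw [dist_self] at this
  omega

theorem halfspace_rev (e : X.Dart) : X.halfspace (X.rev e) = (X.halfspace e)ᶜ := by
  ext z
  rw [Set.mem_compl_iff, hX.notMem_halfspace, hX.mem_halfspace, src_rev, tgt_rev]

/-- There are no double edges, and an edge is determined by its half space and its start. -/
theorem eq_of_tgt_mem {e f : X.Dart} (hs : X.src e = X.src f) (h : X.tgt e ∈ X.halfspace f) :
    e = f := by
  by_contra hne
  have h1 := hX.mem_halfspace.1 h
  have h2 := hX.mem_halfspace.1 (hX.tgt_mem_halfspace e)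
  obtain ⟨e', f', -, h3⟩ := hX.quadrangle hs hne h2 h1
  rw [dist_self] at h2
  omega

theorem eq_of_halfspace_subset {e f : X.Dart} (hs : X.src e = X.src f)
    (h : X.halfspace e ⊆ X.halfspace f) : e = f :=
  hX.eq_of_tgt_mem hs (h (hX.tgt_mem_halfspace e))

/-- If `z` were on different sides, both `e` and `f` would approach `z`. The quadrangle condition
then gives a square at this corner whose far vertex is closer by two; by uniqueness it is the given
square, whose far vertex is not. -/
theorem halfspace_eq_of_sq {e f e' f' : X.Dart} (h : X.Sq e f e' f') :
    X.halfspace e = X.halfspace e' := by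
  have key : ∀ {e f e' f' : X.Dart}, X.Sq e f e' f' → X.halfspace e ⊆ X.halfspace e' := by
    intro e f e' f' h z hz
    by_contra hz'
    rw [hX.mem_halfspace] at hz
    rw [hX.notMem_halfspace] at hz'
    have h1 := hX.dist_dart z f
    have h2 := hX.dist_dart z f'
    rw [h.src_left, h.tgt_eq] at hz'
    rw [h.src_right] at h2
    rw [← h.src_eq] at h1
    obtain ⟨e'', f'', h3, h4⟩ := hX.quadrangle (z := z) h.src_eq (hX.nonPositivelyCurved.sq_ne h)
      hz (by rw [← h.src_eq]; omega)
    obtain ⟨rfl, -⟩ := hX.nonPositivelyCurved.sq_unique h h3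
    rw [h.tgt_eq] at h4
    omega
  exact Set.Subset.antisymm (key h) (key h.symm.rot.symm)

theorem exists_first_dart {x z : X.Vertex} (h : x ≠ z) :
    ∃ g, X.src g = x ∧ X.dist z x = X.dist z (X.tgt g) + 1 := by
  obtain ⟨p, hp, hl⟩ := hX.exists_geodesic x z
  cases p with
  | nil => exact absurd hp h
  | cons g p =>
    obtain ⟨rfl, hp⟩ := hp
    refine ⟨g, rfl, ?_⟩
    have h1 := hp.dist_le
    have h2 := hX.dist_dart z g
    rw [List.length_cons] at hl
    rw [hX.dist_comm] at h1 hl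
    omega

/-- An edge that crosses a hyperplane defines the same half space. -/
theorem halfspace_eq_of_crossing {e f : X.Dart} (h1 : X.src f ∉ X.halfspace e)
    (h2 : X.tgt f ∈ X.halfspace e) : X.halfspace f = X.halfspace e := by
  obtain ⟨r, hr⟩ : ∃ r, X.dist (X.src e) (X.src f) = r := ⟨_, rfl⟩
  induction r using Nat.strong_induction_on generalizing f with
  | _ r IH =>
  rcases eq_or_ne (X.src f) (X.src e) with h | h
  · rw [hX.eq_of_tgt_mem h h2]
  · obtain ⟨g, hg, hd⟩ := hX.exists_first_dart h
    have k1 := hX.notMem_halfspace.1 h1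
    have k2 := hX.mem_halfspace.1 h2
    have k3 := hX.dist_dart (X.src e) f
    have k4 := hX.dist_dart (X.tgt e) f
    have k5 := hX.dist_dart (X.tgt e) g
    have k6 := hX.dist_dart (X.tgt g) e
    rw [hX.dist_comm (X.tgt g), hX.dist_comm (X.tgt g)] at k6
    rw [hX.dist_comm (X.src f), hX.dist_comm (X.src f)] at k1
    rw [hX.dist_comm (X.tgt f), hX.dist_comm (X.tgt f)] at k2
    rw [hg] at k5
    have hfg : f ≠ g := by
      rintro rfl
      omega
    -- Seen from `X.tgt e`, both `f` and the first edge `g` towards `X.src e` descend. Pushing `f`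
    -- across their square keeps its half space and starts one step nearer to `X.src e`.
    obtain ⟨f₁, g₁, hsq, hd'⟩ := hX.quadrangle (z := X.tgt e) hg.symm hfg (by omega)
      (by rw [hg]; omega)
    have hK := hX.halfspace_eq_of_sq hsq
    rw [hK]
    have l1 : X.src e ∉ X.halfspace f₁ := by
      rw [← hK, hX.notMem_halfspace]
      omega
    rw [hX.notMem_halfspace, hsq.src_left] at l1
    apply IH (X.dist (X.src e) (X.tgt g)) (by omega)
    · rw [hsq.src_left, hX.notMem_halfspace, hX.dist_comm (X.tgt g), hX.dist_comm (X.tgt g)]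
      omega
    · rw [hX.mem_halfspace, hX.dist_comm (X.tgt f₁), hX.dist_comm (X.tgt f₁)]
      omega
    · rw [hsq.src_left]

theorem linkAdj_of_mem {e f : X.Dart} (hs : X.src e = X.src f) (hne : e ≠ f) {z : X.Vertex}
    (he : z ∈ X.halfspace e) (hf : z ∈ X.halfspace f) : X.LinkAdj e f := by
  obtain ⟨_, _, h, -⟩ := hX.quadrangle hs hne (hX.mem_halfspace.1 he) (hX.mem_halfspace.1 hf)
  exact h.linkAdj

/-- A half space that does not contain `x` is contained in the half space of an edge at `x`. -/
theorem exists_halfspace_subset {x : X.Vertex} {e : X.Dart} (hx : x ∉ X.halfspace e) :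
    ∃ g, X.src g = x ∧ X.halfspace e ⊆ X.halfspace g := by
  obtain ⟨r, hr⟩ : ∃ r, X.dist (X.tgt e) x = r := ⟨_, rfl⟩
  induction r using Nat.strong_induction_on generalizing x with
  | _ r IH =>
  have hz := hX.tgt_mem_halfspace e
  have hxz : x ≠ X.tgt e := fun h => hx (h ▸ hz)
  obtain ⟨g, rfl, hd⟩ := hX.exists_first_dart hxz
  by_cases h1 : X.tgt g ∈ X.halfspace e
  · exact ⟨g, rfl, (hX.halfspace_eq_of_crossing hx h1).ge⟩
  · obtain ⟨g₁, hg₁, hsub⟩ := IH _ (by omega) h1 rfl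
    -- Either the half space of `g₁` already lies in that of `g`, or `g₁` and `X.rev g` have half
    -- spaces with a common vertex, so they span a square whose edge opposite to `g₁` starts at `x`.
    by_cases h2 : ∃ w, w ∈ X.halfspace g₁ ∧ w ∉ X.halfspace g
    · obtain ⟨w, hw1, hw2⟩ := h2
      have hne : g₁ ≠ X.rev g := by
        rintro rfl
        have := hsub hz
        rw [hX.mem_halfspace, src_rev, tgt_rev] at this
        omega
      have hw3 : w ∈ X.halfspace (X.rev g) := by rwa [hX.halfspace_rev]
      obtain ⟨g', g'', hsq, -⟩ := hX.quadrangle (by rw [hg₁, src_rev]) hne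
        (hX.mem_halfspace.1 hw1) (hX.mem_halfspace.1 hw3)
      refine ⟨g', by rw [hsq.src_left, tgt_rev], ?_⟩
      rwa [← hX.halfspace_eq_of_sq hsq]
    · push Not at h2
      exact ⟨g, rfl, hsub.trans h2⟩

/-- By flagness, pairwise adjacent edges span a cube of dimension `s.card`. This is the only way in
which the dimension enters the bounds. -/
theorem card_le_of_linkAdj {n : ℕ} (hn : X.HasDim n) {x : X.Vertex} (s : Finset X.Dart)
    (hs : ∀ e ∈ s, X.src e = x) (hadj : ∀ e ∈ s, ∀ f ∈ s, e ≠ f → X.LinkAdj e f) :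
    s.card ≤ n := by
  by_contra! hlt
  obtain ⟨c, -⟩ := hX.nonPositivelyCurved.link_flag x (fun i => (s.equivFin.symm i : X.Dart))
    (fun i => hs _ (s.equivFin.symm i).2)
    (fun i j h => s.equivFin.symm.injective (Subtype.ext h))
    (fun i j hij => hadj _ (s.equivFin.symm i).2 _ (s.equivFin.symm j).2
      (fun h => hij (s.equivFin.symm.injective (Subtype.ext h))))
  exact (hn.2 _ hlt).false c

end IsCAT0

end CubeComplex

/-! ### Counting letters. -/

section

open scoped Pointwise Classical

section Counting

variable {L : Type*} [Fintype L]

/-- The number of elements with a given property, as a real number. -/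
noncomputable def cnt (P : L → Prop) : ℝ := ((Finset.univ.filter P).card : ℝ)

theorem cnt_mono {P Q : L → Prop} (h : ∀ a, P a → Q a) : cnt P ≤ cnt Q := by
  unfold cnt
  exact_mod_cast Finset.card_le_card (Finset.monotone_filter_right _ fun a _ => h a)

theorem cnt_le_add {P Q R : L → Prop} (h : ∀ a, P a → Q a ∨ R a) : cnt P ≤ cnt Q + cnt R := by
  unfold cnt
  have : (Finset.univ.filter P) ⊆ Finset.univ.filter Q ∪ Finset.univ.filter R := by
    intro a
    simpa using h a
  exact_mod_cast (Finset.card_le_card this).trans (Finset.card_union_le _ _)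

theorem cnt_add_le {P Q R : L → Prop} (hP : ∀ a, P a → R a) (hQ : ∀ a, Q a → R a)
    (hd : ∀ a, P a → ¬ Q a) : cnt P + cnt Q ≤ cnt R := by
  unfold cnt
  have h : Disjoint (Finset.univ.filter P) (Finset.univ.filter Q) := by
    rw [Finset.disjoint_filter]
    exact fun a _ => hd a
  rw [← Nat.cast_add, ← Finset.card_union_of_disjoint h]
  have : Finset.univ.filter P ∪ Finset.univ.filter Q ⊆ Finset.univ.filter R := by
    intro a
    simp only [Finset.mem_union, Finset.mem_filter, Finset.mem_univ, true_and]
    exact fun h => h.elim (hP a) (hQ a)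
  exact_mod_cast Finset.card_le_card this

theorem cnt_true : cnt (fun _ : L => True) = (Fintype.card L : ℝ) := by
  simp [cnt]

theorem exists_of_cnt_pos {P : L → Prop} (h : 0 < cnt P) : ∃ a, P a := by
  unfold cnt at h
  obtain ⟨a, ha⟩ := Finset.card_pos.1 (by exact_mod_cast h)
  exact ⟨a, by simpa using ha⟩

theorem exists_of_cnt_lt {P Q : L → Prop} (h : cnt Q < cnt P) : ∃ a, P a ∧ ¬ Q a := by
  by_contra! h'
  exact absurd (cnt_mono h') (not_le.2 h)

theorem cnt_comp {f : L → L} (hf : Function.Involutive f) (P : L → Prop) :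
    cnt (fun a => P (f a)) = cnt P := by
  unfold cnt
  norm_cast
  refine Finset.card_bij (fun a _ => f a) ?_ (fun _ _ _ _ h => hf.injective h) ?_
  · intro a
    simp
  · intro a ha
    exact ⟨f a, by simpa [hf a] using ha, hf a⟩

/-- The union bound. -/
theorem exists_forall_not_of_cnt_lt {ι : Type*} {P : L → Prop} (s : Finset ι) (Q : ι → L → Prop)
    (b : ℝ) (hQ : ∀ i ∈ s, cnt (Q i) ≤ b) (h : s.card * b < cnt P) :
    ∃ a, P a ∧ ∀ i ∈ s, ¬ Q i a := by
  have h1 : cnt (fun a => ∃ i ∈ s, Q i a) ≤ s.card * b := by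
    clear h
    induction s using Finset.induction_on with
    | empty => simp [cnt]
    | insert i s hi ih =>
      rw [Finset.card_insert_of_notMem hi]
      have h1 := ih fun j hj => hQ j (Finset.mem_insert_of_mem hj)
      have h2 := hQ i (Finset.mem_insert_self _ _)
      have h3 : cnt (fun a => ∃ j ∈ insert i s, Q j a) ≤ cnt (Q i) + cnt (fun a => ∃ j ∈ s, Q j a) :=
        cnt_le_add fun a ⟨j, hj, hja⟩ => by
          rcases Finset.mem_insert.1 hj with rfl | hj
          · exact .inl hja
          · exact .inr ⟨j, hj, hja⟩
      push_cast
      linarith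
  obtain ⟨a, ha, hb⟩ := exists_of_cnt_lt (h1.trans_lt h)
  push Not at hb
  exact ⟨a, ha, hb⟩

end Counting

/-! ### Direction systems and the game on directions. -/

/-- The directions at a base point: a group with generators indexed by letters acts on a set, and
`dirs` is a collection of sets that do not contain the base point. In the application these are the
half spaces of the edges that start at a vertex of a `CAT(0)` cube complex. -/
structure DirectionSystem (G : Type u) (V : Type v) (L : Type w) [Group G] [MulAction G V]
    (n : ℕ) where
  gen : L → G
  inv : L → L
  inv_inv : Function.Involutive inv
  gen_inv : ∀ a, gen (inv a) = (gen a)⁻¹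
  base : V
  dirs : Set (Set V)
  base_notMem : ∀ K ∈ dirs, base ∉ K
  exists_supset : ∀ K ∈ dirs, ∀ g : G, base ∉ g • K → ∃ K' ∈ dirs, g • K ⊆ K'
  exists_supset_compl : ∀ K ∈ dirs, ∀ g : G, base ∈ g • K → ∃ K' ∈ dirs, g • Kᶜ ⊆ K'
  antichain : ∀ K ∈ dirs, ∀ K' ∈ dirs, K ⊆ K' → K = K'
  card_le : ∀ s : Finset (Set V), (∀ K ∈ s, K ∈ dirs) → (∀ K ∈ s, ∀ K' ∈ s, (K ∩ K').Nonempty) →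
    s.card ≤ n

namespace DirectionSystem

variable {G : Type u} {V : Type v} {L : Type w} [Group G] [MulAction G V] {n : ℕ}
  (D : DirectionSystem G V L n)

/-- The letter exchanges the two sides. -/
def Inverts (a : L) (K : Set V) : Prop := D.gen a • K = Kᶜ

/-- The letter moves the direction behind another direction that contains the image of the base
point. -/
def Absorbs (a : L) (K : Set V) : Prop :=
  ∃ K' ∈ D.dirs, D.gen a • K ⊆ K' ∧ D.gen a • D.base ∈ K'

theorem gen_inv_smul_gen_smul {α : Type*} [MulAction G α] (a : L) (z : α) :
    D.gen (D.inv a) • D.gen a • z = z := by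
  rw [D.gen_inv, inv_smul_smul]

theorem Inverts.inv {D : DirectionSystem G V L n} {a : L} {K : Set V} (h : D.Inverts a K) :
    D.Inverts (D.inv a) K := by
  unfold Inverts at *
  rw [D.gen_inv, inv_smul_eq_iff, Set.smul_set_compl, h, compl_compl]

theorem Inverts.smul_compl {D : DirectionSystem G V L n} {a : L} {K : Set V} (h : D.Inverts a K) :
    D.gen a • Kᶜ = K := by
  rw [Set.smul_set_compl, h, compl_compl]

theorem Inverts.base_mem {D : DirectionSystem G V L n} {a : L} {K : Set V} (h : D.Inverts a K)
    (hK : K ∈ D.dirs) : D.gen a • D.base ∈ K := by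
  rw [← h.smul_compl, Set.smul_mem_smul_set_iff]
  exact D.base_notMem K hK

/-- The base point lies in `aH`, so the complement of `aH` lies behind some direction. That
direction contains `aK`, by disjointness, and the image of the base point, which is not in `aH`. -/
theorem absorbs_of_disjoint {a : L} {K H : Set V} (hH : H ∈ D.dirs)
    (h : D.gen (D.inv a) • D.base ∈ H) (hd : ¬ (K ∩ H).Nonempty) : D.Absorbs a K := by
  rw [D.gen_inv, ← Set.mem_smul_set_iff_inv_smul_mem] at h
  obtain ⟨K', hK', hsub⟩ := D.exists_supset_compl H hH _ h
  refine ⟨K', hK', ?_, ?_⟩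
  · refine (Set.smul_set_mono ?_).trans hsub
    intro z hz hz'
    exact hd ⟨z, hz, hz'⟩
  · apply hsub
    rw [Set.smul_mem_smul_set_iff]
    exact D.base_notMem H hH

/-- Outside the first case `aK` lies in a direction `K'`. If `K'` misses the image of the base
point, pulling it back gives a set between `K` and a direction, and the antichain property forces
`aK = K'`. -/
theorem trichotomy {K : Set V} (hK : K ∈ D.dirs) (a : L) :
    D.gen (D.inv a) • D.base ∈ K ∨ D.Absorbs a K ∨ D.gen a • K ∈ D.dirs := by
  by_cases h1 : D.gen (D.inv a) • D.base ∈ K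
  · exact .inl h1
  right
  rw [D.gen_inv, ← Set.mem_smul_set_iff_inv_smul_mem] at h1
  obtain ⟨K', hK', hsub⟩ := D.exists_supset K hK _ h1
  by_cases h2 : D.gen a • D.base ∈ K'
  · exact .inl ⟨K', hK', hsub, h2⟩
  right
  obtain ⟨K'', hK'', hsub'⟩ := D.exists_supset K' hK' (D.gen a)⁻¹
    (by rwa [Set.mem_inv_smul_set_iff])
  have h3 : K ⊆ (D.gen a)⁻¹ • K' := by rwa [← Set.smul_set_subset_iff_subset_inv_smul_set]
  have h4 := D.antichain K hK K'' hK'' (h3.trans hsub')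
  have h5 : (D.gen a)⁻¹ • K' = K := Set.Subset.antisymm (h4 ▸ hsub') h3
  rw [inv_smul_eq_iff] at h5
  rwa [← h5]

/-- A set of letters, together with a set of directions that all these letters invert, such that the
remaining directions towards images of the base point under these letters are useful. -/
structure Core [Fintype L] (τ : ℝ) where
  inverted : Finset (Set V)
  inverted_mem : ∀ K ∈ inverted, K ∈ D.dirs
  letters : L → Prop
  letters_inv : ∀ a, letters a → letters (D.inv a)
  inverts : ∀ a, letters a → ∀ K ∈ inverted, D.Inverts a K
  exists_dir : ∀ a, letters a → ∃ K ∈ D.dirs, K ∉ inverted ∧ D.gen a • D.base ∈ K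
  useful : ∀ K ∈ D.dirs, K ∉ inverted → (∃ a, letters a ∧ D.gen a • D.base ∈ K) →
    τ ≤ cnt (fun a => letters a ∧ D.Absorbs a K) ∨
      2 * τ ≤ cnt (fun a => letters a ∧ D.gen a • D.base ∈ K)

namespace Core

variable {D} [Fintype L] {τ : ℝ} (C : D.Core τ)

/-- The directions towards images of the base point. -/
def targets : Set (Set V) :=
  {K | K ∈ D.dirs ∧ K ∉ C.inverted ∧ ∃ a, C.letters a ∧ D.gen a • D.base ∈ K}

/-- A direction that crosses all inverted directions. -/
def Transverse (K : Set V) : Prop :=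
  K ∈ D.dirs ∧ K ∉ C.inverted ∧ ∀ K' ∈ C.inverted, (K ∩ K').Nonempty

theorem targets_transverse {K : Set V} (h : K ∈ C.targets) : C.Transverse K := by
  obtain ⟨h1, h2, a, ha, hK⟩ := h
  exact ⟨h1, h2, fun K' hK' => ⟨_, hK, (C.inverts a ha K' hK').base_mem (C.inverted_mem K' hK')⟩⟩

/-- A core letter exchanges the sides of an inverted `K'`, so `aK` meets `K'` exactly when `K` meets
the complement of `K'`; the antichain property guarantees the latter. -/
theorem Transverse.smul {C : D.Core τ} {K : Set V} (h : C.Transverse K) {a : L} (ha : C.letters a)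
    (hK : D.gen a • K ∈ D.dirs) : C.Transverse (D.gen a • K) := by
  refine ⟨hK, ?_, ?_⟩
  · intro hm
    have h1 := (C.inverts a ha _ hm).inv
    unfold Inverts at h1
    rw [D.gen_inv_smul_gen_smul] at h1
    have h2 : D.base ∉ K := D.base_notMem K h.1
    rw [h1, Set.mem_compl_iff, not_not] at h2
    exact D.base_notMem _ hK h2
  · intro K' hK'
    have h1 : ¬ K ⊆ K' := by
      intro hsub
      exact h.2.1 (D.antichain K h.1 K' (C.inverted_mem K' hK') hsub ▸ hK')
    obtain ⟨z, hz, hz'⟩ := Set.not_subset.1 h1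
    refine ⟨D.gen a • z, Set.smul_mem_smul_set hz, ?_⟩
    rw [← (C.inverts a ha K' hK').smul_compl]
    exact Set.smul_mem_smul_set hz'

theorem Transverse.exists_target {C : D.Core τ} {K : Set V} (h : C.Transverse K) {a : L}
    (ha : C.letters a) (hK : D.Absorbs a K) : ∃ K' ∈ C.targets, D.gen a • K ⊆ K' := by
  obtain ⟨K', hK', hsub, hb⟩ := hK
  refine ⟨K', ⟨hK', ?_, a, ha, hb⟩, hsub⟩
  intro hm
  have h1 := C.inverts a ha K' hm
  rw [← h1.smul_compl, Set.smul_set_subset_smul_set_iff] at hsub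
  obtain ⟨z, hz, hz'⟩ := h.2.2 K' hm
  exact hsub hz hz'

/-- Directions from which one can reach a target within `j + 1` steps. -/
def Wins : ℕ → Set V → Prop
  | 0, K => K ∈ C.targets ∨ τ ≤ cnt (fun a => C.letters a ∧ D.Absorbs a K)
  | j + 1, K => Wins j K ∨
      τ ≤ cnt (fun a => C.letters a ∧ D.gen a • K ∈ D.dirs ∧ Wins j (D.gen a • K))

theorem wins_mono {i j : ℕ} (h : i ≤ j) {K : Set V} (hK : C.Wins i K) : C.Wins j K := by
  induction h with
  | refl => exact hK
  | step _ ih => exact .inl ih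

/-- A losing direction is moved by most letters to losing directions. -/
theorem cnt_losing {K : Set V} (hK : C.Transverse K) {j : ℕ} (hl : ¬ C.Wins (j + 1) K) :
    cnt (fun a => C.letters a ∧ ¬ (D.gen a • K ∈ D.dirs ∧ ¬ C.Wins j (D.gen a • K))) ≤ 2 * τ := by
  have h0 : ¬ C.Wins 0 K := fun h => hl (C.wins_mono (Nat.zero_le _) h)
  simp only [Wins, not_or, not_le] at h0 hl
  have := cnt_le_add (P := fun a => C.letters a ∧
      ¬ (D.gen a • K ∈ D.dirs ∧ ¬ C.Wins j (D.gen a • K)))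
    (Q := fun a => C.letters a ∧ D.Absorbs a K)
    (R := fun a => C.letters a ∧ D.gen a • K ∈ D.dirs ∧ C.Wins j (D.gen a • K)) (by
      rintro a ⟨ha, h⟩
      rcases D.trichotomy hK.1 a with h1 | h1 | h1
      · exact absurd ⟨hK.1, hK.2.1, _, C.letters_inv a ha, h1⟩ h0.1
      · exact .inl ⟨ha, h1⟩
      · by_cases h2 : C.Wins j (D.gen a • K)
        · exact .inr ⟨ha, h1, h2⟩
        · exact absurd ⟨h1, h2⟩ h)
  linarith [h0.2, hl.2]

/-- A losing direction crosses every target that is not absorbed by many letters. -/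
theorem crosses_of_losing (hτ : 0 < τ) {k K : Set V} (hk : k ∈ C.targets)
    (hk' : cnt (fun a => C.letters a ∧ D.Absorbs a k) < τ)
    (hl : ¬ C.Wins 0 K) : K ≠ k ∧ (K ∩ k).Nonempty := by
  simp only [Wins, not_or, not_le] at hl
  refine ⟨fun h => hl.1 (h ▸ hk), ?_⟩
  have h1 : 2 * τ ≤ cnt (fun a => C.letters a ∧ D.gen a • D.base ∈ k) :=
    (C.useful k hk.1 hk.2.1 hk.2.2).resolve_left (not_le.2 hk')
  rw [← cnt_comp D.inv_inv] at h1
  -- At least `2τ` letters have inverses moving the base point into `k`, and fewer than `τ` absorb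
  -- `K`. A letter of the first kind but not the second would absorb `K` if `K` and `k` were
  -- disjoint.
  obtain ⟨a, ⟨ha, hak⟩, h2⟩ := exists_of_cnt_lt
    (P := fun a => C.letters (D.inv a) ∧ D.gen (D.inv a) • D.base ∈ k)
    (Q := fun a => C.letters a ∧ D.Absorbs a K) (by linarith [hl.2])
  by_contra hd
  refine h2 ⟨?_, D.absorbs_of_disjoint hk.1 hak hd⟩
  have := C.letters_inv _ ha
  rwa [D.inv_inv] at this

variable {φ γ : ℝ} (hτ : 0 < τ)
  (hφ : ∀ K ∈ D.dirs, K ∉ C.inverted → cnt (fun a => D.gen (D.inv a) • D.base ∈ K) ≤ φ)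
  (hγ : γ ≤ cnt C.letters) (hφγ : φ + (2 * n + 2) * τ ≤ γ)
include hτ hφ hγ hφγ

/-- From a target one can get back to the targets within `n + 1` steps: otherwise there would be
`n + 1` pairwise crossing directions. -/
theorem target_wins {k : Set V} (hk : k ∈ C.targets)
    (hk' : cnt (fun a => C.letters a ∧ D.Absorbs a k) < τ) :
    τ ≤ cnt (fun a => C.letters a ∧ D.gen a • k ∈ D.dirs ∧ C.Wins n (D.gen a • k)) := by
  by_contra! hlose
  have hkt := C.targets_transverse hk
  -- From at least `γ` core letters, remove at most `φ` whose inverse moves the base point into `k`,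
  -- fewer than `τ` absorbing `k`, and fewer than `τ` leading `k` to a winning direction.
  have hP : 2 * n * τ <
      cnt (fun a => C.letters a ∧ D.gen a • k ∈ D.dirs ∧ ¬ C.Wins n (D.gen a • k)) := by
    have h1 := cnt_le_add (P := C.letters)
      (Q := fun a => C.letters a ∧ D.gen a • k ∈ D.dirs ∧ ¬ C.Wins n (D.gen a • k))
      (R := fun a => D.gen (D.inv a) • D.base ∈ k ∨ (C.letters a ∧ D.Absorbs a k) ∨
        (C.letters a ∧ D.gen a • k ∈ D.dirs ∧ C.Wins n (D.gen a • k))) (by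
          intro a ha
          rcases D.trichotomy hk.1 a with h | h | h
          · exact .inr (.inl h)
          · exact .inr (.inr (.inl ⟨ha, h⟩))
          · by_cases h2 : C.Wins n (D.gen a • k)
            · exact .inr (.inr (.inr ⟨ha, h, h2⟩))
            · exact .inl ⟨ha, h, h2⟩)
    have h2 := cnt_le_add (P := fun a => D.gen (D.inv a) • D.base ∈ k ∨
        (C.letters a ∧ D.Absorbs a k) ∨
        (C.letters a ∧ D.gen a • k ∈ D.dirs ∧ C.Wins n (D.gen a • k))) (fun a h => h)
    have h3 := cnt_le_add (P := fun a => (C.letters a ∧ D.Absorbs a k) ∨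
        (C.letters a ∧ D.gen a • k ∈ D.dirs ∧ C.Wins n (D.gen a • k))) (fun a h => h)
    have h4 := hφ k hk.1 hk.2.1
    linarith
  have key : ∀ l, l ≤ n → ∃ Ω : Finset (Set V), Ω.card = l ∧ k ∉ Ω ∧
      (∀ K ∈ Ω, C.Transverse K ∧ ¬ C.Wins (n + 1 - l) K) ∧
      ∀ K ∈ insert k Ω, ∀ K' ∈ insert k Ω, (K ∩ K').Nonempty := by
    intro l
    induction l with
    | zero =>
      intro _
      refine ⟨∅, rfl, by simp, by simp, ?_⟩
      intro K hK K' hK'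
      simp only [insert_empty_eq, Finset.mem_singleton] at hK hK'
      subst hK hK'
      obtain ⟨a, -, ha⟩ := hk.2.2
      exact ⟨_, ha, ha⟩
    | succ l ih =>
      intro hl
      obtain ⟨Ω, hcard, hkΩ, hΩ, hmeet⟩ := ih (by omega)
      -- One letter must keep `k` and all `l` members of `Ω` losing. Each member spoils at most `2 *
      -- τ` letters, and `l ≤ n`, so `hP` leaves a choice.
      obtain ⟨a, ⟨ha, hak, hakn⟩, hall⟩ := exists_forall_not_of_cnt_lt
        (P := fun a => C.letters a ∧ D.gen a • k ∈ D.dirs ∧ ¬ C.Wins n (D.gen a • k)) Ω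
        (fun K a => C.letters a ∧ ¬ (D.gen a • K ∈ D.dirs ∧ ¬ C.Wins (n - l) (D.gen a • K)))
        (2 * τ)
        (fun K hK => by
          refine C.cnt_losing (hΩ K hK).1 ?_
          rw [show n - l + 1 = n + 1 - l by omega]
          exact (hΩ K hK).2)
        (by
          refine lt_of_le_of_lt ?_ hP
          rw [hcard]
          have : (l : ℝ) ≤ n := by exact_mod_cast (by omega : l ≤ n)
          nlinarith)
      have hnew : ∀ K ∈ insert k Ω, C.Transverse (D.gen a • K) ∧
          ¬ C.Wins (n + 1 - (l + 1)) (D.gen a • K) := by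
        intro K hK
        rw [show n + 1 - (l + 1) = n - l by omega]
        rcases Finset.mem_insert.1 hK with rfl | hK
        · exact ⟨hkt.smul ha hak, fun h => hakn (C.wins_mono (by omega) h)⟩
        · have h1 := hall K hK
          push Not at h1
          obtain ⟨h2, h3⟩ := h1 ha
          exact ⟨(hΩ K hK).1.smul ha h2, h3⟩
      have hcross : ∀ K ∈ insert k Ω, D.gen a • K ≠ k ∧ (D.gen a • K ∩ k).Nonempty :=
        fun K hK => C.crosses_of_losing hτ hk hk' fun h =>
          (hnew K hK).2 (C.wins_mono (Nat.zero_le _) h)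
      -- Move the whole family, including `k`. The images are losing, so they differ from the
      -- original `k` and cross it; `k` can be adjoined afresh, and the family has grown by one at
      -- the price of one level of the game.
      refine ⟨(insert k Ω).image (D.gen a • ·), ?_, ?_, ?_, ?_⟩
      · rw [Finset.card_image_of_injective _ (MulAction.injective _),
          Finset.card_insert_of_notMem hkΩ, hcard]
      · intro h
        obtain ⟨K, hK, h⟩ := Finset.mem_image.1 h
        exact (hcross K hK).1 h
      · intro K hK
        obtain ⟨K₀, hK₀, rfl⟩ := Finset.mem_image.1 hK
        exact hnew K₀ hK₀
      · intro K hK K' hK'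
        rcases Finset.mem_insert.1 hK with rfl | hK
        · rcases Finset.mem_insert.1 hK' with rfl | hK'
          · exact hmeet _ (Finset.mem_insert_self _ _) _ (Finset.mem_insert_self _ _)
          · obtain ⟨K₁, hK₁, rfl⟩ := Finset.mem_image.1 hK'
            rw [Set.inter_comm]
            exact (hcross K₁ hK₁).2
        · obtain ⟨K₀, hK₀, rfl⟩ := Finset.mem_image.1 hK
          rcases Finset.mem_insert.1 hK' with rfl | hK'
          · exact (hcross K₀ hK₀).2
          · obtain ⟨K₁, hK₁, rfl⟩ := Finset.mem_image.1 hK'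
            show (D.gen a • K₀ ∩ D.gen a • K₁).Nonempty
            rw [← Set.smul_set_inter]
            exact (hmeet K₀ hK₀ K₁ hK₁).smul_set
  obtain ⟨Ω, hcard, hkΩ, hΩ, hmeet⟩ := key n le_rfl
  have := D.card_le (insert k Ω) (by
    intro K hK
    rcases Finset.mem_insert.1 hK with rfl | hK
    · exact hk.1
    · exact (hΩ K hK).1.1) hmeet
  rw [Finset.card_insert_of_notMem hkΩ] at this
  omega

end Core

end DirectionSystem

end

/-! ### Finite state sets, and the construction of a core. -/

section

open scoped Pointwise Classical

namespace DirectionSystem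

variable {G : Type u} {V : Type v} {L : Type w} [Group G] [MulAction G V] {n : ℕ}
  (D : DirectionSystem G V L n)

theorem exists_dirsAt (z : V) :
    ∃ s : Finset (Set V), s.card ≤ n ∧ ∀ K, K ∈ s ↔ K ∈ D.dirs ∧ z ∈ K := by
  have key : ∀ s : Finset (Set V), (↑s ⊆ {K | K ∈ D.dirs ∧ z ∈ K}) → s.card ≤ n := fun s hs =>
    D.card_le s (fun K hK => (hs hK).1) (fun K hK K' hK' => ⟨z, (hs hK).2, (hs hK').2⟩)
  have hfin : {K | K ∈ D.dirs ∧ z ∈ K}.Finite := by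
    by_contra h
    obtain ⟨s, hs, hc⟩ := Set.Infinite.exists_subset_card_eq h (n + 1)
    have := key s hs
    omega
  exact ⟨hfin.toFinset, key _ (by simp), by simp⟩

namespace Core

variable {D} [Fintype L] {τ : ℝ} (C : D.Core τ)

theorem exists_finset_targets :
    ∃ s : Finset (Set V), s.card ≤ n * Fintype.card L ∧ ∀ K, K ∈ C.targets → K ∈ s := by
  choose s hs hs' using D.exists_dirsAt
  refine ⟨Finset.univ.biUnion fun a => s (D.gen a • D.base), ?_, ?_⟩
  · refine Finset.card_biUnion_le.trans ((Finset.sum_le_card_nsmul _ _ n fun a _ => hs _).trans ?_)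
    simp [mul_comm]
  · rintro K ⟨h1, -, a, -, h2⟩
    exact Finset.mem_biUnion.2 ⟨a, Finset.mem_univ _, (hs' _ _).2 ⟨h1, h2⟩⟩

/-- The translates of a collection of sets by words of bounded length. -/
noncomputable def translates (D : DirectionSystem G V L n) (s : Finset (Set V)) :
    ℕ → Finset (Set V)
  | 0 => s
  | j + 1 => translates D s j ∪
      Finset.univ.biUnion fun a => (translates D s j).image (D.gen a • ·)

omit C in
theorem card_translates (s : Finset (Set V)) (j : ℕ) :
    (translates D s j).card ≤ s.card * (Fintype.card L + 1) ^ j := by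
  induction j with
  | zero => simp [translates]
  | succ j ih =>
    have h1 : (Finset.univ.biUnion fun a => (translates D s j).image (D.gen a • ·)).card ≤
        Fintype.card L * (translates D s j).card :=
      Finset.card_biUnion_le.trans ((Finset.sum_le_card_nsmul _ _ (translates D s j).card
        fun a _ => Finset.card_image_le).trans (by simp))
    calc (translates D s (j + 1)).card
        ≤ (translates D s j).card + Fintype.card L * (translates D s j).card :=
          (Finset.card_union_le _ _).trans (by gcongr)
      _ = (translates D s j).card * (Fintype.card L + 1) := by ring
      _ ≤ s.card * (Fintype.card L + 1) ^ j * (Fintype.card L + 1) := by gcongr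
      _ = _ := by ring

omit C in
theorem translates_mono (s : Finset (Set V)) {i j : ℕ} (h : i ≤ j) :
    translates D s i ⊆ translates D s j := by
  induction h with
  | refl => exact Finset.Subset.refl _
  | step _ ih => exact ih.trans Finset.subset_union_left

omit C in
theorem smul_mem_translates (s : Finset (Set V)) {j : ℕ} {K : Set V} (a : L)
    (h : K ∈ translates D s j) : D.gen a • K ∈ translates D s (j + 1) :=
  Finset.mem_union_right _ (Finset.mem_biUnion.2 ⟨a, Finset.mem_univ _,
    Finset.mem_image.2 ⟨K, h, rfl⟩⟩)

variable {φ γ : ℝ} (hτ : 0 < τ) (hφ0 : 0 ≤ φ)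
  (hφ : ∀ K ∈ D.dirs, K ∉ C.inverted → cnt (fun a => D.gen (D.inv a) • D.base ∈ K) ≤ φ)
  (hγ : γ ≤ cnt C.letters) (hφγ : φ + (2 * n + 2) * τ ≤ γ)
include hτ hφ0 hφ hγ hφγ

/-- A finite collection of sets that do not contain the base point, such that many letters move a
given set into another set of the collection. -/
theorem exists_states :
    ∃ S : Finset (Set V), S.card ≤ n * Fintype.card L * (Fintype.card L + 1) ^ (n + 1) ∧
      (∀ K ∈ S, D.base ∉ K) ∧
      (∀ K ∈ S, τ ≤ cnt (fun a => ∃ K' ∈ S, D.gen a • K ⊆ K')) ∧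
      ∀ z, τ ≤ cnt (fun a => ∃ K' ∈ S, D.gen a • z ∈ K') := by
  obtain ⟨T, hTcard, hT⟩ := C.exists_finset_targets
  -- A state may use `n + 1 - j` translations while it still needs up to `j` rounds to reach level
  -- `0`. Each winning move lowers `j`, and a visit to a target resets the count, so all play stays
  -- in one finite set.
  set S := (translates D T (n + 1)).filter fun K =>
    C.Transverse K ∧ ∃ j ≤ n, C.Wins j K ∧ K ∈ translates D T (n + 1 - j) with hS
  have memS : ∀ {K}, K ∈ S ↔
      C.Transverse K ∧ ∃ j ≤ n, C.Wins j K ∧ K ∈ translates D T (n + 1 - j) := by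
    intro K
    rw [hS, Finset.mem_filter, and_iff_right_iff_imp]
    rintro ⟨-, j, -, -, h⟩
    exact translates_mono T (Nat.sub_le _ _) h
  have targetS : ∀ {K}, K ∈ C.targets → K ∈ S := fun {K} hK =>
    memS.2 ⟨C.targets_transverse hK, 0, Nat.zero_le _, .inl hK,
      translates_mono T (Nat.zero_le _) (hT K hK)⟩
  have hwin : ∀ j ≤ n, ∀ K, C.Transverse K → C.Wins j K → K ∈ translates D T (n + 1 - j) →
      τ ≤ cnt (fun a => ∃ K' ∈ S, D.gen a • K ⊆ K') := by
    intro j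
    induction j with
    | zero =>
      intro _ K hK hw _
      by_cases hgood : τ ≤ cnt (fun a => C.letters a ∧ D.Absorbs a K)
      · refine hgood.trans (cnt_mono ?_)
        rintro a ⟨ha, hab⟩
        obtain ⟨K', hK', hsub⟩ := hK.exists_target ha hab
        exact ⟨K', targetS hK', hsub⟩
      · have hKt : K ∈ C.targets := Or.resolve_right hw hgood
        refine (C.target_wins hτ hφ hγ hφγ hKt (not_le.1 hgood)).trans (cnt_mono ?_)
        rintro a ⟨ha, h1, h2⟩
        refine ⟨_, memS.2 ⟨hK.smul ha h1, n, le_rfl, h2, ?_⟩, subset_rfl⟩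
        rw [Nat.add_sub_cancel_left]
        exact smul_mem_translates T a (hT K hKt)
    | succ j ih =>
      intro hj K hK hw hKT
      rcases hw with hw | hw
      · exact ih (by omega) K hK hw (translates_mono T (by omega) hKT)
      · refine hw.trans (cnt_mono ?_)
        rintro a ⟨ha, h1, h2⟩
        refine ⟨_, memS.2 ⟨hK.smul ha h1, j, by omega, h2, ?_⟩, subset_rfl⟩
        rw [show n + 1 - j = n + 1 - (j + 1) + 1 by omega]
        exact smul_mem_translates T a hKT
  have hstate : ∀ K ∈ S, τ ≤ cnt (fun a => ∃ K' ∈ S, D.gen a • K ⊆ K') := by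
    intro K hK
    obtain ⟨h1, j, hj, h2, h3⟩ := memS.1 hK
    exact hwin j hj K h1 h2 h3
  refine ⟨S, ?_, fun K hK => D.base_notMem K (memS.1 hK).1.1, hstate, ?_⟩
  · refine (Finset.card_filter_le _ _).trans ((card_translates T (n + 1)).trans ?_)
    gcongr
  · intro z
    by_cases hz : ∃ K ∈ C.targets, z ∈ K
    · obtain ⟨K, hK, hzK⟩ := hz
      refine (hstate K (targetS hK)).trans (cnt_mono ?_)
      rintro a ⟨K', hK', hsub⟩
      exact ⟨K', hK', hsub (Set.smul_mem_smul_set hzK)⟩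
    · have hle : τ ≤ cnt C.letters := by nlinarith [(Nat.cast_nonneg n : (0 : ℝ) ≤ n)]
      refine hle.trans (cnt_mono ?_)
      intro a ha
      -- A point outside all targets is outside a direction `H` containing the image of the base
      -- point under the inverse letter. Every core letter then sends it behind a target containing
      -- the complement of `aH`.
      obtain ⟨H, hH, hHi, hb⟩ := C.exists_dir _ (C.letters_inv a ha)
      have hHt : H ∈ C.targets := ⟨hH, hHi, _, C.letters_inv a ha, hb⟩
      have hzH : z ∉ H := fun h => hz ⟨H, hHt, h⟩
      rw [D.gen_inv, ← Set.mem_smul_set_iff_inv_smul_mem] at hb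
      obtain ⟨K', hK', hsub⟩ := D.exists_supset_compl H hH _ hb
      refine ⟨K', targetS ⟨hK', ?_, a, ha, ?_⟩, hsub (Set.smul_mem_smul_set hzH)⟩
      · intro hm
        rw [← (C.inverts a ha K' hm).smul_compl, Set.smul_set_subset_smul_set_iff,
          Set.compl_subset_compl] at hsub
        exact hHi (D.antichain K' hK' H hH hsub ▸ hm)
      · exact hsub (Set.smul_mem_smul_set (D.base_notMem H hH))

end Core

theorem exists_max_card {α : Type*} {P : Finset α → Prop} (h : ∃ s, P s) (N : ℕ)
    (hN : ∀ s, P s → s.card ≤ N) : ∃ s, P s ∧ ∀ t, P t → t.card ≤ s.card := by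
  have h1 : (Finset.card '' {s | P s}).Nonempty := Set.Nonempty.image _ h
  have h2 : BddAbove (Finset.card '' {s | P s}) := ⟨N, by rintro _ ⟨s, hs, rfl⟩; exact hN s hs⟩
  obtain ⟨s, hs, hs'⟩ := Nat.sSup_mem h1 h2
  exact ⟨s, hs, fun t ht => hs' ▸ le_csSup h2 ⟨t, ht, rfl⟩⟩

/-- The constant `c₁` of the theorem. -/
noncomputable def c₁ (n : ℕ) : ℝ := (1 / 10) ^ (n + 2)

/-- The constant `c₂` of the theorem. -/
noncomputable def c₂ (n : ℕ) : ℝ := c₁ n / (20 * (n + 1))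

theorem c₁_pos (n : ℕ) : 0 < c₁ n := by unfold c₁; positivity

theorem c₂_pos (n : ℕ) : 0 < c₂ n := div_pos (c₁_pos n) (by positivity)

theorem c₁_lt (n : ℕ) : c₁ n < 1 / 2 := by
  unfold c₁
  have : ((1 : ℝ) / 10) ^ (n + 2) ≤ (1 / 10) ^ 1 :=
    pow_le_pow_of_le_one (by norm_num) (by norm_num) (by omega)
  linarith

theorem c₂_mul (n : ℕ) : c₂ n * (20 * (n + 1)) = c₁ n :=
  div_mul_cancel₀ _ (by positivity)

theorem c₂_lt (n : ℕ) : c₂ n < 1 / 2 := by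
  nlinarith [c₂_mul n, c₁_lt n, c₂_pos n, (Nat.cast_nonneg n : (0 : ℝ) ≤ n)]

variable [Fintype L]

/-- Letters that preserve none of the sides of a direction are controlled by minimality of the
displacement. -/
theorem cnt_base_le {K : Set V}
    (hmin : cnt (fun a => D.gen a • D.base ∈ K ∧ D.gen (D.inv a) • D.base ∈ K ∧ ¬ D.Inverts a K) ≤
      cnt (fun a => D.gen a • D.base ∉ K ∧ D.gen (D.inv a) • D.base ∉ K)) :
    2 * cnt (fun a => D.gen (D.inv a) • D.base ∈ K) ≤
      Fintype.card L + cnt (fun a => D.Inverts a K) := by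
  -- Sort letters by the sides of the two images of the base point. Inversion matches the two mixed
  -- classes, and the hypothesis trades noninverting letters with both images in `K` for letters
  -- with both outside.
  have h1 := cnt_le_add (P := fun a => D.gen a • D.base ∈ K)
    (Q := fun a => D.gen a • D.base ∈ K ∧ D.gen (D.inv a) • D.base ∈ K ∧ ¬ D.Inverts a K)
    (R := fun a => D.Inverts a K ∨ (D.gen a • D.base ∈ K ∧ D.gen (D.inv a) • D.base ∉ K))
    (fun a ha => by by_cases h : D.Inverts a K <;> by_cases h' : D.gen (D.inv a) • D.base ∈ K <;>
      simp [ha, h, h'])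
  have h2 := cnt_le_add (P := fun a => D.Inverts a K ∨
    (D.gen a • D.base ∈ K ∧ D.gen (D.inv a) • D.base ∉ K)) (fun a h => h)
  have h3 := cnt_comp D.inv_inv (fun a => D.gen a • D.base ∈ K ∧ D.gen (D.inv a) • D.base ∉ K)
  have h4 := cnt_comp D.inv_inv (fun a => D.gen a • D.base ∈ K)
  have h5 := cnt_add_le
    (P := fun a => D.gen (D.inv a) • D.base ∈ K ∧ D.gen (D.inv (D.inv a)) • D.base ∉ K)
    (Q := fun a => D.gen a • D.base ∉ K ∧ D.gen (D.inv a) • D.base ∉ K)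
    (R := fun a => D.gen a • D.base ∉ K)
    (fun a ha => by have := ha.2; rwa [D.inv_inv] at this) (fun a ha => ha.1)
    (fun a ha hb => hb.2 ha.1)
  have h6 := cnt_add_le (P := fun a => D.gen a • D.base ∉ K) (Q := fun a => D.gen a • D.base ∈ K)
    (R := fun _ => True) (fun _ _ => trivial) (fun _ _ => trivial) (fun a ha hb => ha hb)
  rw [cnt_true] at h6
  linarith

/-- Existence of a core: first choose as many directions as possible that are inverted by almost all
letters, then as many pairwise crossing directions as possible that almost all letters avoid. -/
theorem exists_core (hm : 0 < Fintype.card L)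
    (hmin : ∀ K ∈ D.dirs,
      cnt (fun a => D.gen a • D.base ∈ K ∧ D.gen (D.inv a) • D.base ∈ K ∧ ¬ D.Inverts a K) ≤
      cnt (fun a => D.gen a • D.base ∉ K ∧ D.gen (D.inv a) • D.base ∉ K))
    (hfix : ∀ B : Finset (Set V), (∀ K ∈ B, K ∈ D.dirs) →
      (∀ K ∈ B, ∀ K' ∈ B, (K ∩ K').Nonempty) →
      ∃ F : L → Prop, (∀ a, F a → F (D.inv a)) ∧ cnt F < c₁ n * Fintype.card L ∧
        ∀ a, (∀ K ∈ B, D.Inverts a K) → (∀ K ∈ D.dirs, D.gen a • D.base ∈ K → K ∈ B) →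
          (∀ K ∈ D.dirs, D.gen (D.inv a) • D.base ∈ K → K ∈ B) → F a) :
    ∃ (C : D.Core (c₂ n * Fintype.card L)) (φ γ : ℝ), 0 ≤ φ ∧
      (∀ K ∈ D.dirs, K ∉ C.inverted → cnt (fun a => D.gen (D.inv a) • D.base ∈ K) ≤ φ) ∧
      γ ≤ cnt C.letters ∧ φ + (2 * n + 2) * (c₂ n * Fintype.card L) ≤ γ := by
  set m : ℝ := (Fintype.card L : ℝ) with hmdef
  have hm' : 0 < m := Nat.cast_pos.2 hm
  set q := c₁ n with hq
  set τ := c₂ n * m with hτ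
  have hτ0 : 0 < τ := mul_pos (c₂_pos n) hm'
  have hδpos : ∀ j : ℕ, q ≤ 10 ^ j * q := fun j =>
    le_mul_of_one_le_left (c₁_pos n).le (one_le_pow₀ (by norm_num))
  -- The tolerated loss of letters grows tenfold with each inverted direction. The exponent in `c₁`
  -- keeps it below `1 / 10` even for `n + 1` directions, so some letter inverts them all and they
  -- meet pairwise.
  have hδ1 : ∀ j ≤ n + 1, 10 ^ j * q ≤ 1 / 10 := by
    intro j hj
    have h1 : (10 : ℝ) ^ j ≤ 10 ^ (n + 1) := pow_le_pow_right₀ (by norm_num) hj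
    have h2 : (10 : ℝ) ^ (n + 1) * q = 1 / 10 := by
      rw [hq, c₁, pow_succ (1 / 10 : ℝ) (n + 1), ← mul_assoc, ← mul_pow]
      norm_num
    have := c₁_pos n
    nlinarith
  -- the inverted directions
  obtain ⟨B, ⟨hBd, hBc, hBm⟩, hBmax⟩ := exists_max_card
    (P := fun B : Finset (Set V) => (∀ K ∈ B, K ∈ D.dirs) ∧ B.card ≤ n + 1 ∧
      (1 - 10 ^ B.card * q) * m ≤ cnt (fun a => ∀ K ∈ B, D.Inverts a K))
    ⟨∅, by simp, by simp, by
      simp only [Finset.card_empty, pow_zero, one_mul, Finset.notMem_empty, IsEmpty.forall_iff,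
        implies_true, cnt_true, ← hmdef]
      nlinarith [c₁_pos n]⟩ (n + 1) (fun B hB => hB.2.1)
  have hBmeet : ∀ K ∈ B, ∀ K' ∈ B, (K ∩ K').Nonempty := by
    obtain ⟨a, ha⟩ := exists_of_cnt_pos (P := fun a => ∀ K ∈ B, D.Inverts a K)
      (lt_of_lt_of_le (mul_pos (by linarith [hδ1 _ hBc]) hm') hBm)
    exact fun K hK K' hK' =>
      ⟨_, (ha K hK).base_mem (hBd K hK), (ha K' hK').base_mem (hBd K' hK')⟩
  have hBn : B.card ≤ n := D.card_le B hBd hBmeet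
  set δ : ℝ := 10 ^ B.card * q with hδ
  have hδq : q ≤ δ := hδpos _
  have hδle : 10 * δ ≤ 1 / 10 := by
    have := hδ1 (B.card + 1) (by omega)
    rw [pow_succ] at this
    linarith
  -- By maximality fewer than `(1 - 10 * δ) * m` letters invert `K` together with `B`. At most `δ *
  -- m` fail to invert `B`, so fewer than `(1 - 9 * δ) * m` invert `K`; `cnt_base_le` averages this
  -- with `m`.
  have hφ : ∀ K ∈ D.dirs, K ∉ B →
      cnt (fun a => D.gen (D.inv a) • D.base ∈ K) ≤ (1 - 9 / 2 * δ) * m := by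
    intro K hK hKB
    have h1 := D.cnt_base_le (hmin K hK)
    have h2 : cnt (fun a => ∀ K' ∈ insert K B, D.Inverts a K') < (1 - 10 * δ) * m := by
      by_contra! h
      have := hBmax (insert K B) ⟨by
        intro K' hK'
        rcases Finset.mem_insert.1 hK' with rfl | hK'
        · exact hK
        · exact hBd K' hK', by rw [Finset.card_insert_of_notMem hKB]; omega, by
          rw [Finset.card_insert_of_notMem hKB, pow_succ]
          refine le_trans (le_of_eq ?_) h
          rw [hδ]
          ring⟩
      rw [Finset.card_insert_of_notMem hKB] at this
      omega
    have h3 := cnt_le_add (P := fun a => D.Inverts a K)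
      (Q := fun a => ∀ K' ∈ insert K B, D.Inverts a K')
      (R := fun a => ¬ ∀ K' ∈ B, D.Inverts a K') (fun a ha => by
        by_cases h : ∀ K' ∈ B, D.Inverts a K'
        · exact .inl fun K' hK' => by
            rcases Finset.mem_insert.1 hK' with rfl | hK'
            · exact ha
            · exact h K' hK'
        · exact .inr h)
    have h4 := cnt_add_le (P := fun a => ∀ K' ∈ B, D.Inverts a K')
      (Q := fun a => ¬ ∀ K' ∈ B, D.Inverts a K') (R := fun _ => True)
      (fun _ _ => trivial) (fun _ _ => trivial) (fun a h h' => h' h)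
    rw [cnt_true, ← hmdef] at h4
    rw [← hmdef] at h1
    linarith
  -- the letters that invert these directions and move the centre of the corresponding cube
  obtain ⟨F, hFinv, hFc, hF⟩ := hfix B hBd hBmeet
  set Γ₀ : L → Prop := fun a => (∀ K ∈ B, D.Inverts a K) ∧ ¬ F a with hΓ₀
  have hΓ₀inv : ∀ a, Γ₀ a → Γ₀ (D.inv a) := fun a ha =>
    ⟨fun K hK => (ha.1 K hK).inv, fun h => ha.2 (by have := hFinv _ h; rwa [D.inv_inv] at this)⟩
  have hΓ₀c : (1 - δ - q) * m ≤ cnt Γ₀ := by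
    have := cnt_le_add (P := fun a => ∀ K ∈ B, D.Inverts a K) (Q := Γ₀) (R := F) (fun a ha => by
      by_cases h : F a
      · exact .inr h
      · exact .inl ⟨ha, h⟩)
    linarith
  -- If all directions towards the image under `a` were in `B`, the same would hold for the inverse
  -- of `a`, because `a` carries the complement of such a direction behind a member of `B`, which it
  -- inverts. Then `a` would belong to `F`.
  have hΓ₀dir : ∀ a, Γ₀ a → ∃ K ∈ D.dirs, K ∉ B ∧ D.gen a • D.base ∈ K := by
    intro a ha
    by_contra! h
    have h1 : ∀ K ∈ D.dirs, D.gen a • D.base ∈ K → K ∈ B := fun K hK hb => by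
      by_contra hKB
      exact h K hK hKB hb
    refine ha.2 (hF a ha.1 h1 fun H hH hb => ?_)
    rw [D.gen_inv, ← Set.mem_smul_set_iff_inv_smul_mem] at hb
    obtain ⟨K', hK', hsub⟩ := D.exists_supset_compl H hH _ hb
    have hm := h1 K' hK' (hsub (Set.smul_mem_smul_set (D.base_notMem H hH)))
    rw [← (ha.1 K' hm).smul_compl, Set.smul_set_subset_smul_set_iff,
      Set.compl_subset_compl] at hsub
    exact D.antichain K' hK' H hH hsub ▸ hm
  -- the avoided directions
  set Γ : Finset (Set V) → L → Prop := fun s a => Γ₀ a ∧ ∀ H ∈ D.dirs, H ∉ B →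
    (D.gen a • D.base ∈ H ∨ D.gen (D.inv a) • D.base ∈ H) →
      ∀ h ∈ s, H ≠ h ∧ (h ∩ H).Nonempty with hΓ
  have hΓinv : ∀ s a, Γ s a → Γ s (D.inv a) := fun s a ha =>
    ⟨hΓ₀inv a ha.1, fun H hH hHB h => ha.2 H hH hHB (by rw [D.inv_inv] at h; exact h.symm)⟩
  obtain ⟨s, ⟨hsd, hsmeet, hsc⟩, hsmax⟩ := exists_max_card
    (P := fun s : Finset (Set V) => (∀ K ∈ s, K ∈ D.dirs) ∧
      (∀ K ∈ s, ∀ K' ∈ s, (K ∩ K').Nonempty) ∧ (1 - δ - q) * m - 6 * s.card * τ ≤ cnt (Γ s))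
    ⟨∅, by simp, by simp, by
      simp only [Finset.card_empty, Nat.cast_zero, mul_zero, zero_mul, sub_zero]
      exact hΓ₀c.trans (cnt_mono fun a ha => ⟨ha, by simp⟩)⟩ n (fun s hs => D.card_le s hs.1 hs.2.1)
  have hsn : s.card ≤ n := D.card_le s hsd hsmeet
  refine ⟨⟨B, hBd, Γ s, hΓinv s, fun a ha => ha.1.1, fun a ha => hΓ₀dir a ha.1, ?_⟩,
    (1 - 9 / 2 * δ) * m, (1 - δ - q) * m - 6 * n * τ, ?_, hφ, ?_, ?_⟩
  · rintro h hh hhB ⟨b, hb, hbh⟩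
    by_contra! hbad
    obtain ⟨hbad1, hbad2⟩ := hbad
    have hbs := hb.2 h hh hhB (.inl hbh)
    have hhs : h ∉ s := fun hm => (hbs h hm).1 rfl
    -- A direction `h` that is not useful could be added to `s`. The letters lost move the base
    -- point into `h` (fewer than `2τ`) or absorb `h` (fewer than `τ`), or their inverses do; this
    -- is the loss of `6τ` per member allowed to `s`.
    have := hsmax (insert h s) ⟨by
        intro K hK
        rcases Finset.mem_insert.1 hK with rfl | hK
        · exact hh
        · exact hsd K hK, by
        intro K hK K' hK'
        rcases Finset.mem_insert.1 hK with h1 | h1 <;> rcases Finset.mem_insert.1 hK' with h2 | h2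
        · exact ⟨_, h1 ▸ hbh, h2 ▸ hbh⟩
        · rw [Set.inter_comm, h1]
          exact (hbs K' h2).2
        · rw [h2]
          exact (hbs K h1).2
        · exact hsmeet K h1 K' h2, by
        rw [Finset.card_insert_of_notMem hhs]
        have e1 := cnt_comp D.inv_inv (fun a => Γ s a ∧ D.gen a • D.base ∈ h)
        have e2 := cnt_comp D.inv_inv (fun a => Γ s a ∧ D.Absorbs a h)
        have h1 := cnt_le_add (P := Γ s) (Q := Γ (insert h s))
          (R := fun a => ((Γ s a ∧ D.gen a • D.base ∈ h) ∨
            (Γ s (D.inv a) ∧ D.gen (D.inv a) • D.base ∈ h)) ∨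
            ((Γ s a ∧ D.Absorbs a h) ∨ (Γ s (D.inv a) ∧ D.Absorbs (D.inv a) h))) (by
          intro a ha
          by_contra! hcon
          obtain ⟨hc1, ⟨hc2, hc3⟩, hc4, hc5⟩ := hcon
          refine hc1 ⟨ha.1, fun H hH hHB hor k hk => ?_⟩
          rcases Finset.mem_insert.1 hk with rfl | hk
          · constructor
            · rintro rfl
              rcases hor with hor | hor
              · exact hc2 ha hor
              · exact hc3 (hΓinv s a ha) hor
            · by_contra hd
              rcases hor with hor | hor
              · exact hc5 (hΓinv s a ha)
                  (D.absorbs_of_disjoint hH (by rwa [D.inv_inv]) hd)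
              · exact hc4 ha (D.absorbs_of_disjoint hH hor hd)
          · exact ha.2 H hH hHB hor k hk)
        have h2 := cnt_le_add (P := fun a => ((Γ s a ∧ D.gen a • D.base ∈ h) ∨
            (Γ s (D.inv a) ∧ D.gen (D.inv a) • D.base ∈ h)) ∨
            ((Γ s a ∧ D.Absorbs a h) ∨ (Γ s (D.inv a) ∧ D.Absorbs (D.inv a) h)))
            (fun a h => h)
        have h3 := cnt_le_add (P := fun a => (Γ s a ∧ D.gen a • D.base ∈ h) ∨
            (Γ s (D.inv a) ∧ D.gen (D.inv a) • D.base ∈ h)) (fun a h => h)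
        have h4 := cnt_le_add (P := fun a => (Γ s a ∧ D.Absorbs a h) ∨
            (Γ s (D.inv a) ∧ D.Absorbs (D.inv a) h)) (fun a h => h)
        push_cast
        linarith⟩
    rw [Finset.card_insert_of_notMem hhs] at this
    omega
  · exact mul_nonneg (by linarith) hm'.le
  · refine le_trans ?_ hsc
    have : (s.card : ℝ) ≤ n := by exact_mod_cast hsn
    nlinarith
  -- What remains is `(8n + 2)τ ≤ (7/2 δ - q)m`, which holds because `q ≤ δ` and `c₂` was chosen so
  -- that `20(n + 1)τ = qm`.
  · have h1 : τ * (20 * (n + 1)) = q * m := by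
      rw [hτ, mul_right_comm, c₂_mul]
    have h2 : q * m ≤ δ * m := by gcongr
    have h3 : 0 ≤ n * τ := by positivity
    nlinarith

/-- The combinatorial core of the theorem. -/
theorem exists_states (hm : 0 < Fintype.card L)
    (hmin : ∀ K ∈ D.dirs,
      cnt (fun a => D.gen a • D.base ∈ K ∧ D.gen (D.inv a) • D.base ∈ K ∧ ¬ D.Inverts a K) ≤
      cnt (fun a => D.gen a • D.base ∉ K ∧ D.gen (D.inv a) • D.base ∉ K))
    (hfix : ∀ B : Finset (Set V), (∀ K ∈ B, K ∈ D.dirs) →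
      (∀ K ∈ B, ∀ K' ∈ B, (K ∩ K').Nonempty) →
      ∃ F : L → Prop, (∀ a, F a → F (D.inv a)) ∧ cnt F < c₁ n * Fintype.card L ∧
        ∀ a, (∀ K ∈ B, D.Inverts a K) → (∀ K ∈ D.dirs, D.gen a • D.base ∈ K → K ∈ B) →
          (∀ K ∈ D.dirs, D.gen (D.inv a) • D.base ∈ K → K ∈ B) → F a) :
    ∃ S : Finset (Set V), S.card ≤ n * Fintype.card L * (Fintype.card L + 1) ^ (n + 1) ∧
      (∀ K ∈ S, D.base ∉ K) ∧
      (∀ K ∈ S, c₂ n * Fintype.card L ≤ cnt (fun a => ∃ K' ∈ S, D.gen a • K ⊆ K')) ∧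
      ∀ z, c₂ n * Fintype.card L ≤ cnt (fun a => ∃ K' ∈ S, D.gen a • z ∈ K') := by
  obtain ⟨C, φ, γ, hφ0, hφ, hγ, hφγ⟩ := D.exists_core hm hmin hfix
  exact C.exists_states (mul_pos (c₂_pos n) (by exact_mod_cast hm)) hφ0 hφ hγ hφγ

end DirectionSystem

end

/-! ### Actions on CAT(0) cube complexes and minimal displacement. -/

section

open scoped Pointwise Classical

namespace CubeMap

/-- At the centre all corners have equal weight, and flipping coordinate `j` pairs the corners with
value `0` there with those with value `1`. So the antipodal map fixes the centre. -/
theorem extend_sub_half {k : ℕ} (j : Fin k) :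
    (sub (fun _ => true) (fun i : Fin k => i) Function.injective_id).extend
      (fun _ => (1 / 2 : ℝ)) j = 1 / 2 := by
  unfold extend
  have h1 : ∀ v : Fin k → Bool, (∏ i, (if v i then (1 / 2 : ℝ) else 1 - 1 / 2)) = (1 / 2) ^ k := by
    intro v
    rw [Finset.prod_congr rfl (g := fun _ => (1 / 2 : ℝ)) (fun i _ => by split <;> norm_num)]
    simp
  have h2 : ∀ v : Fin k → Bool,
      (sub (fun _ => true) (fun i : Fin k => i) Function.injective_id).toFun v j = !(v j) := by
    intro v
    rw [sub_apply (fun _ => true) (fun i : Fin k => i) Function.injective_id v j]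
    simp
  simp only [h1, h2]
  have h3 : ∑ v : Fin k → Bool, (1 / 2 : ℝ) ^ k * (if (!(v j)) = true then 1 else 0) =
      ∑ v : Fin k → Bool, (1 / 2 : ℝ) ^ k * (if v j = true then 1 else 0) := by
    refine Finset.sum_bij' (fun v _ => Function.update v j (!(v j)))
      (fun v _ => Function.update v j (!(v j))) ?_ ?_ ?_ ?_ ?_ <;> simp
  have h4 : ∑ v : Fin k → Bool, (1 / 2 : ℝ) ^ k * (if (!(v j)) = true then 1 else 0) +
      ∑ v : Fin k → Bool, (1 / 2 : ℝ) ^ k * (if v j = true then 1 else 0) = 1 := by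
    rw [← Finset.sum_add_distrib,
      Finset.sum_congr rfl (g := fun _ => (1 / 2 : ℝ) ^ k) (fun v _ => by
        cases v j <;> simp)]
    simp
  linarith

end CubeMap

namespace CubeComplex

variable {X : CubeComplex.{u}}

theorem originEdge_src {k : ℕ} (c : X.Cube k) (i : Fin k) : X.src (X.originEdge c i) = X.origin c :=
  src_edgeAt _ _ _

namespace IsCAT0

variable (hX : X.IsCAT0)
include hX

theorem halfspace_edgeAt {k : ℕ} (c : X.Cube k) (i : Fin k) (s : Finset (Fin k)) (hi : i ∉ s) :
    X.halfspace (X.edgeAt (fun j => decide (j ∈ s)) i c) = X.halfspace (X.originEdge c i) := by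
  induction s using Finset.induction_on with
  | empty => simp
  | insert j s hj ih =>
    rw [Finset.mem_insert, not_or] at hi
    rw [← ih hi.2, hX.halfspace_eq_of_sq (sq_edgeAt c (fun l => decide (l ∈ s)) hi.1)]
    congr 2
    ext l
    by_cases hl : l = j
    · subst hl
      simp [hj]
    · simp [hl]

omit hX in
theorem corner_insert {k : ℕ} (c : X.Cube k) (i : Fin k) (s : Finset (Fin k)) (hi : i ∉ s) :
    X.tgt (X.edgeAt (fun j => decide (j ∈ s)) i c) =
      X.corner (fun j => decide (j ∈ insert i s)) c := by
  rw [tgt_edgeAt]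
  congr 1
  ext l
  by_cases hl : l = i
  · subst hl
    simp [hi]
  · simp [hl]

/-- A half space that contains a corner of a cube but not the origin of the cube is the half space
of an edge of the cube. -/
theorem exists_halfspace_eq {k : ℕ} (c : X.Cube k) {e : X.Dart}
    (h0 : X.origin c ∉ X.halfspace e) (s : Finset (Fin k))
    (hs : X.corner (fun j => decide (j ∈ s)) c ∈ X.halfspace e) :
    ∃ i, X.halfspace e = X.halfspace (X.originEdge c i) := by
  induction s using Finset.induction_on with
  | empty => exact absurd (by simpa using hs) h0
  | insert j s hj ih =>
    by_cases h1 : X.corner (fun j => decide (j ∈ s)) c ∈ X.halfspace e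
    · exact ih h1
    · rw [← corner_insert c j s hj] at hs
      rw [← src_edgeAt _ j] at h1
      exact ⟨j, by rw [← hX.halfspace_eq_of_crossing h1 hs, hX.halfspace_edgeAt c j s hj]⟩

theorem halfspace_edgeAt_true {k : ℕ} (c : X.Cube k) (i : Fin k) :
    X.halfspace (X.edgeAt (fun _ => true) i c) = (X.halfspace (X.originEdge c i))ᶜ := by
  rw [← hX.halfspace_edgeAt c i (Finset.univ.erase i) (by simp), ← hX.halfspace_rev, rev_edgeAt]
  congr 2
  ext l
  by_cases hl : l = i
  · subst hl
    simp
  · simp [hl]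

theorem corner_true_mem {k : ℕ} (c : X.Cube k) (i : Fin k) :
    X.corner (fun _ => true) c ∈ X.halfspace (X.originEdge c i) := by
  have := IsCAT0.src_notMem_halfspace (X.edgeAt (fun _ => true) i c)
  rw [src_edgeAt, hX.halfspace_edgeAt_true] at this
  simpa using this

end IsCAT0

namespace Action

variable {G : Type v} [Group G] (a : X.Action G)

/-- The action on the vertices. -/
@[reducible] def mulAction : MulAction G X.Vertex where
  smul g x := a.smul g x
  one_smul x := a.one_smul x
  mul_smul g h x := a.mul_smul g h x

/-- The action on the points. -/
@[reducible] def pointAction : MulAction G X.Point where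
  smul := a.smulPoint
  one_smul := by
    rintro ⟨n, c, t⟩
    exact congrArg (fun c' => Quot.mk _ (⟨n, c', t⟩ : X.PrePoint)) (a.one_smul c)
  mul_smul g h := by
    rintro ⟨n, c, t⟩
    exact congrArg (fun c' => Quot.mk _ (⟨n, c', t⟩ : X.PrePoint)) (a.mul_smul g h c)

theorem inv_smul_smul (g : G) {n : ℕ} (c : X.Cube n) : a.smul g⁻¹ (a.smul g c) = c := by
  rw [← a.mul_smul, inv_mul_cancel, a.one_smul]

theorem smul_inv_smul (g : G) {n : ℕ} (c : X.Cube n) : a.smul g (a.smul g⁻¹ c) = c := by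
  rw [← a.mul_smul, mul_inv_cancel, a.one_smul]

theorem src_smul (g : G) (e : X.Dart) : X.src (a.smul g e) = a.smul g (X.src e) :=
  (a.smul_face g _ e).symm

theorem tgt_smul (g : G) (e : X.Dart) : X.tgt (a.smul g e) = a.smul g (X.tgt e) :=
  (a.smul_face g _ e).symm

theorem edgeAt_smul (g : G) {n : ℕ} (v : Fin n → Bool) (i : Fin n) (c : X.Cube n) :
    X.edgeAt v i (a.smul g c) = a.smul g (X.edgeAt v i c) :=
  (a.smul_face g _ c).symm

theorem isPath_smul (g : G) {x y : X.Vertex} {p : List X.Dart} (h : X.IsPath x p y) :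
    X.IsPath (a.smul g x) (p.map (a.smul g)) (a.smul g y) := by
  induction p generalizing x with
  | nil => exact congrArg _ h
  | cons e p ih =>
    obtain ⟨rfl, h⟩ := h
    refine ⟨a.src_smul g e, ?_⟩
    rw [tgt_smul]
    exact ih h

variable (hX : X.IsCAT0)
include hX

theorem dist_smul (g : G) (x y : X.Vertex) : X.dist (a.smul g x) (a.smul g y) = X.dist x y := by
  have key : ∀ (g : G) x y, X.dist (a.smul g x) (a.smul g y) ≤ X.dist x y := by
    intro g x y
    obtain ⟨p, hp, hl⟩ := hX.exists_geodesic x y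
    have := (a.isPath_smul g hp).dist_le
    rwa [List.length_map, hl] at this
  refine le_antisymm (key g x y) ?_
  have := key g⁻¹ (a.smul g x) (a.smul g y)
  rwa [a.inv_smul_smul, a.inv_smul_smul] at this

theorem smul_mem_halfspace (g : G) {x : X.Vertex} {e : X.Dart} :
    a.smul g x ∈ X.halfspace (a.smul g e) ↔ x ∈ X.halfspace e := by
  simp only [halfspace, Set.mem_ofPred_eq, src_smul, tgt_smul, a.dist_smul hX]

theorem smul_halfspace (g : G) (e : X.Dart) :
    let _ := a.mulAction
    g • X.halfspace e = X.halfspace (a.smul g e) := by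
  let _ := a.mulAction
  ext z
  rw [Set.mem_smul_set_iff_inv_smul_mem]
  show a.smul g⁻¹ z ∈ _ ↔ _
  rw [← a.smul_mem_halfspace hX g, a.smul_inv_smul]

/-- The system of directions at a vertex. -/
@[reducible] def directions {n : ℕ} (hn : X.HasDim n) {L : Type w} (gen : L → G) (inv : L → L)
    (hinv : Function.Involutive inv) (hgen : ∀ l, gen (inv l) = (gen l)⁻¹) (x : X.Vertex) :
    @DirectionSystem G X.Vertex L _ a.mulAction n :=
  let _ := a.mulAction
  { gen := gen
    inv := inv
    inv_inv := hinv
    gen_inv := hgen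
    base := x
    dirs := {K | ∃ e, X.src e = x ∧ X.halfspace e = K}
    base_notMem := by
      rintro _ ⟨e, rfl, rfl⟩
      exact IsCAT0.src_notMem_halfspace e
    exists_supset := by
      rintro _ ⟨e, -, rfl⟩ g hx
      rw [a.smul_halfspace hX] at hx ⊢
      obtain ⟨e', h1, h2⟩ := hX.exists_halfspace_subset hx
      exact ⟨_, ⟨e', h1, rfl⟩, h2⟩
    exists_supset_compl := by
      rintro _ ⟨e, -, rfl⟩ g hx
      rw [← hX.halfspace_rev, a.smul_halfspace hX]
      have hx' : x ∉ X.halfspace (a.smul g (X.rev e)) := by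
        rw [← a.smul_halfspace hX, hX.halfspace_rev, Set.smul_set_compl]
        exact fun h => h hx
      obtain ⟨e', h1, h2⟩ := hX.exists_halfspace_subset hx'
      exact ⟨_, ⟨e', h1, rfl⟩, h2⟩
    antichain := by
      rintro _ ⟨e, rfl, rfl⟩ _ ⟨e', h, rfl⟩ hsub
      rw [hX.eq_of_halfspace_subset h.symm hsub]
    card_le := by
      intro s hs hmeet
      rcases s.eq_empty_or_nonempty with rfl | ⟨K₀, hK₀⟩
      · simp
      obtain ⟨e₀, -⟩ := hs K₀ hK₀
      have : Nonempty X.Dart := ⟨e₀⟩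
      choose! f hf1 hf2 using hs
      have hinj : Set.InjOn f (s : Set (Set X.Vertex)) := by
        intro K hK K' hK' h
        rw [← hf2 K hK, h, hf2 K' hK']
      rw [← Finset.card_image_of_injOn hinj]
      refine hX.card_le_of_linkAdj hn (x := x) _ ?_ ?_
      · intro e he
        obtain ⟨K, hK, rfl⟩ := Finset.mem_image.1 he
        exact hf1 K hK
      · intro e he e' he' hne
        obtain ⟨K, hK, rfl⟩ := Finset.mem_image.1 he
        obtain ⟨K', hK', rfl⟩ := Finset.mem_image.1 he'
        obtain ⟨z, hz, hz'⟩ := hmeet K hK K' hK'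
        exact hX.linkAdj_of_mem (by rw [hf1 K hK, hf1 K' hK']) hne (z := z)
          (by rwa [hf2 K hK]) (by rwa [hf2 K' hK']) }

/-- If an automorphism exchanges the two sides of every hyperplane of a cube, and no other
hyperplanes at the origin separate the origin from its images, then it fixes the centre of the
cube. -/
theorem smul_eq_face_of_inverts {k : ℕ} (c : X.Cube k) (g : G)
    (hinv : ∀ i, X.halfspace (a.smul g (X.originEdge c i)) = (X.halfspace (X.originEdge c i))ᶜ)
    (h1 : ∀ e, X.src e = X.origin c → a.smul g (X.origin c) ∈ X.halfspace e →
      ∃ i, X.halfspace e = X.halfspace (X.originEdge c i))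
    (h2 : ∀ e, X.src e = X.origin c → a.smul g⁻¹ (X.origin c) ∈ X.halfspace e →
      ∃ i, X.halfspace e = X.halfspace (X.originEdge c i)) :
    a.smul g c =
      X.face (CubeMap.sub (fun _ => true) (fun i : Fin k => i) Function.injective_id) c := by
  have hbase : ∀ i, a.smul g (X.origin c) ∈ X.halfspace (X.originEdge c i) := by
    intro i
    have h := IsCAT0.src_notMem_halfspace (a.smul g (X.originEdge c i))
    rw [hinv, src_smul, originEdge_src] at h
    simpa using h
  have hfix : a.smul g (X.origin c) = X.corner (fun _ => true) c := by
    by_contra hne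
    obtain ⟨f, hf, hd⟩ := hX.exists_first_dart (Ne.symm hne)
    have hgf : a.smul g (X.origin c) ∈ X.halfspace f := by rw [hX.mem_halfspace, hf, hd]
    -- Let `y` be the corner opposite to the origin and `f` the first edge from `y` towards the
    -- image. If `f` points back to the origin, it is an edge of the cube, but the image is already
    -- beyond every hyperplane of the cube.
    by_cases hxf : X.origin c ∈ X.halfspace f
    · have h3 : X.origin c ∉ X.halfspace (X.rev f) := by rw [hX.halfspace_rev]; simpa using hxf
      obtain ⟨e, he, hsub⟩ := hX.exists_halfspace_subset h3
      have hy : X.corner (fun _ => true) c ∈ X.halfspace e := by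
        apply hsub
        rw [hX.halfspace_rev, ← hf]
        exact IsCAT0.src_notMem_halfspace f
      have h4 := IsCAT0.src_notMem_halfspace e
      rw [he] at h4
      obtain ⟨i, hi⟩ := hX.exists_halfspace_eq c h4 Finset.univ (by simpa using hy)
      rw [hX.halfspace_rev, Set.compl_subset_comm, hi, ← hX.halfspace_edgeAt_true] at hsub
      have h5 := hX.eq_of_halfspace_subset (by rw [hf, src_edgeAt]) hsub
      rw [← h5, hX.halfspace_edgeAt_true] at hgf
      exact hgf (hbase i)
    · obtain ⟨e, he, hsub⟩ := hX.exists_halfspace_subset hxf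
      obtain ⟨i, hi⟩ := h1 e he (hsub hgf)
      have h3 : X.origin c ∉ X.halfspace (a.smul g⁻¹ (X.rev f)) := by
        rw [← a.smul_mem_halfspace hX g, a.smul_inv_smul, hX.halfspace_rev]
        simpa using hgf
      obtain ⟨e', he', hsub'⟩ := hX.exists_halfspace_subset h3
      have h4 : a.smul g⁻¹ (X.origin c) ∈ X.halfspace (a.smul g⁻¹ (X.rev f)) := by
        rw [a.smul_mem_halfspace hX, hX.halfspace_rev]
        exact hxf
      obtain ⟨j, hj⟩ := h2 e' he' (hsub' h4)
      -- Pull the complement of the half space of `f` back by `g`: it lies behind the cube direction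
      -- `j`. Since `g` inverts that direction, the `j`-th half space lies in that of `f`. It
      -- contains `y`, where `f` starts, which is absurd.
      have h5 : X.halfspace (X.originEdge c j) ⊆ X.halfspace f := by
        intro z hz
        by_contra hzf
        have h6 : a.smul g⁻¹ z ∈ X.halfspace e' := by
          apply hsub'
          rw [a.smul_mem_halfspace hX, hX.halfspace_rev]
          exact hzf
        rw [hj, ← a.smul_mem_halfspace hX g, a.smul_inv_smul, hinv] at h6
        exact h6 hz
      have h6 : X.corner (fun _ => true) c ∈ X.halfspace f := h5 (hX.corner_true_mem c j)
      rw [← hf] at h6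
      exact IsCAT0.src_notMem_halfspace f h6
  have ho : ∀ i, (CubeMap.sub (fun _ => true) (fun i : Fin k => i)
      Function.injective_id).toFun (fun _ => false) i = true := by
    intro i
    rw [CubeMap.sub_apply (fun _ => true) (fun i : Fin k => i) Function.injective_id _ i]
    rfl
  apply hX.nonPositivelyCurved.link_unique
  · rw [origin, origin, corner_face, funext ho, ← hfix]
    exact (a.smul_face g _ c).symm
  · intro i
    rw [originEdge, originEdge, edgeAt_face_sub, funext ho, edgeAt_smul]
    apply hX.eq_of_halfspace_subset
    · rw [src_smul, src_edgeAt, src_edgeAt, hfix]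
    · rw [hX.halfspace_edgeAt_true]
      exact (hinv i).le

-- A cube mapped to its antipodal reparametrisation keeps its centre, by the gluing relation.
omit hX in
theorem smulPoint_center {k : ℕ} (c : X.Cube k) (g : G) (h : a.smul g c =
      X.face (CubeMap.sub (fun _ => true) (fun i : Fin k => i) Function.injective_id) c)
    (half : Set.Icc (0 : ℝ) 1) (hh : (half : ℝ) = 1 / 2) :
    a.smulPoint g (Quot.mk _ ⟨k, c, fun _ => half⟩) = Quot.mk _ ⟨k, c, fun _ => half⟩ := by
  show Quot.mk _ (⟨k, a.smul g c, fun _ => half⟩ : X.PrePoint) = _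
  rw [h]
  apply Quot.sound
  refine Glue.mk _ c _ _ fun j => ?_
  simp only [hh]
  exact (CubeMap.extend_sub_half j).symm

omit hX in
theorem cnt_le_of_sum_le {L : Type w} [Fintype L] {P Q : L → Prop} {f g : L → ℕ}
    (h : ∑ l, f l ≤ ∑ l, g l)
    (hPQ : ∀ l, (P l → g l + 2 ≤ f l) ∧ (Q l → g l ≤ f l + 2) ∧ (¬ Q l → g l ≤ f l)) :
    cnt P ≤ cnt Q := by
  have h1 : ∑ l, (g l + 2 * if P l then 1 else 0) ≤ ∑ l, (f l + 2 * if Q l then 1 else 0) := by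
    refine Finset.sum_le_sum fun l _ => ?_
    have := hPQ l
    by_cases hP : P l <;> by_cases hQ : Q l <;>
    simp only [hP, hQ, true_implies, not_true_eq_false, not_false_eq_true, false_implies,
      if_true, if_false] at this ⊢ <;> omega
  rw [Finset.sum_add_distrib, Finset.sum_add_distrib, ← Finset.mul_sum, ← Finset.mul_sum,
    ← Finset.card_filter, ← Finset.card_filter] at h1
  change _ + 2 * (Finset.univ.filter P).card ≤ _ + 2 * (Finset.univ.filter Q).card at h1
  have h2 : (Finset.univ.filter P).card ≤ (Finset.univ.filter Q).card := by omega
  exact Nat.cast_le.2 (by convert h2)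

/-- Crossing a hyperplane at a vertex of minimal displacement. -/
theorem cnt_le_of_minimal {L : Type w} [Fintype L] (gen : L → G) (inv : L → L)
    (hgen : ∀ l, gen (inv l) = (gen l)⁻¹) {x : X.Vertex}
    (hmin : ∀ y, ∑ l, X.dist x (a.smul (gen l) x) ≤ ∑ l, X.dist y (a.smul (gen l) y))
    {e : X.Dart} (he : X.src e = x) :
    cnt (fun l => a.smul (gen l) x ∈ X.halfspace e ∧ a.smul (gen (inv l)) x ∈ X.halfspace e ∧
        ¬ X.halfspace (a.smul (gen l) e) = (X.halfspace e)ᶜ) ≤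
      cnt (fun l => a.smul (gen l) x ∉ X.halfspace e ∧ a.smul (gen (inv l)) x ∉ X.halfspace e) := by
  subst he
  -- Compare displacements at the two ends of `e`. Crossing `e` lowers the displacement by two when
  -- both images of `x` lie beyond `e` and the hyperplane is not inverted; only when neither image
  -- lies beyond can it rise, by at most two.
  refine cnt_le_of_sum_le (hmin (X.tgt e)) fun l => ?_
  have m1 := hX.mem_halfspace (z := a.smul (gen l) (X.src e)) (e := e)
  have m2 := hX.mem_halfspace (z := a.smul (gen (inv l)) (X.src e)) (e := e)
  have d1 := hX.dist_dart (a.smul (gen l) (X.src e)) e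
  have d2 := hX.dist_dart (X.src e) (a.smul (gen l) e)
  have d3 := hX.dist_dart (X.tgt e) (a.smul (gen l) e)
  have d4 := hX.dist_dart (a.smul (gen l) (X.tgt e)) e
  have s1 : ∀ y, X.dist (a.smul (gen (inv l)) (X.src e)) y =
      X.dist (X.src e) (a.smul (gen l) y) := by
    intro y
    rw [← a.dist_smul hX (gen l), hgen, a.smul_inv_smul]
  rw [s1, s1] at m2
  rw [src_smul, tgt_smul] at d2 d3
  rw [hX.dist_comm _ (X.src e), hX.dist_comm _ (X.tgt e)] at d1 d4 m1
  have m3 : a.smul (gen l) (X.src e) ∈ X.halfspace e →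
      ¬ X.halfspace (a.smul (gen l) e) = (X.halfspace e)ᶜ →
      a.smul (gen l) (X.tgt e) ∈ X.halfspace e := by
    intro h1 h2
    by_contra h3
    apply h2
    have := hX.halfspace_eq_of_crossing (e := e) (f := X.rev (a.smul (gen l) e))
      (by rwa [src_rev, tgt_smul]) (by rwa [tgt_rev, src_smul])
    rw [← this, hX.halfspace_rev, compl_compl]
  rw [hX.mem_halfspace (z := a.smul (gen l) (X.tgt e)), hX.dist_comm _ (X.src e),
    hX.dist_comm _ (X.tgt e)] at m3
  by_cases h1 : a.smul (gen l) (X.src e) ∈ X.halfspace e <;>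
  by_cases h2 : a.smul (gen (inv l)) (X.src e) ∈ X.halfspace e <;>
  by_cases h3 : X.halfspace (a.smul (gen l) e) = (X.halfspace e)ᶜ <;>
  simp only [h1, h2, h3, not_true_eq_false, not_false_eq_true, and_self, and_true, and_false,
    true_iff, false_iff, forall_true_left, true_and, false_implies] at m1 m2 m3 ⊢ <;>
  omega

/-- If every point is moved by most letters, then there are many words that act nontrivially. -/
theorem exists_states {n : ℕ} (hn : X.HasDim n) {L : Type w} [Fintype L]
    (hm : 0 < Fintype.card L) (gen : L → G) (inv : L → L)
    (hinv : Function.Involutive inv) (hgen : ∀ l, gen (inv l) = (gen l)⁻¹)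
    (hfix : ∀ p : X.Point, cnt (fun l => a.smulPoint (gen l) p = p) <
      DirectionSystem.c₁ n * Fintype.card L) :
    ∃ (x : X.Vertex) (S : Finset (Set X.Vertex)),
      S.card ≤ n * Fintype.card L * (Fintype.card L + 1) ^ (n + 1) ∧
      (∀ K ∈ S, x ∉ K) ∧
      (∀ K ∈ S, DirectionSystem.c₂ n * Fintype.card L ≤
        cnt (fun l => ∃ K' ∈ S, ∀ z ∈ K, a.smul (gen l) z ∈ K')) ∧
      ∀ z, DirectionSystem.c₂ n * Fintype.card L ≤
        cnt (fun l => ∃ K' ∈ S, a.smul (gen l) z ∈ K') := by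
  obtain ⟨x₁⟩ := hX.simplyConnected.nonempty
  obtain ⟨x, hx⟩ : ∃ x : X.Vertex, ∀ y,
      ∑ l, X.dist x (a.smul (gen l) x) ≤ ∑ l, X.dist y (a.smul (gen l) y) := by
    obtain ⟨x, hx⟩ := Nat.sInf_mem
      (Set.range_nonempty (ι := X.Vertex) (h := ⟨x₁⟩) fun x => ∑ l, X.dist x (a.smul (gen l) x))
    exact ⟨x, fun y => hx.le.trans (Nat.sInf_le ⟨y, rfl⟩)⟩
  let _ := a.mulAction
  have hhalf : (1 / 2 : ℝ) ∈ Set.Icc (0 : ℝ) 1 := ⟨by norm_num, by norm_num⟩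
  set D := a.directions hX hn gen inv hinv hgen x with hD
  refine Exists.elim (D.exists_states hm ?_ ?_) ?_
  · rintro _ ⟨e, he, rfl⟩
    have := a.cnt_le_of_minimal hX gen inv hgen hx he
    refine le_trans (le_of_eq ?_) this
    unfold DirectionSystem.Inverts
    simp only [← a.smul_halfspace hX]
    rfl
  · intro B hB hmeet
    have hdart : ∀ K ∈ B, ∃ e, X.src e = x ∧ X.halfspace e = K := hB
    choose f hf1 hf2 using hdart
    obtain ⟨c, hc, hce⟩ := hX.nonPositivelyCurved.link_flag x
      (fun i => f _ (B.equivFin.symm i).2)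
      (fun i => hf1 _ (B.equivFin.symm i).2)
      (fun i j h => by
        apply B.equivFin.symm.injective
        apply Subtype.ext
        rw [← hf2 _ (B.equivFin.symm i).2, ← hf2 _ (B.equivFin.symm j).2]
        exact congrArg _ h)
      (fun i j hij => by
        obtain ⟨z, hz, hz'⟩ := hmeet _ (B.equivFin.symm i).2 _ (B.equivFin.symm j).2
        refine hX.linkAdj_of_mem (z := z) ?_ ?_ ?_ ?_
        · rw [hf1 _ (B.equivFin.symm i).2, hf1 _ (B.equivFin.symm j).2]
        · intro h
          apply hij
          apply B.equivFin.symm.injective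
          apply Subtype.ext
          rw [← hf2 _ (B.equivFin.symm i).2, ← hf2 _ (B.equivFin.symm j).2]
          exact congrArg _ h
        · rwa [hf2 _ (B.equivFin.symm i).2]
        · rwa [hf2 _ (B.equivFin.symm j).2])
    have hK : ∀ i, X.halfspace (X.originEdge c i) = (B.equivFin.symm i : Set X.Vertex) := by
      intro i
      rw [hce, hf2 _ (B.equivFin.symm i).2]
    have hKB : ∀ K ∈ B, ∃ i, K = X.halfspace (X.originEdge c i) := by
      intro K hKB
      exact ⟨B.equivFin ⟨K, hKB⟩, by rw [hK]; simp⟩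
    -- The centre of the cube spanned by `B`; the discarded letters are those fixing it.
    set p : X.Point := Quot.mk _ ⟨B.card, c, fun _ => ⟨1 / 2, hhalf⟩⟩ with hp
    refine ⟨fun l => a.smulPoint (gen l) p = p, ?_, hfix p, ?_⟩
    · intro l hl
      show a.smulPoint (gen (inv l)) p = p
      let _ := a.pointAction
      have hl' : gen l • p = p := hl
      show gen (inv l) • p = p
      rw [hgen, inv_smul_eq_iff, hl']
    · intro l hl1 hl2 hl3
      apply a.smulPoint_center _ _ _ _ rfl
      apply a.smul_eq_face_of_inverts hX
      · intro i
        have := hl1 _ (B.equivFin.symm i).2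
        unfold DirectionSystem.Inverts at this
        rw [← hK i] at this
        rw [← this, ← a.smul_halfspace hX]
      · intro e he hm
        rw [hc] at he hm
        exact hKB _ (hl2 _ ⟨e, he, rfl⟩ hm)
      · intro e he hm
        rw [hc] at he hm
        refine hKB _ (hl3 _ ⟨e, he, rfl⟩ ?_)
        show a.smul (gen (inv l)) x ∈ _
        rwa [hgen]
  · rintro S ⟨h1, h2, h3, h4⟩
    refine ⟨x, S, h1, h2, fun K hK => (h3 K hK).trans (cnt_mono ?_), h4⟩
    rintro l ⟨K', hK', hsub⟩
    exact ⟨K', hK', fun z hz => hsub (Set.smul_mem_smul_set hz)⟩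

end Action

end CubeComplex

end

/-! ### Small cancellation words in branching trees. -/

section

open scoped Classical

namespace FreeGroup

/-- Among the words of length `L` in a binary tree of words there is one that violates each of a
small number of constraints, each of which predicts `h` consecutive letters from the preceding
ones. -/
theorem exists_avoiding {α : Type u} (P : List α → Prop) (h0 : P [])
    (hP : ∀ w, P w → ∃ a b, a ≠ b ∧ P (w ++ [a]) ∧ P (w ++ [b])) {ι : Type v} [Fintype ι]
    (j : ι → ℕ) (ψ : ι → List α → Option α) (L h : ℕ) (hj : ∀ c, j c + h ≤ L)
    (hcard : Fintype.card ι < 2 ^ h) :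
    ∃ w, P w ∧ w.length = L ∧ ∀ c, ∃ k, j c ≤ k ∧ k < j c + h ∧ w[k]? ≠ ψ c (w.take k) := by
  set alive : ι → List α → Prop := fun c w =>
    ∀ k, j c ≤ k → k < j c + h → k < w.length → w[k]? = ψ c (w.take k) with halive
  have halive_snoc : ∀ c w x, alive c (w ++ [x]) ↔
      alive c w ∧ (j c ≤ w.length → w.length < j c + h → some x = ψ c w) := by
    intro c w x
    constructor
    · intro H
      refine ⟨fun k h1 h2 h3 => ?_, fun h1 h2 => ?_⟩
      · have := H k h1 h2 (by rw [List.length_append]; omega)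
        rwa [List.getElem?_append_left h3, List.take_append_of_le_length h3.le] at this
      · have := H w.length h1 h2 (by simp)
        simpa using this
    · rintro ⟨H1, H2⟩ k h1 h2 h3
      rw [List.length_append, List.length_singleton] at h3
      rcases Nat.lt_succ_iff_lt_or_eq.1 h3 with h3 | rfl
      · rw [List.getElem?_append_left h3, List.take_append_of_le_length h3.le]
        exact H1 k h1 h2 h3
      · simpa using H2 h1 h2
  -- A constraint obeyed so far weighs `2` to the number of its letters already read, and a violated
  -- one weighs `0`. As at most one of two letters is the predicted one, the average over two
  -- extensions does not increase. A total below `2 ^ h` can thus be maintained, while a constraint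
  -- obeyed to the end would alone weigh `2 ^ h`.
  set f : ι → List α → ℕ := fun c w =>
    if alive c w then 2 ^ (min (w.length - j c) h) else 0 with hf
  have hstep : ∀ c w a b, a ≠ b → f c (w ++ [a]) + f c (w ++ [b]) ≤ 2 * f c w := by
    intro c w a b hab
    simp only [hf, halive_snoc, List.length_append, List.length_singleton]
    by_cases hal : alive c w
    · simp only [hal, true_and, if_true]
      by_cases hw : j c ≤ w.length ∧ w.length < j c + h
      · have e : min (w.length + 1 - j c) h = min (w.length - j c) h + 1 := by omega
        have : ¬ (some a = ψ c w ∧ some b = ψ c w) := by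
          rintro ⟨h1, h2⟩
          exact hab (Option.some_injective _ (h1.trans h2.symm))
        simp only [hw.1, hw.2, true_implies, e, pow_succ]
        by_cases h1 : some a = ψ c w
        · have h2 : ¬ some b = ψ c w := fun h2 => this ⟨h1, h2⟩
          rw [if_pos h1, if_neg h2]
          omega
        · rw [if_neg h1]
          split_ifs <;> omega
      · have e : min (w.length + 1 - j c) h = min (w.length - j c) h := by omega
        rw [e]
        split_ifs <;> omega
    · simp [hal]
  have key : ∀ l, ∃ w, P w ∧ w.length = l ∧ ∑ c, f c w < 2 ^ h := by
    intro l
    induction l with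
    | zero =>
      refine ⟨[], h0, rfl, ?_⟩
      simpa [hf, halive] using hcard
    | succ l ih =>
      obtain ⟨w, hw, hl, hs⟩ := ih
      obtain ⟨a, b, hab, ha, hb⟩ := hP w hw
      have h1 : ∑ c, f c (w ++ [a]) + ∑ c, f c (w ++ [b]) ≤ 2 * ∑ c, f c w := by
        rw [← Finset.sum_add_distrib, Finset.mul_sum]
        exact Finset.sum_le_sum fun c _ => hstep c w a b hab
      rcases le_total (∑ c, f c (w ++ [a])) (∑ c, f c w) with h2 | h2
      · exact ⟨_, ha, by simp [hl], h2.trans_lt hs⟩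
      · exact ⟨_, hb, by simp [hl], by omega⟩
  obtain ⟨w, hw, hl, hs⟩ := key L
  refine ⟨w, hw, hl, fun c => ?_⟩
  by_contra! hcon
  have h1 : f c w = 2 ^ h := by
    have := hj c
    simp only [hf]
    rw [if_pos fun k h1 h2 _ => hcon k h1 h2, min_eq_right (by omega)]
  have := Finset.single_le_sum (f := fun c => f c w) (fun _ _ => Nat.zero_le _)
    (Finset.mem_univ c)
  simp only [h1] at this
  omega

variable {S : Type u}

/-- The formal inverse of a letter. -/
def letterInv (a : Letter S) : Letter S := (a.1, !a.2)

@[simp] theorem letterInv_letterInv (a : Letter S) : letterInv (letterInv a) = a := by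
  simp [letterInv]

theorem getElem?_invRev (w : List (Letter S)) {k : ℕ} (hk : k < w.length) :
    (invRev w)[k]? = (w[w.length - 1 - k]?).map letterInv := by
  unfold invRev
  rw [List.getElem?_reverse (by simpa using hk)]
  simp
  rfl

theorem isReduced_snoc {w : List (Letter S)} {a : Letter S} (hw : IsReduced w)
    (ha : ∀ b ∈ w.getLast?, a ≠ letterInv b) : IsReduced (w ++ [a]) := by
  unfold IsReduced at *
  rw [List.isChain_append]
  refine ⟨hw, by simp, ?_⟩
  intro x hx y hy hxy
  simp only [List.head?_cons, Option.mem_def, Option.some.injEq] at hy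
  subst hy
  have := ha x hx
  by_contra hne
  apply this
  refine Prod.ext hxy.symm ?_
  simp only [letterInv]
  cases hx2 : x.2 <;> cases ha2 : a.2 <;> simp_all

/-- The words `r` and the inverses of the words `r`. -/
def orient (b : Bool) (r : List (Letter S)) : List (Letter S) := if b then r else invRev r

/-- Words of length `L` whose subwords of length `h` determine the word, the orientation and the
position in which they occur. -/
structure Separated (L h : ℕ) (R : Set (List (Letter S))) : Prop where
  length_eq : ∀ r ∈ R, r.length = L
  isCyclicallyReduced : ∀ r ∈ R, IsCyclicallyReduced r
  eq_of_window : ∀ r ∈ R, ∀ r' ∈ R, ∀ b i j, i + h ≤ L → j + h ≤ L →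
    (∀ t < h, r[i + t]? = (orient b r')[j + t]?) → b = true ∧ r = r' ∧ i = j

theorem length_orient (b : Bool) (r : List (Letter S)) : (orient b r).length = r.length := by
  cases b <;> simp [orient]

/-- Inverting both words reverses the windows; this exchanges the roles of `r` and `r'`. -/
theorem window_flip {L h i j : ℕ} {r r' : List (Letter S)} (hr : r.length = L)
    (hr' : r'.length = L) (hi : i + h ≤ L) (hj : j + h ≤ L)
    (H : ∀ t < h, r[i + t]? = (invRev r')[j + t]?) {t : ℕ} (ht : t < h) :
    r'[L - h - j + t]? = (invRev r)[L - h - i + t]? := by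
  have h1 := H (h - 1 - t) (by omega)
  rw [getElem?_invRev _ (by omega), hr'] at h1
  rw [getElem?_invRev _ (by omega), hr, show L - 1 - (L - h - i + t) = i + (h - 1 - t) by omega,
    h1, show L - 1 - (j + (h - 1 - t)) = L - h - j + t by omega, Option.map_map]
  have : (letterInv ∘ letterInv : Letter S → Letter S) = id := funext letterInv_letterInv
  rw [this, Option.map_id, id]

/-- A tree of words in which there are at least two choices for the first letter, and at least two
choices for each further letter that avoid two given letters. -/
structure IsBranching (T : Set (List (Letter S))) : Prop where
  nil_mem : [] ∈ T
  start : ∃ a b, a ≠ b ∧ [a] ∈ T ∧ [b] ∈ T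
  step : ∀ w ∈ T, w ≠ [] → ∀ x y, ∃ a b, a ≠ b ∧ (a ≠ x ∧ a ≠ y ∧ w ++ [a] ∈ T) ∧
    (b ≠ x ∧ b ≠ y ∧ w ++ [b] ∈ T)

/-- The two forbidden letters are the inverse of the last letter, for reducedness, and the inverse
of the first, for cyclic reducedness at every stage. -/
theorem IsBranching.isCyclicallyReduced_step {T : Set (List (Letter S))} (hT : IsBranching T)
    (w : List (Letter S)) (hw : w ∈ T ∧ IsCyclicallyReduced w) :
    ∃ a b, a ≠ b ∧ (w ++ [a] ∈ T ∧ IsCyclicallyReduced (w ++ [a])) ∧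
      (w ++ [b] ∈ T ∧ IsCyclicallyReduced (w ++ [b])) := by
  obtain ⟨hw, hred⟩ := hw
  rcases List.eq_nil_or_concat w with rfl | ⟨w', z, rfl⟩
  · obtain ⟨a, b, hab, ha, hb⟩ := hT.start
    exact ⟨a, b, hab, ⟨ha, IsCyclicallyReduced.singleton⟩, ⟨hb, IsCyclicallyReduced.singleton⟩⟩
  · simp only [List.concat_eq_append] at *
    have hne : w' ++ [z] ≠ [] := by simp
    have hstep : ∀ c, c ≠ letterInv z → c ≠ letterInv ((w' ++ [z]).head hne) →
        IsCyclicallyReduced (w' ++ [z] ++ [c]) := by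
      intro c h1 h2
      rw [isCyclicallyReduced_iff]
      refine ⟨isReduced_snoc hred.isReduced (by simpa using h1), ?_⟩
      intro x hx y hy hxy
      rw [List.getLast?_append_of_ne_nil _ (by simp)] at hx
      rw [List.head?_append_of_ne_nil _ hne, List.head?_eq_some_head hne] at hy
      simp only [List.getLast?_singleton, Option.mem_def, Option.some.injEq] at hx hy
      rw [hy] at h2
      rw [← hx] at hxy ⊢
      by_contra hcon
      apply h2
      refine Prod.ext hxy ?_
      simp only [letterInv]
      cases hx2 : c.2 <;> cases hy2 : y.2 <;> simp_all
    obtain ⟨a, b, hab, ⟨ha1, ha2, ha⟩, ⟨hb1, hb2, hb⟩⟩ := hT.step _ hw hne (letterInv z)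
      (letterInv ((w' ++ [z]).head hne))
    exact ⟨a, b, hab, ⟨ha, hstep a ha1 ha2⟩, ⟨hb, hstep b hb1 hb2⟩⟩

theorem Separated.exists_insert {L h : ℕ} {R : Set (List (Letter S))} (hR : Separated L (2 * h) R)
    (hfin : R.Finite) (hL : 2 * h ≤ L) (hh : 0 < h) {T : Set (List (Letter S))}
    (hT : IsBranching T) (hcard : (R.ncard + 1) * (2 * (L * L)) < 2 ^ h) :
    ∃ w ∈ T, Separated L (2 * h) (insert w R) := by
  have := hfin.fintype
  obtain ⟨w, ⟨hwT, hwr⟩, hwL, hw⟩ := exists_avoiding (fun w => w ∈ T ∧ IsCyclicallyReduced w)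
    ⟨hT.nil_mem, IsCyclicallyReduced.nil⟩ hT.isCyclicallyReduced_step
    (ι := Option R × Bool × Fin L × Fin L)
    -- Only the second half of each window of length `2 * h` is constrained. When `w` is compared
    -- with its own inverse, this ensures that the predicted letter has already been written.
    (fun c => min (c.2.2.1 : ℕ) (L - 2 * h) + h)
    (fun c u => match c with
      | (some x, b, j, i) => (orient b x.1)[i + (u.length - j)]?
      | (none, true, j, i) => u[i + (u.length - j)]?
      | (none, false, j, i) => (u[L - 1 - (i + (u.length - j))]?).map letterInv)
    L h (fun c => by omega) (by
      rw [Fintype.card_prod, Fintype.card_option, Fintype.card_prod, Fintype.card_prod,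
        Fintype.card_bool, Fintype.card_fin]
      rwa [Set.ncard_eq_toFinset_card', Set.toFinset_card] at hcard)
  have hold : ∀ x ∈ R, ∀ b i j, i + 2 * h ≤ L → j + 2 * h ≤ L →
      ¬ ∀ t < 2 * h, w[i + t]? = (orient b x)[j + t]? := by
    intro x hx b i j hi hj H
    obtain ⟨k, h1, h2, h3⟩ := hw (some ⟨x, hx⟩, b, ⟨i, by omega⟩, ⟨j, by omega⟩)
    simp only [List.length_take, hwL] at h1 h2 h3
    rw [min_eq_left (by omega)] at h1 h2 h3
    apply h3
    have := H (k - i) (by omega)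
    rwa [show i + (k - i) = k by omega] at this
  have hself : ∀ i j, i < j → j + 2 * h ≤ L → ¬ ∀ t < 2 * h, w[j + t]? = w[i + t]? := by
    intro i j hij hj H
    obtain ⟨k, h1, h2, h3⟩ := hw (none, true, ⟨j, by omega⟩, ⟨i, by omega⟩)
    simp only [List.length_take, hwL] at h1 h2 h3
    rw [min_eq_left (by omega)] at h1 h2 h3
    apply h3
    have := H (k - j) (by omega)
    rw [List.getElem?_take_of_lt (by omega)]
    rwa [show j + (k - j) = k by omega] at this
  have hinv : ∀ i j, i + 2 * h ≤ L → j + 2 * h ≤ L → L - 2 * h - i ≤ j →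
      ¬ ∀ t < 2 * h, w[j + t]? = (invRev w)[i + t]? := by
    intro i j hi hj hij H
    obtain ⟨k, h1, h2, h3⟩ := hw (none, false, ⟨j, by omega⟩, ⟨i, by omega⟩)
    simp only [List.length_take, hwL] at h1 h2 h3
    rw [min_eq_left (by omega)] at h1 h2 h3
    apply h3
    have := H (k - j) (by omega)
    rw [getElem?_invRev _ (by omega), hwL] at this
    rw [List.getElem?_take_of_lt (by omega)]
    rwa [show j + (k - j) = k by omega] at this
  refine ⟨w, hwT, ?_, ?_, ?_⟩
  · rintro r (rfl | hr)
    exacts [hwL, hR.length_eq r hr]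
  · rintro r (rfl | hr)
    exacts [hwr, hR.isCyclicallyReduced r hr]
  · rintro r (rfl | hr) r' (rfl | hr') b i j hi hj H
    · cases b with
      | true =>
        refine ⟨rfl, rfl, ?_⟩
        rcases lt_trichotomy i j with hij | hij | hij
        · exact absurd (fun t ht => (H t ht).symm) (hself i j hij hj)
        · exact hij
        · exact absurd H (hself j i hij hi)
      | false =>
        exfalso
        -- Prediction from the inverse of `w` needs the later of the two overlapping places in `w`;
        -- in the other case flip the windows.
        rcases le_total (L - 2 * h - j) i with hij | hij
        · exact hinv j i hj hi hij H
        · refine hinv (L - 2 * h - i) (L - 2 * h - j) (by omega) (by omega) (by omega) ?_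
          exact fun t ht => window_flip hwL hwL hi hj H ht
    · exact absurd H (hold r' hr' b i j hi hj)
    · exfalso
      cases b with
      | true => exact hold r hr true j i hj hi fun t ht => (H t ht).symm
      | false =>
        exact hold r hr false (L - 2 * h - j) (L - 2 * h - i) (by omega) (by omega)
          fun t ht => window_flip (hR.length_eq r hr) hwL hi hj H ht
    · exact hR.eq_of_window r hr r' hr' b i j hi hj H

/-- Separated choices of a word in each of finitely many trees. -/
theorem exists_separated {ι : Type v} (F : Finset ι) (T : ι → Set (List (Letter S)))
    (hT : ∀ A ∈ F, IsBranching (T A)) {L h : ℕ} (hL : 2 * h ≤ L) (hh : 0 < h)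
    (hcard : (F.card + 1) * (2 * (L * L)) < 2 ^ h) :
    ∃ r : ι → List (Letter S), (∀ A ∈ F, r A ∈ T A) ∧ Separated L (2 * h) (r '' F) := by
  induction F using Finset.induction_on with
  | empty =>
    refine ⟨fun _ => [], by simp, ?_⟩
    constructor <;> simp
  | insert A F hA ih =>
    rw [Finset.card_insert_of_notMem hA] at hcard
    obtain ⟨r, hr, hS⟩ := ih (fun B hB => hT B (Finset.mem_insert_of_mem hB))
      (lt_of_le_of_lt (by gcongr; omega) hcard)
    obtain ⟨w, hw, hS'⟩ := hS.exists_insert (F.finite_toSet.image r) hL hh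
      (hT A (Finset.mem_insert_self A F)) (lt_of_le_of_lt (by
        gcongr
        exact (Set.ncard_image_le F.finite_toSet).trans (by simp)) hcard)
    have hne : ∀ B ∈ F, Function.update r A w B = r B := fun B hB =>
      Function.update_of_ne (fun h => hA (by rwa [← h])) _ _
    refine ⟨Function.update r A w, fun B hB => ?_, ?_⟩
    · rcases Finset.mem_insert.1 hB with rfl | hB
      · rwa [Function.update_self]
      · rw [hne B hB]
        exact hr B hB
    · rw [Finset.coe_insert, Set.image_insert_eq, Function.update_self,
        Set.image_congr fun B hB => hne B hB]
      exact hS'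

theorem Separated.orient_eq {L k : ℕ} {R : Set (List (Letter S))} (hR : Separated L k R)
    {r r' : List (Letter S)} (hr : r ∈ R) (hr' : r' ∈ R) (c c' : Bool) {i j : ℕ} (hi : i + k ≤ L)
    (hj : j + k ≤ L) (H : ∀ t < k, (orient c r)[i + t]? = (orient c' r')[j + t]?) :
    orient c r = orient c' r' ∧ i = j := by
  cases c with
  | true =>
    obtain ⟨rfl, rfl, h⟩ := hR.eq_of_window r hr r' hr' c' i j hi hj H
    exact ⟨rfl, h⟩
  | false =>
    cases c' with
    | true =>
      have := hR.eq_of_window r' hr' r hr false j i hj hi fun t ht => (H t ht).symm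
      simp at this
    | false =>
      have h1 := hR.eq_of_window r' hr' r hr true (L - k - j) (L - k - i) (by omega) (by omega)
        fun t ht => by
          have := window_flip (r := invRev r) (by rw [invRev_length, hR.length_eq r hr])
            (hR.length_eq r' hr') hi hj H ht
          rwa [invRev_invRev] at this
      exact ⟨by rw [h1.2.1], by omega⟩

theorem exists_rotate_eq {L : ℕ} {R : Set (List (Letter S))} (hR : ∀ r ∈ R, r.length = L)
    (hL : 0 < L) {u : List (Letter S)} (hu : u ∈ symmetrized R) :
    ∃ r ∈ R, ∃ c, ∃ a < L, u = (orient c r).rotate a := by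
  obtain ⟨r, hr, hu⟩ := hu
  have : ∃ c, orient c r ~r u := by
    rcases hu with hu | hu
    exacts [⟨true, hu.symm⟩, ⟨false, hu.symm⟩]
  obtain ⟨c, n, hn⟩ := this
  refine ⟨r, hr, c, n % L, Nat.mod_lt _ hL, ?_⟩
  rw [← hn, ← hR r hr, ← length_orient c r, List.rotate_mod]

theorem getElem?_rotate_window {L k a s : ℕ} {x : List (Letter S)} (hx : x.length = L)
    (ha : a < L) (hs : s + k ≤ L) (h : ¬ (a + s < L ∧ L < a + s + k)) :
    ∃ i, i + k ≤ L ∧ (a + s = i ∨ a + s = i + L) ∧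
      ∀ t < k, (x.rotate a)[s + t]? = x[i + t]? := by
  by_cases h1 : a + s < L
  · refine ⟨a + s, by omega, Or.inl rfl, fun t ht => ?_⟩
    rw [List.getElem?_rotate (by omega), hx, Nat.mod_eq_of_lt (by omega)]
    congr 1
    omega
  · refine ⟨a + s - L, by omega, Or.inr (by omega), fun t ht => ?_⟩
    rw [List.getElem?_rotate (by omega), hx, Nat.mod_eq_sub_mod (by omega),
      Nat.mod_eq_of_lt (by omega)]
    congr 1
    omega

/-- Cut the first `3k` letters of a long piece into three windows. The junction of each of the two
rotations is interior to at most one window, so some window is an honest subword in both. Separation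
then identifies the words, orientations and rotations, so the two words were not distinct. -/
theorem Separated.smallCancellation {L k : ℕ} {R : Set (List (Letter S))} (hR : Separated L k R)
    (hL : 0 < L) (hk : 0 < k) {lam : ℝ} (hlam : ((3 * k : ℕ) : ℝ) ≤ lam * L) :
    SmallCancellation lam R := by
  refine ⟨fun r hr => ⟨?_, hR.isCyclicallyReduced r hr⟩, ?_⟩
  · rintro rfl
    simpa using hL.trans_eq (hR.length_eq [] hr).symm
  · rintro u₀ hu₀ b - ⟨u, hu, v, hv, hne, hbu, hbv⟩
    obtain ⟨r₀, hr₀, c₀, a₀, -, rfl⟩ := exists_rotate_eq hR.length_eq hL hu₀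
    rw [List.length_rotate, length_orient, hR.length_eq r₀ hr₀]
    by_contra! hcon
    have hb : 3 * k ≤ b.length := by exact_mod_cast hlam.trans hcon
    apply hne
    obtain ⟨r, hr, c, a, ha, rfl⟩ := exists_rotate_eq hR.length_eq hL hu
    obtain ⟨r', hr', c', a', ha', rfl⟩ := exists_rotate_eq hR.length_eq hL hv
    have hl : (orient c r).length = L := by rw [length_orient, hR.length_eq r hr]
    have hl' : (orient c' r').length = L := by rw [length_orient, hR.length_eq r' hr']
    have hbL : b.length ≤ L := by simpa [hl] using hbu.length_le
    obtain ⟨s, hs, h1, h2⟩ : ∃ s, s + k ≤ 3 * k ∧ ¬ (a + s < L ∧ L < a + s + k) ∧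
        ¬ (a' + s < L ∧ L < a' + s + k) := by
      by_contra! hno
      have h0 := hno 0
      have h1 := hno k
      have h2 := hno (2 * k)
      omega
    obtain ⟨i, hi, hai, Hi⟩ := getElem?_rotate_window hl ha (by omega) h1
    obtain ⟨j, hj, haj, Hj⟩ := getElem?_rotate_window hl' ha' (by omega) h2
    obtain ⟨h3, h4⟩ := hR.orient_eq hr hr' c c' hi hj fun t ht => by
      rw [← Hi t ht, ← Hj t ht]
      obtain ⟨y, hy⟩ := hbu
      obtain ⟨z, hz⟩ := hbv
      rw [← hy, ← hz, List.getElem?_append_left (by omega), List.getElem?_append_left (by omega)]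
    rw [h3, show a = a' by omega]

/-- Words satisfying a small cancellation condition exist in any finite family of branching
trees. -/
theorem exists_smallCancellation {ι : Type v} (F : Finset ι) (T : ι → Set (List (Letter S)))
    (hT : ∀ A ∈ F, IsBranching (T A)) {p : ℝ} (hp : 1 ≤ p) :
    ∃ r : ι → List (Letter S), (∀ A ∈ F, r A ∈ T A) ∧ SmallCancellation (1 / p) (r '' F) := by
  -- Windows have length `2h`, so pieces are shorter than `6h`; words of length `qh` with `q ≥ 6p`
  -- are long enough. Such an `h` exists because `2 ^ h` outgrows the quadratic number of
  -- constraints.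
  obtain ⟨q, hq⟩ := exists_nat_ge (6 * p)
  have hq1 : 6 ≤ q := by exact_mod_cast (show (6 : ℝ) ≤ q by linarith)
  obtain ⟨h, hh0, hh⟩ : ∃ h : ℕ, 0 < h ∧ (F.card + 1) * (2 * ((q * h) * (q * h))) < 2 ^ h := by
    have h1 := tendsto_pow_const_div_const_pow_of_one_lt 2 (show (1 : ℝ) < 2 by norm_num)
    set C : ℝ := (F.card + 1) * 2 * q * q with hC
    have hC0 : 0 < C := by positivity
    obtain ⟨h, h3, h2⟩ := ((Filter.eventually_gt_atTop 0).and
      (h1.eventually (gt_mem_nhds (show (0 : ℝ) < 1 / C by positivity)))).exists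
    refine ⟨h, h3, ?_⟩
    rw [div_lt_div_iff₀ (by positivity) hC0] at h2
    have : ((F.card : ℝ) + 1) * (2 * ((q * h) * (q * h))) < 2 ^ h := by
      rw [hC] at h2
      nlinarith
    exact_mod_cast this
  obtain ⟨r, hr, hS⟩ := exists_separated F T hT (L := q * h) (h := h)
    (Nat.mul_le_mul_right _ (by omega)) hh0 hh
  refine ⟨r, hr, hS.smallCancellation (by positivity) (by positivity) ?_⟩
  push_cast
  rw [one_div, inv_mul_eq_div, le_div_iff₀ (by linarith)]
  have : (0 : ℝ) ≤ h := Nat.cast_nonneg _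
  nlinarith

end FreeGroup

end

/-! ### Automata from finite transition tables. -/

section

open scoped Classical

theorem exists_finset_card_eq_ceil {L : Type u} [Fintype L] {P : L → Prop} {r : ℝ}
    (h : r ≤ cnt P) : ∃ D : Finset L, (∀ l ∈ D, P l) ∧ D.card = ⌈r⌉₊ := by
  obtain ⟨D, hD, hc⟩ := Finset.exists_subset_card_eq (Nat.ceil_le.2 h)
  exact ⟨D, fun l hl => (Finset.mem_filter.1 (hD hl)).2, hc⟩

namespace FinAutomaton

variable {S : Type u}

theorem isPath_snoc {A : FinAutomaton S} {v w : A.V} {p : List A.E} {e : A.E} :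
    A.IsPath v (p ++ [e]) w ↔ A.IsPath v p (A.src e) ∧ A.tgt e = w := by
  induction p generalizing v with
  | nil => simp [IsPath, eq_comm]
  | cons d p ih => simp [IsPath, ih, and_assoc]

theorem IsPath.ne_start {A : FinAutomaton S} (hA : ∀ e, A.tgt e ≠ A.start) {v w : A.V}
    {p : List A.E} (hp : A.IsPath v p w) (hne : p ≠ []) : w ≠ A.start := by
  rcases List.eq_nil_or_concat p with rfl | ⟨q, e, rfl⟩
  · exact absurd rfl hne
  · rw [List.concat_eq_append, isPath_snoc] at hp
    rw [← hp.2]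
    exact hA e

/-- In a deterministic automaton with enough outgoing edges the accepted words branch. -/
theorem isBranching_language {A : FinAutomaton S} (hA : A.IsDeterministic)
    (htgt : ∀ e, A.tgt e ≠ A.start) (hstart : 2 ≤ (A.outEdges A.start).ncard)
    (hstep : ∀ v, v ≠ A.start → 4 ≤ (A.outEdges v).ncard) :
    FreeGroup.IsBranching A.language := by
  have hinj : ∀ v, Set.InjOn A.label (A.outEdges v) := fun v e he e' he' h =>
    hA e e' (Eq.trans he (Eq.symm he')) h
  have := A.finite_E
  refine ⟨⟨[], A.start, rfl, rfl⟩, ?_, ?_⟩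
  · obtain ⟨e, he, e', he', hne⟩ := (Set.one_lt_ncard (Set.toFinite _)).1 hstart
    exact ⟨A.label e, A.label e', fun h => hne (hinj _ he he' h),
      ⟨[e], A.tgt e, ⟨he, rfl⟩, rfl⟩, ⟨[e'], A.tgt e', ⟨he', rfl⟩, rfl⟩⟩
  · rintro _ ⟨p, v, hp, rfl⟩ hne x y
    have hv : v ≠ A.start := hp.ne_start htgt (by simpa using hne)
    -- Four outgoing edges have four labels by determinism, so two survive the exclusion of `x` and
    -- `y`.
    have h1 : 1 < ((A.label '' A.outEdges v) \ {x, y}).ncard := by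
      have h2 := Set.ncard_le_ncard_sdiff_add_ncard (A.label '' A.outEdges v) {x, y}
        (Set.toFinite _)
      have h3 := Set.ncard_insert_le x {y}
      rw [(hinj v).ncard_image] at h2
      rw [Set.ncard_singleton] at h3
      have := hstep v hv
      omega
    obtain ⟨_, ⟨⟨e, he, rfl⟩, hxy⟩, _, ⟨⟨e', he', rfl⟩, hxy'⟩, hne⟩ :=
      (Set.one_lt_ncard (Set.toFinite _)).1 h1
    simp only [Set.mem_insert_iff, Set.mem_singleton_iff, not_or] at hxy hxy'
    refine ⟨_, _, hne, ⟨hxy.1, hxy.2, p ++ [e], A.tgt e, isPath_snoc.2 ⟨?_, rfl⟩, by simp⟩,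
      hxy'.1, hxy'.2, p ++ [e'], A.tgt e', isPath_snoc.2 ⟨?_, rfl⟩, by simp⟩
    · rwa [show A.src e = v from he]
    · rwa [show A.src e' = v from he']

/-- The automaton given by a transition table; the edges are the defined transitions. -/
def ofTable {m : ℕ} (ε : Letter S ≃ Fin m) (N : ℕ)
    (δ : Fin (N + 1) → Letter S → Option (Fin (N + 1))) : FinAutomaton S where
  V := Fin (N + 1)
  -- Letters are replaced by their numbers because the edges must form a type in `Type`, while `S`
  -- may live in any universe.
  E := {q : Fin (N + 1) × Fin m // (δ q.1 (ε.symm q.2)).isSome}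
  finite_V := inferInstance
  finite_E := inferInstance
  src e := e.1.1
  tgt e := (δ e.1.1 (ε.symm e.1.2)).get e.2
  label e := ε.symm e.1.2
  start := 0

section ofTable

variable {m : ℕ} {ε : Letter S ≃ Fin m} {N : ℕ}
  {δ : Fin (N + 1) → Letter S → Option (Fin (N + 1))}

theorem ofTable_transition (e : (ofTable ε N δ).E) :
    δ ((ofTable ε N δ).src e) ((ofTable ε N δ).label e) = some ((ofTable ε N δ).tgt e) :=
  (Option.some_get e.2).symm

theorem exists_ofTable_edge {q q' : Fin (N + 1)} {l : Letter S} (h : δ q l = some q') :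
    ∃ e : (ofTable ε N δ).E, (ofTable ε N δ).src e = q ∧ (ofTable ε N δ).tgt e = q' ∧
      (ofTable ε N δ).label e = l := by
  have h1 : (δ q (ε.symm (ε l))).isSome := by simp [h]
  refine ⟨⟨(q, ε l), h1⟩, rfl, ?_, ε.symm_apply_apply l⟩
  have := ofTable_transition (ε := ε) (δ := δ) ⟨(q, ε l), h1⟩
  apply Option.some_injective
  refine this.symm.trans (Eq.trans ?_ h)
  exact congrArg (δ q) (ε.symm_apply_apply l)

theorem ofTable_isDeterministic : (ofTable ε N δ).IsDeterministic := by
  rintro ⟨⟨q, i⟩, h⟩ ⟨⟨q', i'⟩, h'⟩ h1 h2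
  obtain rfl : q = q' := h1
  obtain rfl : i = i' := ε.symm.injective h2
  rfl

theorem ncard_outEdges_ofTable (q : Fin (N + 1)) {D : Finset (Letter S)}
    (hD : ∀ l, (δ q l).isSome ↔ l ∈ D) : ((ofTable ε N δ).outEdges q).ncard = D.card := by
  have hinj : Set.InjOn (ofTable ε N δ).label ((ofTable ε N δ).outEdges q) :=
    fun e he e' he' h => ofTable_isDeterministic e e' (Eq.trans he (Eq.symm he')) h
  rw [← Set.ncard_coe_finset, ← hinj.ncard_image]
  congr 1
  ext l
  rw [Finset.mem_coe, ← hD, Option.isSome_iff_exists]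
  constructor
  · rintro ⟨e, rfl, rfl⟩
    exact ⟨_, ofTable_transition e⟩
  · rintro ⟨q', h⟩
    obtain ⟨e, h1, -, h3⟩ := exists_ofTable_edge (ε := ε) h
    exact ⟨e, h1, h3⟩

end ofTable

/-- If every transition out of a state preserves a relation between states and points, then so
does every path. -/
theorem IsPath.foldl {A : FinAutomaton S} {Z : Type v} (act : Letter S → Z → Z)
    (I : A.V → Z → Prop) (hI : ∀ e z, I (A.src e) z → I (A.tgt e) (act (A.label e) z))
    {p : List A.E} {v w : A.V} (hp : A.IsPath v p w) {z : Z} (hz : I v z) :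
    I w ((p.map A.label).foldl (fun z l => act l z) z) := by
  induction p generalizing v z with
  | nil => exact (show v = w from hp) ▸ hz
  | cons e p ih => exact ih hp.2 (hI e z (by rwa [hp.1]))

variable [Fintype S]

/-- The states are the sets in `𝒮` and the singletons `{act l x}` reached by one moving letter. A
path ends in a state that contains the image of `x`, and no state contains `x`. Transitions are
thinned to the prescribed number. -/
theorem exists_isSecondForm {m : ℕ} (ε : Letter S ≃ Fin m) {Z : Type v} (act : Letter S → Z → Z)
    (x : Z) (𝒮 : Finset (Set Z)) {N : ℕ} (hN : 𝒮.card + Fintype.card (Letter S) ≤ N)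
    (hx : ∀ K ∈ 𝒮, x ∉ K) {c₁ c₂ : ℝ}
    (h0 : 0 < (1 - c₁) * (Nat.card (Letter S) : ℝ))
    (h1 : (1 - c₁) * (Nat.card (Letter S) : ℝ) ≤ cnt fun l => act l x ≠ x)
    (h2 : ∀ K ∈ 𝒮, c₂ * (Nat.card (Letter S) : ℝ) ≤
      cnt fun l => ∃ K' ∈ 𝒮, ∀ z ∈ K, act l z ∈ K')
    (h3 : ∀ z, c₂ * (Nat.card (Letter S) : ℝ) ≤ cnt fun l => ∃ K' ∈ 𝒮, act l z ∈ K') :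
    ∃ A ∈ Set.range (ofTable ε N), A.IsSecondForm c₁ c₂ ∧
      ∀ w ∈ A.language, w ≠ [] → w.foldl (fun z l => act l z) x ≠ x := by
  obtain ⟨D₀, hDx, hD₀c⟩ := exists_finset_card_eq_ceil h1
  set 𝒯 : Finset (Set Z) := 𝒮 ∪ D₀.image (fun l => {act l x}) with h𝒯
  have h𝒯c : 𝒯.card ≤ N := by
    have e1 := Finset.card_union_le 𝒮 (D₀.image fun l => ({act l x} : Set Z))
    have e2 := Finset.card_image_le (s := D₀) (f := fun l => ({act l x} : Set Z))
    have e3 := D₀.card_le_univ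
    rw [← h𝒯] at e1
    omega
  have h𝒯x : ∀ K ∈ 𝒯, x ∉ K := by
    intro K hK
    rcases Finset.mem_union.1 hK with hK | hK
    · exact hx K hK
    · obtain ⟨l, hl, rfl⟩ := Finset.mem_image.1 hK
      exact fun h => hDx l hl h.symm
  have h𝒯2 : ∀ K : 𝒯, c₂ * (Nat.card (Letter S) : ℝ) ≤
      cnt fun l => ∃ K' ∈ 𝒯, ∀ z ∈ K.1, act l z ∈ K' := by
    rintro ⟨K, hK⟩
    rcases Finset.mem_union.1 hK with hK | hK
    · refine (h2 K hK).trans (cnt_mono ?_)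
      rintro l ⟨K', hK', h⟩
      exact ⟨K', Finset.mem_union_left _ hK', h⟩
    · obtain ⟨l, hl, rfl⟩ := Finset.mem_image.1 hK
      refine (h3 (act l x)).trans (cnt_mono ?_)
      rintro l' ⟨K', hK', h⟩
      exact ⟨K', Finset.mem_union_left _ hK', by simpa using h⟩
  choose D hD hDc using fun K => exists_finset_card_eq_ceil (h𝒯2 K)
  have hDt : ∀ K : 𝒯, ∀ l, ∃ K' : 𝒯, l ∈ D K → ∀ z ∈ K.1, act l z ∈ K'.1 := by
    intro K l
    by_cases hl : l ∈ D K
    · obtain ⟨K', hK', h⟩ := hD K l hl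
      exact ⟨⟨K', hK'⟩, fun _ => h⟩
    · exact ⟨K, fun h => absurd h hl⟩
  choose t ht using hDt
  obtain ⟨l₀, hl₀⟩ := Finset.card_pos.1 (hD₀c ▸ Nat.ceil_pos.2 h0)
  have hstart : ∀ l, ∃ K' : 𝒯, l ∈ D₀ → act l x ∈ K'.1 := by
    intro l
    by_cases hl : l ∈ D₀
    · exact ⟨⟨{act l x}, Finset.mem_union_right _ (Finset.mem_image_of_mem _ hl)⟩,
        fun _ => rfl⟩
    · exact ⟨⟨{act l₀ x}, Finset.mem_union_right _ (Finset.mem_image_of_mem _ hl₀)⟩,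
        fun h => absurd h hl⟩
  choose t₀ ht₀ using hstart
  obtain ⟨κ⟩ : Nonempty (𝒯 ↪ Fin N) :=
    Function.Embedding.nonempty_of_card_le (by simpa using h𝒯c)
  have : Nonempty 𝒯 := ⟨t₀ l₀⟩
  -- The vertex count must not depend on `𝒮`. Superfluous vertices copy a default state, so they too
  -- have the prescribed out-degree.
  set ρ : Fin N → 𝒯 := Function.invFun κ with hρ
  have hρκ : ∀ K, ρ (κ K) = K := Function.leftInverse_invFun κ.injective
  set δ : Fin (N + 1) → Letter S → Option (Fin (N + 1)) :=
    Fin.cases (fun l => if l ∈ D₀ then some (κ (t₀ l)).succ else none)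
      (fun i l => if l ∈ D (ρ i) then some (κ (t (ρ i) l)).succ else none) with hδ
  have hδ0 : ∀ l, δ 0 l = if l ∈ D₀ then some (κ (t₀ l)).succ else none := fun l => rfl
  have hδs : ∀ i l, δ (Fin.succ i) l =
    if l ∈ D (ρ i) then some (κ (t (ρ i) l)).succ else none := fun i l => rfl
  have htgt : ∀ q l q', δ q l = some q' → q' ≠ 0 := by
    intro q l q' h
    cases q using Fin.cases with
    | zero =>
      rw [hδ0] at h
      split_ifs at h
      rw [← Option.some_injective _ h]
      exact Fin.succ_ne_zero _
    | succ i =>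
      rw [hδs] at h
      split_ifs at h
      rw [← Option.some_injective _ h]
      exact Fin.succ_ne_zero _
  refine ⟨ofTable ε N δ, ⟨δ, rfl⟩, ⟨?_, ?_, ?_⟩, ?_⟩
  · refine (ncard_outEdges_ofTable (D := D₀) (0 : Fin (N + 1)) fun l => ?_).trans hD₀c
    rw [hδ0]
    split_ifs with h <;> simp [h]
  · exact fun e _ => htgt _ _ _ (ofTable_transition e)
  · intro v hv
    refine ⟨?_, fun e _ => htgt _ _ _ (ofTable_transition e)⟩
    obtain ⟨i, rfl⟩ := (Fin.exists_succ_eq (n := N) (x := v)).2 hv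
    refine (ncard_outEdges_ofTable (D := D (ρ i)) i.succ fun l => ?_).trans (hDc (ρ i))
    rw [hδs]
    split_ifs with h <;> simp [h]
  · rintro _ ⟨p, v, hp, rfl⟩ hne
    have hv := hp.ne_start (fun e => htgt _ _ _ (ofTable_transition e)) (by simpa using hne)
    obtain ⟨i, rfl⟩ := (Fin.exists_succ_eq (n := N) (x := v)).2 hv
    set I : Fin (N + 1) → Z → Prop := Fin.cases (fun z => z = x) (fun i z => z ∈ (ρ i).1) with hI
    have := IsPath.foldl (A := ofTable ε N δ) act I (fun e z hz => by
      have he := ofTable_transition e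
      generalize (ofTable ε N δ).src e = q at he hz
      generalize (ofTable ε N δ).tgt e = q' at he
      generalize (ofTable ε N δ).label e = l at he
      change Fin (N + 1) at q q'
      cases q using Fin.cases with
      | zero =>
        rw [hδ0] at he
        split_ifs at he with hl
        obtain rfl := Option.some_injective _ he
        obtain rfl : z = x := hz
        show act l z ∈ (ρ (κ (t₀ l))).1
        rw [hρκ]
        exact ht₀ l hl
      | succ i =>
        rw [hδs] at he
        split_ifs at he with hl
        obtain rfl := Option.some_injective _ he
        show act l z ∈ (ρ (κ (t (ρ i) l))).1
        rw [hρκ]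
        exact ht _ _ hl z hz) hp (z := x) rfl
    intro h
    rw [h] at this
    exact h𝒯x _ (ρ i).2 this

/-- The loops carry letters of `F`, in the application the letters fixing a point that `s` moves;
`hs` keeps `s` and its inverse off the loops. -/
theorem exists_isFirstForm {m : ℕ} (ε : Letter S ≃ Fin m) (s : S) (F : Letter S → Prop) {c₁ : ℝ}
    (hs : ∀ b, ¬ F (s, b))
    (hF : c₁ * (Nat.card (Letter S) : ℝ) ≤ cnt F) :
    ∃ A ∈ Set.range (ofTable ε 1), A.IsFirstForm c₁ ∧
      ∀ w ∈ A.language, w ≠ [] → ∃ b w', w = (s, b) :: w' ∧ ∀ l ∈ w', F l := by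
  obtain ⟨D, hDF, hDc⟩ := exists_finset_card_eq_ceil hF
  set δ : Fin 2 → Letter S → Option (Fin 2) :=
    Fin.cases (fun l => if l.1 = s then some 1 else none)
      (fun _ l => if l ∈ D then some 1 else none) with hδ
  have hδ0 : ∀ l, δ 0 l = if l.1 = s then some 1 else none := fun l => rfl
  have hδ1 : ∀ l, δ 1 l = if l ∈ D then some 1 else none := fun l => rfl
  have hcase : ∀ d : (ofTable ε 1 δ).E,
      ((ofTable ε 1 δ).src d = (0 : Fin 2) ∧ ((ofTable ε 1 δ).label d).1 = s ∨
        (ofTable ε 1 δ).src d = (1 : Fin 2) ∧ (ofTable ε 1 δ).label d ∈ D) ∧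
      (ofTable ε 1 δ).tgt d = (1 : Fin 2) := by
    intro d
    have he := ofTable_transition d
    generalize (ofTable ε 1 δ).src d = q at he
    generalize (ofTable ε 1 δ).tgt d = q' at he
    generalize (ofTable ε 1 δ).label d = l at he
    change Fin 2 at q q'
    have hq : q = 0 ∨ q = 1 := by omega
    rcases hq with rfl | rfl
    · rw [hδ0] at he
      split_ifs at he with hl
      exact ⟨Or.inl ⟨rfl, hl⟩, (Option.some_injective _ he).symm⟩
    · rw [hδ1] at he
      split_ifs at he with hl
      exact ⟨Or.inr ⟨rfl, hl⟩, (Option.some_injective _ he).symm⟩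
  have h01 : (0 : Fin 2) ≠ 1 := by decide
  obtain ⟨e, he1, he2, he3⟩ := exists_ofTable_edge (ε := ε) (δ := δ) (q := 0) (q' := 1)
    (l := (s, true)) (by rw [hδ0, if_pos rfl])
  obtain ⟨e', he1', he2', he3'⟩ := exists_ofTable_edge (ε := ε) (δ := δ) (q := 0) (q' := 1)
    (l := (s, false)) (by rw [hδ0, if_pos rfl])
  refine ⟨ofTable ε 1 δ, ⟨δ, rfl⟩, ⟨(1 : Fin 2), s, e, e', h01.symm, ?_, ⟨he1, he2, he3⟩,
    ⟨he1', he2', he3'⟩, ?_, ?_⟩, ?_⟩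
  · intro q
    change Fin 2 at q
    have : q = 0 ∨ q = 1 := by omega
    exact this
  · intro d
    obtain ⟨⟨h1, h2⟩ | ⟨h1, h2⟩, h3⟩ := hcase d
    · obtain ⟨⟨s', b⟩, hl⟩ : ∃ l, (ofTable ε 1 δ).label d = l := ⟨_, rfl⟩
      rw [hl] at h2
      obtain rfl : s' = s := h2
      cases b with
      | true => exact Or.inl (ofTable_isDeterministic _ _ (h1.trans he1.symm) (hl.trans he3.symm))
      | false =>
        exact Or.inr (Or.inl
          (ofTable_isDeterministic _ _ (h1.trans he1'.symm) (hl.trans he3'.symm)))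
    · refine Or.inr (Or.inr ⟨h1, h3, fun hls => ?_⟩)
      apply hs ((ofTable ε 1 δ).label d).2
      rw [← hls]
      exact hDF _ h2
  · refine (ncard_outEdges_ofTable (D := D) (1 : Fin 2) fun l => ?_).trans hDc
    rw [hδ1]
    split_ifs with h <;> simp [h]
  · have hloop : ∀ (p : List (ofTable ε 1 δ).E) (v : (ofTable ε 1 δ).V),
        (ofTable ε 1 δ).IsPath (1 : Fin 2) p v → ∀ d ∈ p, F ((ofTable ε 1 δ).label d) := by
      intro p
      induction p with
      | nil => simp
      | cons d p ih =>
        rintro v ⟨h1, h2⟩ d' hd'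
        obtain ⟨⟨h3, -⟩ | ⟨-, h3⟩, h4⟩ := hcase d
        · exact absurd (h3.symm.trans h1) h01
        · rw [h4] at h2
          rcases List.mem_cons.1 hd' with rfl | hd'
          · exact hDF _ h3
          · exact ih v h2 d' hd'
    rintro _ ⟨_ | ⟨d, p⟩, v, hp, rfl⟩ hne
    · exact absurd rfl hne
    · obtain ⟨h1, h2⟩ := hp
      obtain ⟨⟨-, h3⟩ | ⟨h3, -⟩, h4⟩ := hcase d
      · rw [h4] at h2
        refine ⟨((ofTable ε 1 δ).label d).2, p.map (ofTable ε 1 δ).label, ?_, ?_⟩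
        · rw [← h3]
          rfl
        · intro l hl
          obtain ⟨d', hd', rfl⟩ := List.mem_map.1 hl
          exact hloop p v h2 d' hd'
      · exact absurd (h1.symm.trans h3) h01

end FinAutomaton

end

/-! ### Presented groups and the conclusion. -/

section

open scoped Classical

namespace PresentedGroup

variable {S : Type u}

/-- The element of a presented group given by a letter. -/
def ofLetter (rels : Set (FreeGroup S)) (l : Letter S) : PresentedGroup rels :=
  cond l.2 (of l.1) (of l.1)⁻¹

theorem ofLetter_letterInv (rels : Set (FreeGroup S)) (l : Letter S) :
    ofLetter rels (FreeGroup.letterInv l) = (ofLetter rels l)⁻¹ := by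
  obtain ⟨s, b⟩ := l
  cases b <;> simp [ofLetter, FreeGroup.letterInv]

theorem prod_ofLetter {R : Set (List (Letter S))} {r : List (Letter S)} (hr : r ∈ R) :
    (r.map (ofLetter (FreeGroup.mk '' R))).prod = 1 := by
  have h : mk (FreeGroup.mk '' R) = FreeGroup.lift of := FreeGroup.ext_hom _ _ fun s => by
    rw [FreeGroup.lift_apply_of]
    rfl
  have h1 := one_of_mem (Set.mem_image_of_mem FreeGroup.mk hr)
  rw [h, FreeGroup.lift_mk] at h1
  exact h1

theorem smul_eq_of_ofLetter {rels : Set (FreeGroup S)} {Z : Type v}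
    [MulAction (PresentedGroup rels) Z] {p : Z} (h : ∀ l, ofLetter rels l • p = p)
    (g : PresentedGroup rels) : g • p = p := by
  have : Subgroup.closure (Set.range (of : S → PresentedGroup rels)) ≤
      MulAction.stabilizer (PresentedGroup rels) p := by
    rw [Subgroup.closure_le]
    rintro _ ⟨s, rfl⟩
    exact h (s, true)
  rw [closure_range_of] at this
  exact this (Subgroup.mem_top g)

end PresentedGroup

open PresentedGroup FinAutomaton

variable {S : Type u} [Fintype S]

/-- A set of relators that meets the languages of all automata of the two forms defines a group with
property `FW_n`. -/
theorem hasFW_of_forall_automata (n : ℕ) {m : ℕ} (ε : Letter S ≃ Fin m) {N : ℕ}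
    (hN : n * Fintype.card (Letter S) * (Fintype.card (Letter S) + 1) ^ (n + 1) +
      Fintype.card (Letter S) ≤ N) (R : Set (List (Letter S)))
    (hR : ∀ A : FinAutomaton S, A ∈ Set.range (ofTable ε 1) ∪ Set.range (ofTable ε N) →
      (A.IsFirstForm (DirectionSystem.c₁ n) ∨
        A.IsSecondForm (DirectionSystem.c₁ n) (DirectionSystem.c₂ n)) →
      ∃ r ∈ R, r ≠ [] ∧ r ∈ A.language) :
    HasFW.{v} n (PresentedGroup (FreeGroup.mk '' R)) := by
  intro X hX hdim a
  by_contra hno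
  set ρ := ofLetter (FreeGroup.mk '' R) with hρ
  let _ := a.pointAction
  have hmove : ∀ p : X.Point, ∃ l, ρ l • p ≠ p := by
    intro p
    by_contra! hp
    exact hno ⟨p, fun g => smul_eq_of_ofLetter hp g⟩
  -- Otherwise a first-form automaton for a letter moving `p` yields a relator `s^{±1} w` with `w`
  -- fixing `p`, and then `s` fixes `p`.
  have hfix : ∀ p : X.Point, cnt (fun l => a.smulPoint (ρ l)⁻¹ p = p) <
      DirectionSystem.c₁ n * Fintype.card (Letter S) := by
    intro p
    by_contra! hp
    obtain ⟨⟨s, b₀⟩, hs⟩ := hmove p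
    have hiff : ∀ g : PresentedGroup (FreeGroup.mk '' R), a.smulPoint g⁻¹ p = p ↔ g • p = p :=
      fun g => (show g⁻¹ • p = p ↔ g • p = p from inv_smul_eq_iff.trans eq_comm)
    obtain ⟨A, hA, hform, hacc⟩ := exists_isFirstForm ε s (fun l => a.smulPoint (ρ l)⁻¹ p = p)
      (c₁ := DirectionSystem.c₁ n) (fun b hb => hs (by
        rw [hiff] at hb
        rcases eq_or_ne b b₀ with rfl | hne
        · exact hb
        · have : (s, b₀) = FreeGroup.letterInv (s, b) := by
            cases b <;> cases b₀ <;> simp_all [FreeGroup.letterInv]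
          rw [this, hρ, ofLetter_letterInv, inv_smul_eq_iff]
          exact hb.symm)) (by rwa [Nat.card_eq_fintype_card])
    obtain ⟨r, hr, hne, hrA⟩ := hR A (Or.inl hA) (Or.inl hform)
    obtain ⟨b, w, rfl, hw⟩ := hacc r hrA hne
    have h1 := prod_ofLetter hr
    rw [← hρ, List.map_cons, List.prod_cons] at h1
    have h2 : ∀ w : List (Letter S), (∀ l ∈ w, a.smulPoint (ρ l)⁻¹ p = p) →
        (w.map ρ).prod • p = p := by
      intro w
      induction w with
      | nil => exact fun _ => one_smul _ p
      | cons l w ih =>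
        intro h
        rw [List.map_cons, List.prod_cons, mul_smul,
          ih fun l' hl' => h l' (List.mem_cons_of_mem _ hl')]
        exact (hiff _).1 (h l List.mem_cons_self)
    have h3 : ρ (s, b) • p = p := by
      conv_lhs => rw [← h2 w hw]
      rw [← mul_smul, h1, one_smul]
    apply hs
    rcases eq_or_ne b b₀ with rfl | hne
    · exact h3
    · have : (s, b₀) = FreeGroup.letterInv (s, b) := by
        cases b <;> cases b₀ <;> simp_all [FreeGroup.letterInv]
      rw [this, hρ, ofLetter_letterInv, inv_smul_eq_iff]
      exact h3.symm
  obtain ⟨x₀⟩ := hX.simplyConnected.nonempty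
  obtain ⟨l₀, -⟩ := hmove (Quot.mk _ ⟨0, x₀, Fin.elim0⟩)
  have hm : 0 < Fintype.card (Letter S) := Fintype.card_pos_iff.2 ⟨l₀⟩
  -- Letters act through inverses, since an automaton reads a word from left to right: the
  -- successive actions then compose to the inverse of the element represented by the word.
  obtain ⟨x, 𝒮, hc, hx, hK, hz⟩ := a.exists_states hX hdim hm (fun l => (ρ l)⁻¹)
    FreeGroup.letterInv FreeGroup.letterInv_letterInv
    (fun l => by rw [hρ, ofLetter_letterInv]) hfix
  have hm' : (0 : ℝ) < Fintype.card (Letter S) := by exact_mod_cast hm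
  have hc₁ := DirectionSystem.c₁_lt n
  obtain ⟨A, hA, hform, hacc⟩ := exists_isSecondForm ε (fun l z => a.smul (ρ l)⁻¹ z) x 𝒮 (N := N)
    (by omega) hx (c₁ := DirectionSystem.c₁ n) (c₂ := DirectionSystem.c₂ n)
    (by
      rw [Nat.card_eq_fintype_card]
      exact mul_pos (by linarith) hm')
    (by
      rw [Nat.card_eq_fintype_card]
      have h1 := cnt_le_add (P := fun _ : Letter S => True)
        (Q := fun l => a.smulPoint (ρ l)⁻¹ (Quot.mk _ ⟨0, x, Fin.elim0⟩) =
          Quot.mk _ ⟨0, x, Fin.elim0⟩) (R := fun l => a.smul (ρ l)⁻¹ x ≠ x) (by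
          intro l _
          by_cases hl : a.smul (ρ l)⁻¹ x = x
          · left
            exact congrArg (fun y => Quot.mk _ (⟨0, y, Fin.elim0⟩ : X.PrePoint)) hl
          · exact Or.inr hl)
      rw [cnt_true] at h1
      have h2 := hfix (Quot.mk _ ⟨0, x, Fin.elim0⟩)
      linarith)
    (by rwa [Nat.card_eq_fintype_card]) (by rwa [Nat.card_eq_fintype_card])
  obtain ⟨r, hr, hne, hrA⟩ := hR A (Or.inr hA) (Or.inr hform)
  apply hacc r hrA hne
  have hfold : ∀ (w : List (Letter S)) (z : X.Vertex),
      w.foldl (fun z l => a.smul (ρ l)⁻¹ z) z = a.smul (w.map ρ).prod⁻¹ z := by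
    intro w
    induction w with
    | nil =>
      intro z
      simp [a.one_smul]
    | cons l w ih =>
      intro z
      rw [List.foldl_cons, ih, List.map_cons, List.prod_cons, mul_inv_rev, a.mul_smul]
  rw [hfold, hρ, prod_ofLetter hr, inv_one, a.one_smul]

omit [Fintype S] in
theorem isBranching_of_forms {A : FinAutomaton S} (hA : A.IsDeterministic) {c₁ c₂ : ℝ}
    (h1 : 3 < c₁ * (Nat.card (Letter S) : ℝ)) (h2 : 3 < c₂ * (Nat.card (Letter S) : ℝ))
    (h3 : 1 < (1 - c₁) * (Nat.card (Letter S) : ℝ))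
    (hform : A.IsFirstForm c₁ ∨ A.IsSecondForm c₁ c₂) : FreeGroup.IsBranching A.language := by
  have hceil : ∀ {k : ℕ} {r : ℝ}, (k : ℝ) < r → k + 1 ≤ ⌈r⌉₊ := fun h =>
    Nat.lt_ceil.2 h
  rcases hform with ⟨v, s, e, e', hv, hV, ⟨he1, he2, he3⟩, ⟨he1', he2', he3'⟩, hE, hc⟩ |
    ⟨hc, hs, hstep⟩
  · have := A.finite_E
    refine isBranching_language hA ?_ ?_ ?_
    · intro d
      rcases hE d with rfl | rfl | ⟨-, h, -⟩
      · rwa [he2]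
      · rwa [he2']
      · rwa [h]
    · refine (Set.one_lt_ncard (Set.toFinite _)).2 ⟨e, he1, e', he1', ?_⟩
      rintro rfl
      rw [he3] at he3'
      simp at he3'
    · intro u hu
      obtain rfl := (hV u).resolve_left hu
      rw [hc]
      exact hceil (by exact_mod_cast h1)
  · refine isBranching_language hA ?_ ?_ ?_
    · intro d
      by_cases hd : A.src d = A.start
      · exact hs d hd
      · exact (hstep _ hd).2 d rfl
    · rw [hc]
      exact hceil (by exact_mod_cast h3)
    · intro v hv
      rw [(hstep v hv).1]
      exact hceil (by exact_mod_cast h2)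

end

theorem theorem5p10 (n : ℕ) (hn : 0 < n) :
    ∃ c₁ c₂ : ℝ, 0 < c₁ ∧ c₁ < 1 ∧ 0 < c₂ ∧ c₂ < 1 ∧ ∃ K : ℕ,
      ∀ (S : Type u) [Finite S],
        ∃ Aut : Set (FinAutomaton S), Aut.Finite ∧
          (∀ R : Set (List (Letter S)),
            (∀ A ∈ Aut, ∃ r ∈ R, r ≠ [] ∧ r ∈ A.language) →
              HasFW.{v} n (PresentedGroup (FreeGroup.mk '' R))) ∧
          (∀ A ∈ Aut, A.IsDeterministic ∧ (A.IsFirstForm c₁ ∨ A.IsSecondForm c₁ c₂)) ∧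
          (K ≤ Nat.card (Letter S) → ∀ p : ℝ, 1 ≤ p →
            ∃ r : FinAutomaton S → List (Letter S),
              (∀ A ∈ Aut, r A ∈ A.language) ∧ SmallCancellation (1 / p) (r '' Aut)) := by
  have hc₁ := DirectionSystem.c₁_pos n
  have hc₁' := DirectionSystem.c₁_lt n
  have hc₂ := DirectionSystem.c₂_pos n
  have hc₂' := DirectionSystem.c₂_lt n
  -- With this many letters the out-degrees are at least four on loops and inner vertices and at
  -- least two at the start, as branching requires.
  obtain ⟨K, hK⟩ := exists_nat_gt
    (3 / DirectionSystem.c₁ n + 3 / DirectionSystem.c₂ n + 2)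
  refine ⟨DirectionSystem.c₁ n, DirectionSystem.c₂ n, hc₁, by linarith, hc₂, by linarith, K, ?_⟩
  intro S _
  have := Fintype.ofFinite S
  set ε := Fintype.equivFin (Letter S)
  set N := n * Fintype.card (Letter S) * (Fintype.card (Letter S) + 1) ^ (n + 1) +
    Fintype.card (Letter S) with hN
  -- All automata of the two forms given by tables of two fixed sizes. There are finitely many
  -- tables, and `N` depends only on `n` and the alphabet, so one set serves all `R` and all
  -- actions.
  set Aut : Set (FinAutomaton S) := {A | A ∈ Set.range (FinAutomaton.ofTable ε 1) ∪ Set.range (FinAutomaton.ofTable ε N) ∧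
    A.IsDeterministic ∧ (A.IsFirstForm (DirectionSystem.c₁ n) ∨
      A.IsSecondForm (DirectionSystem.c₁ n) (DirectionSystem.c₂ n))} with hAut
  have hfin : Aut.Finite := ((Set.finite_range (FinAutomaton.ofTable ε 1)).union
    (Set.finite_range (FinAutomaton.ofTable ε N))).subset fun A hA => hA.1
  refine ⟨Aut, hfin, ?_, fun A hA => hA.2, ?_⟩
  · intro R hR
    refine hasFW_of_forall_automata n ε hN.ge R fun A hA hform => hR A ⟨hA, ?_, hform⟩
    rcases hA with ⟨δ, rfl⟩ | ⟨δ, rfl⟩ <;> exact FinAutomaton.ofTable_isDeterministic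
  · intro hm p hp
    have hm' : (K : ℝ) ≤ Nat.card (Letter S) := by exact_mod_cast hm
    have e1 : 0 < 3 / DirectionSystem.c₁ n := by positivity
    have e2 : 0 < 3 / DirectionSystem.c₂ n := by positivity
    have h1 : 3 < DirectionSystem.c₁ n * (Nat.card (Letter S) : ℝ) := by
      rw [← div_lt_iff₀' hc₁]
      linarith
    have h2 : 3 < DirectionSystem.c₂ n * (Nat.card (Letter S) : ℝ) := by
      rw [← div_lt_iff₀' hc₂]
      linarith
    have h3 : 1 < (1 - DirectionSystem.c₁ n) * (Nat.card (Letter S) : ℝ) := by nlinarith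
    obtain ⟨r, hr, hS⟩ := FreeGroup.exists_smallCancellation hfin.toFinset
      FinAutomaton.language (fun A hA =>
        isBranching_of_forms ((hfin.mem_toFinset.1 hA).2.1) h1 h2 h3 (hfin.mem_toFinset.1 hA).2.2)
      hp
    refine ⟨r, fun A hA => hr A (hfin.mem_toFinset.2 hA), ?_⟩
    rwa [Set.Finite.coe_toFinset] at hS
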